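/- **Theorem (squared multiplicity of rational tropical curves as a $2$-dimensional tropical quantum field theory).** *Lattices.* Let $N$ be a lattice of finite rank $r\ge 0$, $M=\operatorname{Hom}(N,\mathbb Z)$ and $N_{\mathbb R}=N\otimes\mathbb R$. For $n\in N$ let $|n|$ be its index (the largest $k$ with $n\in kN$ if $n\neq 0$; $|0|=0$) and $M_n=n^\perp\subset M$. For a lattice $L$ and $\alpha\in\Lambda^kL$ put $\alpha^\Box=(-1)^{k(k-1)/2}(\alpha,0)\wedge(0,\alpha)\in\Lambda^*(L\oplus L)$, so that $(a_1\wedge\dots\wedge a_k)^\Box=\bigwedge_i (a_i,0)\wedge(0,a_i)$. *The theory $F^\Box_{\mathrm{Mult}}$.* For $n\in \overline N:=N/\{\pm1\}$ let $C_n\subset\Lambda^*(M_n\oplus M_n)\otimes\mathbb Q\subset \Lambda^*(M\oplus M)\otimes\mathbb Q$ be the commutative $\mathbb Q$-subalgebra generated by all $\alpha^\Box$ with $\alpha\in\Lambda^*M_n$ simple. Let $\kappa_n:C_n\to C_0$ be the inclusion, and let $\kappa_n^\vee:C_0\to C_n$ be contraction by $(n,0)\wedge(0,n)$ if $n\ne0$,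 and the identity if $n=0$. Let $\operatorname{Tr}_0:C_0\to\mathbb Q$ be the projection to top degree normalised by $\Theta_M^\Box\mapsto 1$ ($\Theta_M$ a generator of $\Lambda^rM$), and for $n\neq0$ let $\operatorname{Tr}_n:C_n\to\mathbb Q$ be the projection to top degree normalised by $\kappa_n^\vee(\Theta_M^\Box)\mapsto1$. Each $C_n$ is a commutative Frobenius algebra, and $\operatorname{Tr}_n(\kappa_n^\vee(a)b)=\operatorname{Tr}_0(a\,\kappa_n(b))$. Let $\Gamma$ be a finite graph whose edges carry directions in $\overline N$ and whose vertices carry genera, with non-compact edges (legs) $i\in I$ of direction $\Delta(i)$. Then $F^\Box_{\mathrm{Mult}}(\Gamma):\bigotimes_{i\in I}C_{\Delta(i)}\to\mathbb Q$ is computed along a tropical flow: an acyclic orientation of the graph obtained from $\Gamma$ by inserting a vertex in the middle of every edge and closing every leg by an outer end, such that the outer ends are sources. The arguments are inserted at the outer ends. At a vertex of $\Gamma$ of genus $g$, one applies $\kappa$ on each incoming half-edge, multiplies in $C_0$, multiplies by the $g$-th power of the handle element (product $\circ$ coproduct of $1$), applies the iterated coproduct of $C_0$ (the trace if nothing flows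 out), and applies $\kappa^\vee$ on each outgoing half-edge. In the middle of an edge of direction $n$, one applies the trace pairing $\operatorname{Tr}_n(ab)$ if it is a sink, the cotrace (coproduct of $1$ in $C_n$) if it is a source, and the identity otherwise. *Tropical curves.* A tropical curve $\Gamma$ is a finite connected graph with at least one vertex, with compact edges and with non-compact edges $E_i$ marked by a finite set $I$, with weights $w(E)\in\mathbb Z_{\ge0}$ and genera $g(V)\in\mathbb Z_{\geq 0}$ ($>0$ at univalent and bivalent vertices), and a map $h:\Gamma\to N_{\mathbb R}$ that is a proper embedding into a line of rational slope on edges of positive weight, constant on edges of weight $0$, and balanced at all vertices ($\sum_{E\ni V}w(E)u_{(V,E)}=0$, where $u_{(V,E)}$ is the primitive integral vector from $h(V)$ into $h(E)$, and $0$ if $w(E)=0$). Its genus is $g=b_1(\Gamma)+\sum_Vg(V)$, its degree is $\Delta(i)=w(E_i)u_{E_i}$, and the over-valence is $\operatorname{ov}(V)=\operatorname{val}(V)+3g(V)-3$. The expected dimension is $d=\#I+(r-3)(1-g)-\sum_V\operatorname{ov}(V)$. $\Gamma$ is non-superabundant if it has no contracted loops and no vertices of positive genus, and the space of curves of its combinatorial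 type has dimension $d$. Let $A=(A_i)_{i\in I}$ be affine subspaces of $N_{\mathbb R}$ of rational slope, with weights $w_i\in\mathbb Z_{\geq 1}$, and let $\Psi=(s_i)$ be non-negative integers, indexed by the $i$ with $w(E_i)=0$. $\Gamma$ is called rigid if it is non-superabundant, $h(E_i)\subset A_i$ for all $i$, $\operatorname{ov}(V)\ge\sum_{E_i\ni V,\,w(E_i)=0}s_i$ for all $V$, and $\sum_i\operatorname{codim}A_i=d$. (No genericity of $A$ is needed.) Let $\operatorname{Mult}(\Gamma)=D\cdot\prod_{E\text{ compact}}w(E)\cdot\prod_{i\in I}w_i$, where $D$ is the index of the image of $$\prod_VN\to\prod_{E\text{ compact}}N/(N\cap \mathbb Ru_E)\times\prod_{i\in I}N/(N\cap L(A_i)),\qquad H\mapsto\big((H_{\partial^+E}-H_{\partial^-E})_E,(H_{\partial E_i})_i\big),$$ with $L(A_i)$ the linear space parallel to $A_i$, and $D=0$ if this index is infinite. *Statement.* Let $\Gamma$ be a rigid tropical curve of genus $0$. For each $i\in I$ let $\alpha_i\in\Lambda^{\operatorname{codim}A_i}M$ be the element, unique up to sign, which has index $w_i$ and is trivial along $A_i$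 (all contractions with vectors of $N\cap L(A_i)$ vanish). Then $\alpha_i^\Box\in C_{\Delta(i)}$ for all $i$, and for $\gamma=\bigotimes_{i\in I}\alpha_i^\Box$ $$\operatorname{Mult}(\Gamma)^2=F^\Box_{\mathrm{Mult}}(\Gamma)(\gamma),$$ whichever tropical flow on $\Gamma$ is used to compute the right-hand side. -/

import Mathlib

noncomputable section

namespace TropQFT
open Module
open scoped TensorProduct

set_option linter.unusedSectionVars false

/-- The exterior algebra `Λ(V ⊕ V)` of a rational vector space `V`. -/
abbrev DExt (V : Type*) [AddCommGroup V] [Module ℚ V] := ExteriorAlgebra ℚ (V × V)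

section Alg
variable {V : Type*} [AddCommGroup V] [Module ℚ V]

/-- The generator `(v, 0)` of `Λ(V ⊕ V)`. -/
def xx (v : V) : DExt V := ExteriorAlgebra.ι ℚ (v, 0)
/-- The generator `(0, v)` of `Λ(V ⊕ V)`. -/
def yy (v : V) : DExt V := ExteriorAlgebra.ι ℚ (0, v)
/-- The square `(v, 0) ∧ (0, v)`. -/
def sq (v : V) : DExt V := xx v * yy v

/-- Contraction by `(φ, 0)`. -/
def dX (φ : V →ₗ[ℚ] ℚ) : DExt V →ₗ[ℚ] DExt V :=
  CliffordAlgebra.contractLeft (φ ∘ₗ LinearMap.fst ℚ V V)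
/-- Contraction by `(0, φ)`. -/
def dY (φ : V →ₗ[ℚ] ℚ) : DExt V →ₗ[ℚ] DExt V :=
  CliffordAlgebra.contractLeft (φ ∘ₗ LinearMap.snd ℚ V V)

theorem swap (a b : V × V) : ExteriorAlgebra.ι ℚ a * ExteriorAlgebra.ι ℚ b
    = - (ExteriorAlgebra.ι ℚ b * ExteriorAlgebra.ι ℚ a) :=
  eq_neg_of_add_eq_zero_left (ExteriorAlgebra.ι_add_mul_swap a b)

theorem xx_xx (v w : V) : xx v * xx w = - (xx w * xx v) := swap _ _
theorem xx_yy (v w : V) : xx v * yy w = - (yy w * xx v) := swap _ _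
theorem yy_xx (v w : V) : yy v * xx w = - (xx w * yy v) := swap _ _
theorem yy_yy (v w : V) : yy v * yy w = - (yy w * yy v) := swap _ _
theorem xx_self (v : V) : xx v * xx v = 0 := ExteriorAlgebra.ι_sq_zero _
theorem yy_self (v : V) : yy v * yy v = 0 := ExteriorAlgebra.ι_sq_zero _

theorem ι_sq_comm (a : V × V) (v : V) :
    ExteriorAlgebra.ι ℚ a * sq v = sq v * ExteriorAlgebra.ι ℚ a := by
  unfold sq xx yy
  rw [← mul_assoc, swap a, neg_mul, mul_assoc, swap a, mul_neg, neg_neg, mul_assoc]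

theorem sq_comm (v w : V) : sq v * sq w = sq w * sq v := by
  conv_lhs => rw [show sq v = xx v * yy v from rfl]
  rw [mul_assoc, yy, ι_sq_comm, ← mul_assoc, xx, ι_sq_comm, mul_assoc]; rfl

theorem xx_add (v w : V) : xx (v + w) = xx v + xx w := by
  unfold xx; rw [← map_add]; simp
theorem yy_add (v w : V) : yy (v + w) = yy v + yy w := by
  unfold yy; rw [← map_add]; simp
theorem xx_smul (c : ℚ) (v : V) : xx (c • v) = c • xx v := by
  unfold xx; rw [← map_smul]; simp
theorem yy_smul (c : ℚ) (v : V) : yy (c • v) = c • yy v := by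
  unfold yy; rw [← map_smul]; simp

theorem sq_smul (c : ℚ) (v : V) : sq (c • v) = c ^ 2 • sq v := by
  simp only [sq, xx_smul, yy_smul, smul_mul_smul_comm, pow_two]

theorem sq_add_smul_mul (u v : V) (t : ℚ) : sq (u + t • v) * sq v = sq u * sq v := by
  have h1 : xx v * sq v = 0 := by unfold sq; rw [← mul_assoc, xx_self, zero_mul]
  have h2 : yy v * sq v = 0 := by
    have := ι_sq_comm (0, v) v
    change yy v * sq v = sq v * yy v at this
    rw [this]; unfold sq; rw [mul_assoc, yy_self, mul_zero]
  have h3 : xx v * yy u * sq v = 0 := by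
    rw [xx_yy, neg_mul, mul_assoc, h1, mul_zero, neg_zero]
  rw [sq, xx_add, yy_add, xx_smul, yy_smul, mul_add, add_mul, add_mul]
  simp only [smul_mul_assoc, mul_smul_comm, add_mul, mul_assoc, h2, mul_zero, smul_zero,
    add_zero]
  rw [← mul_assoc (xx v), h3, smul_zero, add_zero, sq, sq, mul_assoc]

theorem dX_xx (φ : V →ₗ[ℚ] ℚ) (v : V) (p : DExt V) :
    dX φ (xx v * p) = φ v • p - xx v * dX φ p := CliffordAlgebra.contractLeft_ι_mul _ _ _
theorem dX_yy (φ : V →ₗ[ℚ] ℚ) (v : V) (p : DExt V) :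
    dX φ (yy v * p) = - (yy v * dX φ p) := by
  have := CliffordAlgebra.contractLeft_ι_mul (Q := (0 : QuadraticForm ℚ (V × V)))
    (φ ∘ₗ LinearMap.fst ℚ V V) (0, v) p
  rw [show (φ ∘ₗ LinearMap.fst ℚ V V) (0, v) = 0 by simp, zero_smul, zero_sub] at this
  exact this
theorem dY_yy (φ : V →ₗ[ℚ] ℚ) (v : V) (p : DExt V) :
    dY φ (yy v * p) = φ v • p - yy v * dY φ p := CliffordAlgebra.contractLeft_ι_mul _ _ _
theorem dY_xx (φ : V →ₗ[ℚ] ℚ) (v : V) (p : DExt V) :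
    dY φ (xx v * p) = - (xx v * dY φ p) := by
  have := CliffordAlgebra.contractLeft_ι_mul (Q := (0 : QuadraticForm ℚ (V × V)))
    (φ ∘ₗ LinearMap.snd ℚ V V) (v, 0) p
  rw [show (φ ∘ₗ LinearMap.snd ℚ V V) (v, 0) = 0 by simp, zero_smul, zero_sub] at this
  exact this
theorem dX_sq (φ : V →ₗ[ℚ] ℚ) (v : V) (p : DExt V) :
    dX φ (sq v * p) = φ v • (yy v * p) + sq v * dX φ p := by
  rw [sq, mul_assoc, dX_xx, dX_yy, mul_neg, sub_neg_eq_add, mul_assoc]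
theorem dY_sq (φ : V →ₗ[ℚ] ℚ) (v : V) (p : DExt V) :
    dY φ (sq v * p) = - (φ v • (xx v * p)) + sq v * dY φ p := by
  rw [sq, mul_assoc, dY_xx, dY_yy, mul_sub, mul_smul_comm, mul_assoc]; abel
theorem dX_one (φ : V →ₗ[ℚ] ℚ) : dX φ 1 = 0 := CliffordAlgebra.contractLeft_one _ _
theorem dY_one (φ : V →ₗ[ℚ] ℚ) : dY φ 1 = 0 := CliffordAlgebra.contractLeft_one _ _

/-- The product of the squares of a list of vectors. -/
def sqProd (l : List V) : DExt V := (l.map sq).prod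

@[simp] theorem sqProd_nil : sqProd ([] : List V) = 1 := rfl
@[simp] theorem sqProd_cons (v : V) (l : List V) : sqProd (v :: l) = sq v * sqProd l := by
  simp [sqProd]
@[simp] theorem sqProd_append (l l' : List V) : sqProd (l ++ l') = sqProd l * sqProd l' := by
  simp [sqProd]

theorem d_sqProd_ker (φ : V →ₗ[ℚ] ℚ) (l : List V) (h : ∀ v ∈ l, φ v = 0) :
    dX φ (sqProd l) = 0 ∧ dY φ (sqProd l) = 0 := by
  induction l with
  | nil => exact ⟨dX_one φ, dY_one φ⟩
  | cons v l ih =>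
    obtain ⟨h1, h2⟩ := ih fun u hu => h u (by simp [hu])
    simp [dX_sq, dY_sq, h1, h2, h v (by simp)]

/-- Contraction by `(φ, 0) ∧ (0, φ)`; it sends `(v, 0) ∧ (0, v)` to `φ v ^ 2`. -/
def dD (φ : V →ₗ[ℚ] ℚ) : DExt V →ₗ[ℚ] DExt V := dY φ ∘ₗ dX φ

theorem dD_ker (φ : V →ₗ[ℚ] ℚ) (l : List V) (h : ∀ v ∈ l, φ v = 0) : dD φ (sqProd l) = 0 := by
  simp [dD, (d_sqProd_ker φ l h).1]

theorem dD_cons_ker (φ : V →ₗ[ℚ] ℚ) (v : V) (l : List V) (h : ∀ u ∈ l, φ u = 0) :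
    dD φ (sq v * sqProd l) = φ v ^ 2 • sqProd l := by
  obtain ⟨h1, h2⟩ := d_sqProd_ker φ l h
  simp [dD, dX_sq, dY_yy, h1, h2, smul_smul, pow_two]

theorem normal_form (φ : V →ₗ[ℚ] ℚ) (l : List V) :
    (∀ v ∈ l, φ v = 0) ∨ ∃ v l', (∀ u ∈ l', φ u = 0) ∧ sqProd l = sq v * sqProd l' ∧
      l.length = l'.length + 1 := by
  induction l with
  | nil => left; simp
  | cons u t ih =>
    by_cases hu : φ u = 0
    · rcases ih with h | ⟨v, l', h1, h2, h3⟩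
      · left; simpa [hu] using h
      · refine Or.inr ⟨v, u :: l', by simpa [hu] using h1, ?_, by simp [h3]⟩
        rw [sqProd_cons, sqProd_cons, h2, ← mul_assoc, ← mul_assoc, sq_comm]
    · rcases ih with h | ⟨v, l', h1, h2, h3⟩
      · exact Or.inr ⟨u, t, h, by simp, rfl⟩
      · refine Or.inr ⟨u, (v + (-(φ v / φ u)) • u) :: l', ?_, ?_, by simp [h3]⟩
        · simp only [List.mem_cons, forall_eq_or_imp]
          refine ⟨?_, h1⟩
          simp; field_simp; ring
        · rw [sqProd_cons, sqProd_cons, h2, ← mul_assoc, ← mul_assoc, sq_comm u (v + _),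
            sq_add_smul_mul, sq_comm]

/-- The rational subalgebra generated by squares. -/
def box (V : Type*) [AddCommGroup V] [Module ℚ V] : Subalgebra ℚ (DExt V) :=
  Algebra.adjoin ℚ (Set.range sq)

theorem box_eq_span : Subalgebra.toSubmodule (box V) = Submodule.span ℚ (Set.range sqProd) := by
  rw [box, Algebra.adjoin_eq_span]
  congr 1
  ext x
  constructor
  · intro hx
    obtain ⟨l, hl, rfl⟩ := Submonoid.exists_list_of_mem_closure hx
    choose! f hf using hl
    refine ⟨l.map f, ?_⟩
    rw [sqProd, List.map_map]
    congr 1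
    conv_rhs => rw [← List.map_id l]
    exact List.map_congr_left fun a ha => hf a ha
  · rintro ⟨l, rfl⟩
    refine Submonoid.list_prod_mem _ fun x hx => ?_
    obtain ⟨v, -, rfl⟩ := List.mem_map.1 hx
    exact Submonoid.subset_closure ⟨v, rfl⟩

theorem sqProd_mem (l : List V) : sqProd l ∈ box V := by
  rw [← Subalgebra.mem_toSubmodule, box_eq_span]; exact Submodule.subset_span ⟨l, rfl⟩

theorem box_induction {p : DExt V → Prop} (h0 : p 0) (ha : ∀ x y, p x → p y → p (x + y))
    (hs : ∀ (c : ℚ) x, p x → p (c • x)) (hl : ∀ l, p (sqProd l)) {x : DExt V}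
    (hx : x ∈ box V) : p x := by
  rw [← Subalgebra.mem_toSubmodule, box_eq_span] at hx
  induction hx using Submodule.span_induction with
  | mem x h => obtain ⟨l, rfl⟩ := h; exact hl l
  | zero => exact h0
  | add x y _ _ h1 h2 => exact ha _ _ h1 h2
  | smul c x _ h => exact hs c x h

section map
variable {V' : Type*} [AddCommGroup V'] [Module ℚ V'] (j : V' →ₗ[ℚ] V)

/-- The algebra map on `Λ(V ⊕ V)` induced by a linear map to another vector space. -/
def dmap : DExt V' →ₐ[ℚ] DExt V := ExteriorAlgebra.map (j.prodMap j)

theorem dmap_sq (v : V') : dmap j (sq v) = sq (j v) := by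
  simp [dmap, sq, xx, yy]

theorem dmap_sqProd (l : List V') : dmap j (sqProd l) = sqProd (l.map j) := by
  induction l with
  | nil => simp
  | cons v l ih => simp [ih, dmap_sq]

theorem dmap_injective (hj : Function.Injective j) : Function.Injective (dmap j) :=
  ExteriorAlgebra.map_injective_field (by
    rw [LinearMap.ker_eq_bot]; exact Function.Injective.prodMap hj hj)

theorem dmap_mem {x : DExt V'} (hx : x ∈ box V') : dmap j x ∈ box V := by
  refine box_induction (p := fun x => dmap j x ∈ box V) ?_ ?_ ?_ ?_ hx
  · simp
  · intro x y hx hy; rw [map_add]; exact add_mem hx hy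
  · intro c x hx; rw [map_smul]; exact Subalgebra.smul_mem _ hx c
  · intro l; rw [dmap_sqProd]; exact sqProd_mem _

theorem exists_lift {φ : V →ₗ[ℚ] ℚ} (hk : LinearMap.range j = LinearMap.ker φ) (l : List V)
    (h : ∀ u ∈ l, φ u = 0) : ∃ l₀ : List V', l = l₀.map j := by
  have : ∀ u ∈ l, ∃ w, j w = u := fun u hu => by
    have : u ∈ LinearMap.range j := by rw [hk]; exact h u hu
    exact this
  choose! f hf using this
  refine ⟨l.map f, ?_⟩
  rw [List.map_map]
  conv_lhs => rw [← List.map_id l]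
  exact List.map_congr_left fun a ha => (hf a ha).symm

/-- Contraction sends box to box of the kernel. -/
theorem dD_mem {φ : V →ₗ[ℚ] ℚ} (hk : LinearMap.range j = LinearMap.ker φ) {x : DExt V}
    (hx : x ∈ box V) : ∃ y ∈ box V', dmap j y = dD φ x := by
  refine box_induction (p := fun x => ∃ y ∈ box V', dmap j y = dD φ x) ?_ ?_ ?_ ?_ hx
  · exact ⟨0, zero_mem _, by simp⟩
  · rintro x y ⟨a, ha, h1⟩ ⟨b, hb, h2⟩; exact ⟨a + b, add_mem ha hb, by simp [h1, h2]⟩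
  · rintro c x ⟨a, ha, h1⟩; exact ⟨c • a, Subalgebra.smul_mem _ ha c, by simp [h1]⟩
  · intro l
    rcases normal_form φ l with h | ⟨v, l', h1, h2, -⟩
    · exact ⟨0, zero_mem _, by simp [dD_ker φ l h]⟩
    · obtain ⟨l₀, rfl⟩ := exists_lift j hk l' h1
      refine ⟨φ v ^ 2 • sqProd l₀, Subalgebra.smul_mem _ (sqProd_mem _) _, ?_⟩
      rw [h2, dD_cons_ker _ _ _ h1, map_smul, dmap_sqProd]

end map

/-- The coordinates of a vector of `V ⊕ V` in the basis
`(e₀, 0), (0, e₀), (e₁, 0), (0, e₁), …`. -/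
def traceCoords {d : ℕ} (e : Basis (Fin d) ℚ V) : V × V →ₗ[ℚ] (Fin (d * 2) → ℚ) :=
  LinearMap.pi fun t =>
    if (finProdFinEquiv.symm t).2 = 0 then e.coord (finProdFinEquiv.symm t).1 ∘ₗ LinearMap.fst ℚ V V
    else e.coord (finProdFinEquiv.symm t).1 ∘ₗ LinearMap.snd ℚ V V

/-- Projection to the top degree of `Λ(V ⊕ V)`, followed by the isomorphism with `ℚ` that sends
`⋀ᵢ (eᵢ, 0) ∧ (0, eᵢ)` to `1`. -/
def traceOf {d : ℕ} (e : Basis (Fin d) ℚ V) : DExt V →ₗ[ℚ] ℚ :=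
  ExteriorAlgebra.liftAlternating
    (Pi.single (d * 2) (Matrix.detRowAlternating.compLinearMap (traceCoords e)))

/-- The sequence `(a₀, 0), (0, a₀), (a₁, 0), (0, a₁), …`. -/
def dvec {m : ℕ} (a : Fin m → V) (t : Fin (m * 2)) : V × V :=
  if (finProdFinEquiv.symm t).2 = 0 then (a (finProdFinEquiv.symm t).1, 0)
  else (0, a (finProdFinEquiv.symm t).1)

theorem ιMulti_dvec {m : ℕ} (a : Fin m → V) :
    ExteriorAlgebra.ιMulti ℚ (m * 2) (dvec a) = sqProd (List.ofFn a) := by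
  rw [ExteriorAlgebra.ιMulti_apply, List.ofFn_mul, List.prod_flatten, sqProd, List.map_ofFn,
    List.map_ofFn]
  congr 2
  funext i
  have key : ∀ c : Fin 2, ∀ n (h : n < m * 2), n = i * 2 + c →
      finProdFinEquiv.symm (⟨n, h⟩ : Fin (m * 2)) = (i, c) := by
    intro c n h hn
    rw [Equiv.symm_apply_eq]
    ext
    simp [finProdFinEquiv, hn]; ring
  simp only [Function.comp, List.ofFn_succ, List.ofFn_zero, List.prod_cons, List.prod_nil, mul_one,
    dvec]
  rw [key 0 _ _ (by simp), key 1 _ _ (by simp)]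
  simp [sq, xx, yy]

theorem traceOf_sqProd_ofFn {d : ℕ} (e : Basis (Fin d) ℚ V) (a : Fin d → V) :
    traceOf e (sqProd (List.ofFn a)) = (Matrix.of fun i j => e.repr (a i) j).det ^ 2 := by
  rw [← ιMulti_dvec, traceOf, ExteriorAlgebra.liftAlternating_apply_ιMulti, Pi.single_eq_same,
    AlternatingMap.compLinearMap_apply]
  change Matrix.det (Matrix.of fun s t => traceCoords e (dvec a s) t) = _
  have : (Matrix.of fun s t => traceCoords e (dvec a s) t) =
      (Matrix.kroneckerMap (· * ·) (Matrix.of fun i j => e.repr (a i) j)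
        (1 : Matrix (Fin 2) (Fin 2) ℚ)).submatrix finProdFinEquiv.symm finProdFinEquiv.symm := by
    ext s t
    obtain ⟨⟨i, c⟩, rfl⟩ := finProdFinEquiv.surjective s
    obtain ⟨⟨j, c'⟩, rfl⟩ := finProdFinEquiv.surjective t
    simp only [Matrix.of_apply, traceCoords, dvec, LinearMap.pi_apply, Equiv.symm_apply_apply,
      Matrix.submatrix_apply, Matrix.kroneckerMap_apply]
    fin_cases c <;> fin_cases c' <;> simp
  rw [this, Matrix.det_submatrix_equiv_self, Matrix.det_kronecker]
  simp

theorem traceOf_sqProd_ne {d : ℕ} (e : Basis (Fin d) ℚ V) (l : List V) (h : l.length ≠ d) :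
    traceOf e (sqProd l) = 0 := by
  obtain ⟨m, a, rfl⟩ : ∃ m, ∃ a : Fin m → V, l = List.ofFn a := ⟨_, l.get, (List.ofFn_get l).symm⟩
  rw [← ιMulti_dvec, traceOf, ExteriorAlgebra.liftAlternating_apply_ιMulti, Pi.single_eq_of_ne]
  · rfl
  · intro h'; apply h; simp; omega

theorem traceOf_change {d : ℕ} (e b : Basis (Fin d) ℚ V) {x : DExt V} (hx : x ∈ box V) :
    traceOf e x = (e.toMatrix b).det ^ 2 * traceOf b x := by
  refine box_induction (p := fun x => traceOf e x = (e.toMatrix b).det ^ 2 * traceOf b x)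
    ?_ ?_ ?_ ?_ hx
  · simp
  · intro x y h1 h2; rw [map_add, map_add, h1, h2, mul_add]
  · intro c x h; rw [map_smul, map_smul, h, smul_eq_mul, smul_eq_mul]; ring
  · intro l
    by_cases h : l.length = d
    · obtain ⟨a, rfl⟩ : ∃ a : Fin d → V, l = List.ofFn a := by
        subst h; exact ⟨l.get, (List.ofFn_get l).symm⟩
      rw [traceOf_sqProd_ofFn, traceOf_sqProd_ofFn, ← mul_pow, ← Matrix.det_transpose,
        ← Matrix.det_transpose (Matrix.of _), ← Matrix.det_mul]
      congr 2
      have := Basis.toMatrix_mul_toMatrix e b a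
      ext i j
      have := congrFun (congrFun this i) j
      simpa [Basis.toMatrix_apply, Matrix.mul_apply] using this.symm
    · rw [traceOf_sqProd_ne _ _ h, traceOf_sqProd_ne _ _ h, mul_zero]

/-! The Casimir-type operator -/
section casimir
variable {d : ℕ} (b : Basis (Fin d) ℚ V)

theorem sum_yy (v : V) (p : DExt V) : ∑ i, yy (b i) * (b.coord i v • p) = yy v * p := by
  conv_rhs => rw [← b.sum_repr v]
  simp only [yy, mul_smul_comm, ← smul_mul_assoc, ← map_smul, ← Finset.sum_mul, ← map_sum]
  congr 2
  simp [Prod.ext_iff, Prod.fst_sum, Prod.snd_sum]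

theorem sum_xx (v : V) (p : DExt V) : ∑ i, xx (b i) * (b.coord i v • p) = xx v * p := by
  conv_rhs => rw [← b.sum_repr v]
  simp only [xx, mul_smul_comm, ← smul_mul_assoc, ← map_smul, ← Finset.sum_mul, ← map_sum]
  congr 2
  simp [Prod.ext_iff, Prod.fst_sum, Prod.snd_sum]

theorem yy_sq (v w : V) (p : DExt V) : yy v * (sq w * p) = sq w * (yy v * p) := by
  rw [← mul_assoc, yy, ι_sq_comm, mul_assoc]
theorem xx_sq (v w : V) (p : DExt V) : xx v * (sq w * p) = sq w * (xx v * p) := by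
  rw [← mul_assoc, xx, ι_sq_comm, mul_assoc]

theorem J_sqProd (l : List V) : ∑ i, yy (b i) * dX (b.coord i) (sqProd l) = 0 := by
  induction l with
  | nil => simp [dX_one]
  | cons v l ih =>
    simp only [sqProd_cons, dX_sq, mul_add, Finset.sum_add_distrib, sum_yy, yy_sq,
      ← Finset.mul_sum, ih]
    rw [← mul_assoc, yy_self, zero_mul, mul_zero, add_zero]

theorem NX_sqProd (l : List V) :
    ∑ i, xx (b i) * dX (b.coord i) (sqProd l) = (l.length : ℚ) • sqProd l := by
  induction l with
  | nil => simp [dX_one]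
  | cons v l ih =>
    simp only [sqProd_cons, dX_sq, mul_add, Finset.sum_add_distrib, sum_xx, xx_sq,
      ← Finset.mul_sum, ih]
    rw [← mul_assoc, ← sq, mul_smul_comm, List.length_cons]
    push_cast
    rw [add_smul, one_smul, add_comm]

theorem NY_sqProd (l : List V) :
    ∑ i, yy (b i) * dY (b.coord i) (sqProd l) = (l.length : ℚ) • sqProd l := by
  induction l with
  | nil => simp [dY_one]
  | cons v l ih =>
    simp only [sqProd_cons, dY_sq, mul_add, Finset.sum_add_distrib, sum_yy, yy_sq, mul_neg,
      Finset.sum_neg_distrib, ← Finset.mul_sum, ih]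
    rw [← mul_assoc, yy_xx, neg_mul, neg_neg, ← sq, mul_smul_comm, List.length_cons]
    push_cast
    rw [add_smul, one_smul, add_comm]

/-- An auxiliary operator, used only to prove that the trace pairing is nondegenerate. -/
def casimir : DExt V →ₗ[ℚ] DExt V :=
  ∑ i, ∑ j, LinearMap.mulLeft ℚ (xx (b i) * yy (b j)) ∘ₗ
    (dY (b.coord i) ∘ₗ dX (b.coord j) + dY (b.coord j) ∘ₗ dX (b.coord i))

theorem dY_dX (φ ψ : V →ₗ[ℚ] ℚ) (x : DExt V) : dY φ (dX ψ x) = - dX ψ (dY φ x) :=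
  CliffordAlgebra.contractLeft_comm _ _ _

theorem casimir_sqProd (l : List V) :
    casimir b (sqProd l) = ((l.length : ℚ) * (l.length + 1)) • sqProd l := by
  have h1 : ∀ i, ∑ j, yy (b j) * dY (b.coord i) (dX (b.coord j) (sqProd l))
      = dX (b.coord i) (sqProd l) := by
    intro i
    have : ∀ j z, yy (b j) * dY (b.coord i) z = b.coord i (b j) • z
        - dY (b.coord i) (yy (b j) * z) := by intro j z; rw [dY_yy]; abel
    simp only [this, Finset.sum_sub_distrib, ← map_sum, J_sqProd, map_zero, sub_zero]
    rw [Finset.sum_eq_single i]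
    · simp
    · intro j _ hj; simp [hj]
    · simp
  have h2 : ∀ i, ∑ j, yy (b j) * dY (b.coord j) (dX (b.coord i) (sqProd l))
      = (l.length : ℚ) • dX (b.coord i) (sqProd l) := by
    intro i
    rw [← map_smul, ← NY_sqProd b l, map_sum]
    refine Finset.sum_congr rfl fun j _ => ?_
    rw [dX_yy, dY_dX, mul_neg]
  simp only [casimir, LinearMap.sum_apply, LinearMap.comp_apply, LinearMap.mulLeft_apply,
    LinearMap.add_apply, mul_add, mul_assoc, Finset.sum_add_distrib, ← Finset.mul_sum, h1, h2,
    NX_sqProd, mul_smul_comm, ← Finset.smul_sum, smul_smul]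
  rw [← add_smul]; congr 1; ring

theorem casimir_eq_zero {x : DExt V} (h : ∀ φ, dD φ x = 0) : casimir b x = 0 := by
  have key : ∀ φ ψ : V →ₗ[ℚ] ℚ, dY φ (dX ψ x) + dY ψ (dX φ x) = 0 := by
    intro φ ψ
    have h3 := h (φ + ψ)
    have hX : dX (φ + ψ) = dX φ + dX ψ := by
      unfold dX; rw [LinearMap.add_comp, map_add]
    have hY : dY (φ + ψ) = dY φ + dY ψ := by
      unfold dY; rw [LinearMap.add_comp, map_add]
    have h1 := h φ
    have h2 := h ψ
    simp only [dD, hX, hY, LinearMap.comp_apply, LinearMap.add_apply, map_add] at h1 h2 h3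
    rw [h1, h2] at h3
    simpa [add_comm] using h3
  simp [casimir, key]

theorem eq_smul_one_of_dD {d : ℕ} (b : Basis (Fin d) ℚ V) {x : DExt V} (hx : x ∈ box V) (h : ∀ φ, dD φ x = 0) :
    ∃ c : ℚ, x = c • 1 := by
  let G : End ℚ (DExt V) := casimir b
  obtain ⟨c, z, hz, rfl⟩ : ∃ (c : ℚ) (z : DExt V),
      z ∈ (⨆ μ ≠ (0 : ℚ), G.eigenspace μ) ∧ x = c • 1 + z := by
    refine box_induction (p := fun x => ∃ (c : ℚ) (z : DExt V),
      z ∈ (⨆ μ ≠ (0 : ℚ), G.eigenspace μ) ∧ x = c • 1 + z) ?_ ?_ ?_ ?_ hx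
    · exact ⟨0, 0, zero_mem _, by simp⟩
    · rintro _ _ ⟨c, z, hz, rfl⟩ ⟨c', z', hz', rfl⟩
      exact ⟨c + c', z + z', add_mem hz hz', by rw [add_smul]; abel⟩
    · rintro t _ ⟨c, z, hz, rfl⟩
      exact ⟨t * c, t • z, Submodule.smul_mem _ _ hz, by rw [smul_add, mul_smul]⟩
    · intro l
      cases l with
      | nil => exact ⟨1, 0, zero_mem _, by simp⟩
      | cons v l =>
        refine ⟨0, sqProd (v :: l), ?_, by simp⟩
        refine Submodule.mem_iSup_of_mem ((((v :: l).length : ℕ) : ℚ) * ((v :: l).length + 1)) ?_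
        refine Submodule.mem_iSup_of_mem (by rw [List.length_cons]; push_cast; positivity) ?_
        rw [End.mem_eigenspace_iff]
        exact casimir_sqProd b (v :: l)
  have h1 : G 1 = 0 := by simpa using casimir_sqProd b []
  have hG : G (c • 1 + z) = 0 := casimir_eq_zero b h
  have hz0 : z ∈ G.eigenspace 0 := by
    rw [End.mem_eigenspace_iff, zero_smul]
    rwa [map_add, map_smul, h1, smul_zero, zero_add] at hG
  have hd := (End.eigenspaces_iSupIndep G) 0
  have : z = 0 := by
    have := (Submodule.disjoint_def.1 hd) z hz0 hz
    exact this
  exact ⟨c, by rw [this, add_zero]⟩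

end casimir

section adj
variable {V' : Type*} [AddCommGroup V'] [Module ℚ V'] (j : V' →ₗ[ℚ] V) {φ : V →ₗ[ℚ] ℚ}

theorem dD_mul_dmap (hk : LinearMap.range j = LinearMap.ker φ) {x : DExt V} (hx : x ∈ box V) {y : DExt V'} (hy : y ∈ box V') :
    dD φ (x * dmap j y) = dD φ x * dmap j y := by
  have hker : ∀ w, φ (j w) = 0 := fun w => by
    have : j w ∈ LinearMap.ker φ := by rw [← hk]; exact ⟨w, rfl⟩
    exact this
  have step : ∀ (v : V) (p : DExt V), φ v = 0 → dD φ (sq v * p) = sq v * dD φ p := by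
    intro v p hv
    simp [dD, dX_sq, dY_sq, hv]
  have comm : ∀ l : List V', ∀ z ∈ box V, z * dmap j (sqProd l) = dmap j (sqProd l) * z := by
    intro l z hz
    have := (Algebra.isMulCommutative_adjoin ℚ (s := Set.range (sq (V := V)))
      (by rintro _ ⟨a, rfl⟩ _ ⟨b, rfl⟩; exact sq_comm a b))
    have h2 := this.is_comm.comm ⟨z, hz⟩ ⟨_, dmap_mem j (sqProd_mem l)⟩
    exact congrArg Subtype.val h2
  refine box_induction (p := fun y => dD φ (x * dmap j y) = dD φ x * dmap j y) ?_ ?_ ?_ ?_ hy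
  · simp
  · intro a b h1 h2; rw [map_add, mul_add, map_add, h1, h2, mul_add]
  · intro c a h; rw [map_smul, mul_smul_comm, map_smul, h, mul_smul_comm]
  · intro l
    obtain ⟨y, hy, hy'⟩ := dD_mem j hk hx
    rw [comm l x hx, comm l _ (hy' ▸ dmap_mem j hy)]
    clear hy hy'
    induction l with
    | nil => simp
    | cons v l ih => rw [sqProd_cons, map_mul (dmap j), dmap_sq, mul_assoc, step _ _ (hker v), ih, mul_assoc]

theorem traceOf_dD (hk : LinearMap.range j = LinearMap.ker φ) (hj : Function.Injective j) {k : ℕ} (e' : Basis (Fin k) ℚ V')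
    (b : Basis (Fin (k + 1)) ℚ V) (hb : ∀ i : Fin k, b i.succ = j (e' i)) {x : DExt V}
    (hx : x ∈ box V) {y : DExt V'} (hy : dmap j y = dD φ x) :
    traceOf e' y = φ (b 0) ^ 2 * traceOf b x := by
  have hker : ∀ w, φ (j w) = 0 := fun w => by
    have : j w ∈ LinearMap.ker φ := by rw [← hk]; exact ⟨w, rfl⟩
    exact this
  have h0 : ∀ v, φ v = b.repr v 0 * φ (b 0) := by
    intro v
    conv_lhs => rw [← b.sum_repr v, map_sum, Fin.sum_univ_succ]
    simp only [map_smul, hb, hker, smul_eq_mul, mul_zero, Finset.sum_const_zero, add_zero]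
  have hs : ∀ w i, b.repr (j w) (Fin.succ i) = e'.repr w i := by
    intro w i
    conv_lhs => rw [← e'.sum_repr w]
    simp only [map_sum, map_smul, ← hb, Basis.repr_self]
    simp [Finsupp.finsetSum_apply, Finsupp.single_apply]
  obtain ⟨y', h1, h2⟩ : ∃ y', dmap j y' = dD φ x ∧ traceOf e' y' = φ (b 0) ^ 2 * traceOf b x := by
    refine box_induction (p := fun x => ∃ y', dmap j y' = dD φ x ∧
      traceOf e' y' = φ (b 0) ^ 2 * traceOf b x) ?_ ?_ ?_ ?_ hx
    · exact ⟨0, by simp⟩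
    · rintro _ _ ⟨y, h1, h2⟩ ⟨z, h3, h4⟩
      exact ⟨y + z, by simp [h1, h3], by simp [h2, h4, mul_add]⟩
    · rintro c _ ⟨y, h1, h2⟩
      exact ⟨c • y, by simp [h1], by simp [h2]; ring⟩
    · intro l
      rcases normal_form φ l with h | ⟨v, l', h1, h2, -⟩
      · refine ⟨0, by simp [dD_ker φ l h], ?_⟩
        by_cases hl : l.length = k + 1
        · obtain ⟨a, rfl⟩ : ∃ a : Fin (k + 1) → V, l = List.ofFn a := by
            rw [← hl]; exact ⟨l.get, (List.ofFn_get l).symm⟩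
          rw [traceOf_sqProd_ofFn, ← mul_pow, map_zero]
          suffices φ (b 0) * (Matrix.of fun i j => b.repr (a i) j).det = 0 by rw [this]; simp
          by_cases hf : φ (b 0) = 0
          · rw [hf, zero_mul]
          · rw [Matrix.det_eq_zero_of_column_eq_zero 0, mul_zero]
            intro i
            have := h (a i) ((List.mem_ofFn' _ _).2 ⟨i, rfl⟩)
            rw [h0] at this
            simpa [hf] using this
        · rw [traceOf_sqProd_ne _ _ hl]; simp
      · obtain ⟨l₀, rfl⟩ := exists_lift j hk l' h1
        refine ⟨φ v ^ 2 • sqProd l₀, ?_, ?_⟩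
        · rw [h2, dD_cons_ker _ _ _ h1, map_smul, dmap_sqProd]
        · rw [h2, ← sqProd_cons]
          by_cases hl : l₀.length = k
          · obtain ⟨a, rfl⟩ : ∃ a : Fin k → V', l₀ = List.ofFn a := by
              subst hl; exact ⟨l₀.get, (List.ofFn_get l₀).symm⟩
            have : v :: (List.ofFn a).map j = List.ofFn (Fin.cons v (j ∘ a)) := by
              rw [List.ofFn_cons, List.map_ofFn]
            rw [this, traceOf_sqProd_ofFn, map_smul, traceOf_sqProd_ofFn,
              Matrix.det_succ_column_zero, Fin.sum_univ_succ, Finset.sum_eq_zero]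
            · rw [h0 v, smul_eq_mul]
              simp only [Matrix.of_apply, Fin.cons_zero, add_zero, Fin.val_zero, pow_zero, one_mul]
              have : (Matrix.of fun i t => b.repr ((Fin.cons v (j ∘ a) : Fin (k + 1) → V) i) t).submatrix
                  (Fin.succAbove 0) Fin.succ = Matrix.of fun i t => e'.repr (a i) t := by
                ext i t; simp [hs]
              rw [this]; ring
            · intro i _
              have := hker (a i)
              rw [h0] at this
              by_cases hf : φ (b 0) = 0
              · exfalso
                have hφ : b 0 ∈ LinearMap.range j := by rw [hk]; exact hf
                obtain ⟨w, hw⟩ := hφ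
                have h5 : b.repr (b 0) 0 = 1 := by simp
                rw [← hw, ← e'.sum_repr w] at h5
                simp only [map_sum, map_smul, ← hb, Basis.repr_self] at h5
                simp [Finsupp.finsetSum_apply] at h5
              · simp [hf] at this
                simp [this]
          · rw [map_smul, traceOf_sqProd_ne _ _ hl, traceOf_sqProd_ne]
            · simp
            · simpa using hl
  rw [dmap_injective j hj (hy.trans h1.symm), h2]

end adj

end Alg

section consBasis
variable {R L L' : Type*} [CommRing R] [IsDomain R] [AddCommGroup L] [Module R L]
  [AddCommGroup L'] [Module R L']

theorem exists_consBasis (j : L' →ₗ[R] L) (hj : Function.Injective j) (φ : L →ₗ[R] R)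
    (hk : LinearMap.range j = LinearMap.ker φ) {k : ℕ} (e' : Basis (Fin k) R L') (f : L)
    (hf : φ f ≠ 0) (hd : ∀ z, φ f ∣ φ z) :
    ∃ b : Basis (Fin (k + 1)) R L, b 0 = f ∧ ∀ i : Fin k, b i.succ = j (e' i) := by
  let e'' : Basis (Fin k) R (LinearMap.range j) := e'.map (LinearEquiv.ofInjective j hj)
  have hli : ∀ (c : R), ∀ x ∈ LinearMap.range j, c • f + x = 0 → c = 0 := by
    intro c x hx h
    rw [hk, LinearMap.mem_ker] at hx
    have := congrArg φ h
    simpa [hx, hf] using this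
  have hsp : ∀ z : L, ∃ c : R, z + c • f ∈ LinearMap.range j := by
    intro z
    obtain ⟨c, hc⟩ := hd z
    refine ⟨-c, ?_⟩
    rw [hk, LinearMap.mem_ker]
    simp [hc]; ring
  refine ⟨Basis.mkFinCons f e'' hli hsp, by simp, fun i => ?_⟩
  simp [e'']
end consBasis

theorem box_nondeg (d : ℕ) : ∀ {V : Type*} [AddCommGroup V] [Module ℚ V] (e : Basis (Fin d) ℚ V)
    {x : DExt V}, x ∈ box V → (∀ y ∈ box V, traceOf e (x * y) = 0) → x = 0 := by
  induction d with
  | zero =>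
    intro V _ _ e x hx h
    obtain ⟨c, rfl⟩ := eq_smul_one_of_dD e hx fun φ => by
      have : φ = 0 := e.ext fun i => i.elim0
      subst this
      simp [dD, dX]
    have := h _ (sqProd_mem (List.ofFn e))
    rw [smul_mul_assoc, one_mul, map_smul, traceOf_sqProd_ofFn] at this
    simp at this
    rw [this, zero_smul]
  | succ k ih =>
    intro V _ _ e x hx h
    obtain ⟨c, rfl⟩ := eq_smul_one_of_dD e hx fun φ => by
      by_cases hφ : φ = 0
      · subst hφ; simp [dD, dX]
      obtain ⟨f, hf⟩ : ∃ f, φ f ≠ 0 := by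
        by_contra hcon; push Not at hcon; exact hφ (LinearMap.ext hcon)
      have : FiniteDimensional ℚ V := Module.Finite.of_basis e
      have hr : finrank ℚ (LinearMap.ker φ) = k := by
        have h1 := LinearMap.finrank_range_add_finrank_ker φ
        have h2 : finrank ℚ V = k + 1 := by simpa using finrank_eq_card_basis e
        have h3 : finrank ℚ (LinearMap.range φ) = 1 := by
          rw [LinearMap.range_eq_top.2 (LinearMap.surjective hφ)]; simp
        omega
      let e' := finBasisOfFinrankEq ℚ (LinearMap.ker φ) hr
      have hk : LinearMap.range (LinearMap.ker φ).subtype = LinearMap.ker φ := by simp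
      have hj := (LinearMap.ker φ).injective_subtype
      obtain ⟨b, hb0, hb⟩ := exists_consBasis (LinearMap.ker φ).subtype hj φ hk e' f hf
        fun z => (isUnit_iff_ne_zero.2 hf).dvd
      obtain ⟨y, hy, hy'⟩ := dD_mem _ hk hx
      suffices y = 0 by rw [← hy', this, map_zero]
      refine ih e' hy fun z hz => ?_
      have hxz : x * dmap (LinearMap.ker φ).subtype z ∈ box V := mul_mem hx (dmap_mem _ hz)
      rw [traceOf_dD _ hk hj e' b hb hxz (by rw [map_mul, hy', dD_mul_dmap _ hk hx hz])]
      have h1 := h _ (dmap_mem (LinearMap.ker φ).subtype hz)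
      rw [traceOf_change e b hxz] at h1
      have h2 : (e.toMatrix b).det ≠ 0 := by
        have := congrArg Matrix.det (Basis.toMatrix_mul_toMatrix_flip e b)
        rw [Matrix.det_mul, Matrix.det_one] at this
        exact left_ne_zero_of_mul_eq_one this
      rcases mul_eq_zero.1 h1 with h1 | h1
      · exact absurd (pow_eq_zero_iff (by norm_num) |>.1 h1) h2
      · rw [h1, mul_zero]
    have := h _ (sqProd_mem (List.ofFn e))
    rw [smul_mul_assoc, one_mul, map_smul, traceOf_sqProd_ofFn] at this
    have h1 : (Matrix.of fun i j => e.repr (e i) j) = 1 := by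
      ext i j; simp [Matrix.one_apply, Finsupp.single_apply]
    rw [h1] at this
    simp at this
    rw [this, zero_smul]

section Lattice
variable (L : Type*) [AddCommGroup L]

variable {L}

/-- The map `α ↦ (α, 0)` from `Λ L` to `Λ(L ⊕ L) ⊗ ℚ`. -/
def legX : ExteriorAlgebra ℤ L →ₐ[ℤ] DExt (ℚ ⊗[ℤ] L) :=
  ExteriorAlgebra.lift ℤ
    ⟨(AddMonoidHom.mk' (fun a : L => xx ((1 : ℚ) ⊗ₜ[ℤ] a))
        (fun a b => by rw [TensorProduct.tmul_add, xx_add])).toIntLinearMap, fun a => xx_self _⟩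

/-- The map `α ↦ (0, α)` from `Λ L` to `Λ(L ⊕ L) ⊗ ℚ`. -/
def legY : ExteriorAlgebra ℤ L →ₐ[ℤ] DExt (ℚ ⊗[ℤ] L) :=
  ExteriorAlgebra.lift ℤ
    ⟨(AddMonoidHom.mk' (fun a : L => yy ((1 : ℚ) ⊗ₜ[ℤ] a))
        (fun a b => by rw [TensorProduct.tmul_add, yy_add])).toIntLinearMap, fun a => yy_self _⟩

/-- The square `α^□ = (-1)^(k(k-1)/2) (α, 0) ∧ (0, α)` of a form `α` of degree `k`. -/
def square (k : ℕ) (α : ExteriorAlgebra ℤ L) : DExt (ℚ ⊗[ℤ] L) :=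
  (-1 : ℚ) ^ (k * (k - 1) / 2) • (legX α * legY α)

theorem legX_ι (a : L) : legX (ExteriorAlgebra.ι ℤ a) = xx ((1 : ℚ) ⊗ₜ[ℤ] a) :=
  ExteriorAlgebra.lift_ι_apply _ _ _ _
theorem legY_ι (a : L) : legY (ExteriorAlgebra.ι ℤ a) = yy ((1 : ℚ) ⊗ₜ[ℤ] a) :=
  ExteriorAlgebra.lift_ι_apply _ _ _ _

theorem prod_xx_yy {V : Type*} [AddCommGroup V] [Module ℚ V] (l : List V) (v : V) :
    (l.map xx).prod * yy v = (-1 : ℚ) ^ l.length • (yy v * (l.map xx).prod) := by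
  induction l with
  | nil => simp
  | cons w l ih =>
    rw [List.map_cons, List.prod_cons, mul_assoc, ih, mul_smul_comm, ← mul_assoc, xx_yy,
      List.length_cons, pow_succ, neg_mul, smul_neg, mul_neg_one, neg_smul, mul_assoc]

theorem prod_xx_prod_yy {V : Type*} [AddCommGroup V] [Module ℚ V] (l : List V) :
    (-1 : ℚ) ^ (l.length * (l.length - 1) / 2) • ((l.map xx).prod * (l.map yy).prod)
      = sqProd l := by
  induction l with
  | nil => simp
  | cons v l ih =>
    have h : (-1 : ℚ) ^ ((v :: l).length * ((v :: l).length - 1) / 2) =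
        (-1 : ℚ) ^ (l.length * (l.length - 1) / 2) * (-1) ^ l.length := by
      rw [← pow_add]; congr 1
      rw [List.length_cons, ← Nat.triangle_succ]
    have h2 : ((-1 : ℚ) ^ l.length) * (-1) ^ l.length = 1 := by rw [← mul_pow]; simp
    rw [sqProd_cons, ← ih, h, List.map_cons, List.map_cons, List.prod_cons, List.prod_cons,
      mul_assoc (xx v), ← mul_assoc _ (yy v), prod_xx_yy]
    simp only [smul_mul_assoc, mul_smul_comm, smul_smul, sq, mul_assoc]
    rw [h2, mul_one]

theorem square_ιMulti (k : ℕ) (a : Fin k → L) :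
    square k (ExteriorAlgebra.ιMulti ℤ k a) =
      sqProd (List.ofFn fun i => (1 : ℚ) ⊗ₜ[ℤ] a i) := by
  rw [← prod_xx_prod_yy, square, ExteriorAlgebra.ιMulti_apply, map_list_prod, map_list_prod]
  simp only [List.map_ofFn, List.length_ofFn, Function.comp_def, legX_ι, legY_ι]

variable (L) in
/-- The algebra of tropical classes of the lattice `L`, with rational coefficients: the subalgebra of
`Λ(L ⊕ L) ⊗ ℚ` generated by the squares of the simple elements `a₁ ∧ … ∧ aₖ` of `Λ L`. -/
def boxAlg : Subalgebra ℚ (DExt (ℚ ⊗[ℤ] L)) :=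
  Algebra.adjoin ℚ {x | ∃ (k : ℕ) (a : Fin k → L), x = square k (ExteriorAlgebra.ιMulti ℤ k a)}

theorem exists_denom (v : ℚ ⊗[ℤ] L) : ∃ (m : ℚ) (a : L), m ≠ 0 ∧ v = m • ((1 : ℚ) ⊗ₜ[ℤ] a) := by
  suffices ∃ (m : ℕ) (a : L), m ≠ 0 ∧ (m : ℚ) • v = (1 : ℚ) ⊗ₜ[ℤ] a by
    obtain ⟨m, a, hm, h⟩ := this
    have hm' : (m : ℚ) ≠ 0 := by exact_mod_cast hm
    exact ⟨(m : ℚ)⁻¹, a, inv_ne_zero hm', by rw [← h, smul_smul, inv_mul_cancel₀ hm', one_smul]⟩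
  induction v using TensorProduct.induction_on with
  | zero => exact ⟨1, 0, one_ne_zero, by simp⟩
  | tmul q a =>
    refine ⟨q.den, q.num • a, q.den_ne_zero, ?_⟩
    rw [TensorProduct.smul_tmul', ← TensorProduct.smul_tmul]
    congr 1
    simp [Rat.den_mul_eq_num]
  | add x y hx hy =>
    obtain ⟨m, a, hm, h⟩ := hx
    obtain ⟨n, b, hn, h'⟩ := hy
    refine ⟨m * n, n • a + m • b, mul_ne_zero hm hn, ?_⟩
    rw [TensorProduct.tmul_add, smul_add, Nat.cast_mul, mul_comm (m : ℚ), mul_smul, h, mul_comm (n : ℚ),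
      mul_smul, h', TensorProduct.tmul_smul, TensorProduct.tmul_smul]
    simp [Nat.cast_smul_eq_nsmul]

theorem boxAlg_eq : boxAlg L = box (ℚ ⊗[ℤ] L) := by
  apply le_antisymm
  · refine Algebra.adjoin_le ?_
    rintro _ ⟨k, a, rfl⟩
    rw [square_ιMulti]; exact sqProd_mem _
  · refine Algebra.adjoin_le ?_
    rintro _ ⟨v, rfl⟩
    obtain ⟨m, a, -, rfl⟩ := exists_denom v
    rw [sq_smul]
    refine Subalgebra.smul_mem (boxAlg L) ?_ _
    exact Algebra.subset_adjoin ⟨1, fun _ => a, by rw [square_ιMulti]; simp⟩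

theorem boxAlg_comm : ∀ a ∈ {x | ∃ (k : ℕ) (a : Fin k → L), x = square k (ExteriorAlgebra.ιMulti ℤ k a)},
    ∀ b ∈ {x | ∃ (k : ℕ) (a : Fin k → L), x = square k (ExteriorAlgebra.ιMulti ℤ k a)},
    a * b = b * a := by
  have h := (Algebra.isMulCommutative_adjoin ℚ (s := Set.range (sq (V := ℚ ⊗[ℤ] L)))
      (by rintro _ ⟨a, rfl⟩ _ ⟨b, rfl⟩; exact sq_comm a b))
  rintro _ ⟨k, a, rfl⟩ _ ⟨m, b, rfl⟩
  rw [square_ιMulti, square_ιMulti]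
  exact congrArg Subtype.val (h.is_comm.comm
    (⟨_, sqProd_mem (List.ofFn fun i => (1 : ℚ) ⊗ₜ[ℤ] a i)⟩ : box (ℚ ⊗[ℤ] L))
    (⟨_, sqProd_mem (List.ofFn fun i => (1 : ℚ) ⊗ₜ[ℤ] b i)⟩ : box (ℚ ⊗[ℤ] L)))

instance : IsMulCommutative (boxAlg L) := Algebra.isMulCommutative_adjoin ℚ boxAlg_comm

section ratmap
/-- The extension of an integral linear form to `ℚ ⊗ L`. -/
def ratFun (φ : L →ₗ[ℤ] ℤ) : ℚ ⊗[ℤ] L →ₗ[ℚ] ℚ :=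
  LinearMap.liftBaseChange ℚ ((Int.castAddHom ℚ).toIntLinearMap ∘ₗ φ)

variable {L' : Type*} [AddCommGroup L']

theorem ratFun_tmul (φ : L →ₗ[ℤ] ℤ) (q : ℚ) (a : L) : ratFun φ (q ⊗ₜ a) = q * φ a := by
  simp [ratFun]

theorem ratMap_injective (j : L' →ₗ[ℤ] L) (hj : Function.Injective j) :
    Function.Injective (j.baseChange ℚ) := by
  have := Module.Flat.lTensor_preserves_injective_linearMap (M := ℚ) j hj
  exact this

theorem ratMap_range (j : L' →ₗ[ℤ] L) (φ : L →ₗ[ℤ] ℤ)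
    (hk : LinearMap.range j = LinearMap.ker φ) :
    LinearMap.range (j.baseChange ℚ) = LinearMap.ker (ratFun φ) := by
  apply le_antisymm
  · rintro _ ⟨x, rfl⟩
    rw [LinearMap.mem_ker]
    induction x using TensorProduct.induction_on with
    | zero => simp
    | tmul q a =>
      have : j a ∈ LinearMap.ker φ := hk ▸ ⟨a, rfl⟩
      rw [LinearMap.mem_ker] at this
      simp [ratFun_tmul, this]
    | add x y hx hy => rw [map_add, map_add, hx, hy, add_zero]
  · intro v hv
    obtain ⟨m, a, hm, rfl⟩ := exists_denom v
    rw [LinearMap.mem_ker, map_smul, ratFun_tmul] at hv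
    have : a ∈ LinearMap.ker φ := by simpa [hm] using hv
    rw [← hk] at this
    obtain ⟨w, rfl⟩ := this
    exact ⟨m • ((1 : ℚ) ⊗ₜ w), by simp⟩

end ratmap

theorem traceOf_baseChange {d d' : ℕ} (e : Basis (Fin d) ℤ L) (b : Basis (Fin d') ℤ L)
    {x : DExt (ℚ ⊗[ℤ] L)} (hx : x ∈ boxAlg L) :
    traceOf (e.baseChange ℚ) x = traceOf (b.baseChange ℚ) x := by
  obtain rfl : d = d' := by
    have h1 := finrank_eq_card_basis e
    have h2 := finrank_eq_card_basis b
    simp at h1 h2; omega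
  rw [boxAlg_eq] at hx
  rw [traceOf_change (e.baseChange ℚ) (b.baseChange ℚ) hx]
  have h1 : (e.baseChange ℚ).toMatrix (b.baseChange ℚ) = (e.toMatrix b).map (Int.castRingHom ℚ) := by
    ext i j; simp [Basis.toMatrix_apply]
  have h2 : IsUnit (e.toMatrix b).det := by
    have := congrArg Matrix.det (Basis.toMatrix_mul_toMatrix_flip e b)
    rw [Matrix.det_mul, Matrix.det_one] at this
    exact IsUnit.of_mul_eq_one _ this
  rw [h1, ← RingHom.mapMatrix_apply, ← RingHom.map_det, ← map_pow, Int.isUnit_sq h2]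
  simp

section fin
variable [Module.Free ℤ L] [Module.Finite ℤ L]

instance : Module.Finite ℚ (DExt (ℚ ⊗[ℤ] L)) :=
  Module.Finite.of_basis (Module.finBasis ℚ ((ℚ ⊗[ℤ] L) × (ℚ ⊗[ℤ] L))).ExteriorAlgebra


variable (L) in
/-- The trace of `Λ(L ⊕ L) ⊗ ℚ`: projection to the top degree, normalised by `Θ_L^□ ↦ 1`, where
`Θ_L` is a generator of the top exterior power of `L`. -/
def latTrace : DExt (ℚ ⊗[ℤ] L) →ₗ[ℚ] ℚ := traceOf ((Module.finBasis ℤ L).baseChange ℚ)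

variable {L' : Type*} [AddCommGroup L'] [Module.Free ℤ L'] [Module.Finite ℤ L']

theorem latTrace_contract (j : L' →ₗ[ℤ] L) (hj : Function.Injective j) (φ : L →ₗ[ℤ] ℤ)
    (hk : LinearMap.range j = LinearMap.ker φ) (f : L) (hf : φ f ≠ 0) (hd : ∀ z, φ f ∣ φ z)
    {x : DExt (ℚ ⊗[ℤ] L)} (hx : x ∈ boxAlg L) {y : DExt (ℚ ⊗[ℤ] L')}
    (hy : dmap (j.baseChange ℚ) y = dD (ratFun φ) x) :
    latTrace L' y = (φ f : ℚ) ^ 2 * latTrace L x := by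
  obtain ⟨b, hb0, hb⟩ := exists_consBasis j hj φ hk (Module.finBasis ℤ L') f hf hd
  rw [latTrace, latTrace, traceOf_baseChange (Module.finBasis ℤ L) b hx]
  rw [boxAlg_eq] at hx
  rw [traceOf_dD (j.baseChange ℚ) (ratMap_range j φ hk) (ratMap_injective j hj)
    ((Module.finBasis ℤ L').baseChange ℚ) (b.baseChange ℚ) (by simp [hb]) hx hy]
  simp [hb0, ratFun_tmul]

theorem latTrace_nondeg {x : DExt (ℚ ⊗[ℤ] L)} (hx : x ∈ boxAlg L)
    (h : ∀ y ∈ boxAlg L, latTrace L (x * y) = 0) : x = 0 := by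
  rw [boxAlg_eq] at hx h
  exact box_nondeg _ _ hx h

end fin
end Lattice


section boxmaps
variable {L L' : Type*} [AddCommGroup L] [AddCommGroup L']

open scoped IsMulCommutative in
instance : CommRing (boxAlg L) := inferInstance

theorem dmap_mem_boxAlg (j : L' →ₗ[ℤ] L) {x : DExt (ℚ ⊗[ℤ] L')} (hx : x ∈ boxAlg L') :
    dmap (j.baseChange ℚ) x ∈ boxAlg L := by
  rw [boxAlg_eq] at *; exact dmap_mem _ hx

/-- The map of algebras of tropical classes induced by a map of lattices. -/
def boxMap (j : L' →ₗ[ℤ] L) : boxAlg L' →ₐ[ℚ] boxAlg L :=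
  ((dmap (j.baseChange ℚ)).comp (boxAlg L').val).codRestrict (boxAlg L)
    fun x => dmap_mem_boxAlg j x.2

theorem coe_boxMap (j : L' →ₗ[ℤ] L) (x : boxAlg L') :
    (boxMap j x : DExt (ℚ ⊗[ℤ] L)) = dmap (j.baseChange ℚ) x := rfl

theorem boxMap_injective (j : L' →ₗ[ℤ] L) (hj : Function.Injective j) :
    Function.Injective (boxMap j) := fun x y h => by
  have := congrArg Subtype.val h
  rw [coe_boxMap, coe_boxMap] at this
  exact Subtype.ext (dmap_injective _ (ratMap_injective j hj) this)

theorem boxContract_aux (j : L' →ₗ[ℤ] L) (φ : L →ₗ[ℤ] ℤ)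
    (hk : LinearMap.range j = LinearMap.ker φ) (x : boxAlg L) :
    (dD (ratFun φ) ∘ₗ (boxAlg L).val.toLinearMap) x ∈
      LinearMap.range ((boxAlg L).val.toLinearMap ∘ₗ (boxMap j).toLinearMap) := by
  have hx : (x : DExt (ℚ ⊗[ℤ] L)) ∈ box (ℚ ⊗[ℤ] L) := by rw [← boxAlg_eq]; exact x.2
  obtain ⟨y, hy, h⟩ := dD_mem (j.baseChange ℚ) (ratMap_range j φ hk) hx
  exact ⟨⟨y, by rw [boxAlg_eq]; exact hy⟩, h⟩

/-- Contraction by `(φ, 0) ∧ (0, φ)`, as a map from the tropical classes of `L` to those of the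
kernel of `φ`, which is given as the image of the injective map `j`. -/
def boxContract (j : L' →ₗ[ℤ] L) (hj : Function.Injective j) (φ : L →ₗ[ℤ] ℤ)
    (hk : LinearMap.range j = LinearMap.ker φ) : boxAlg L →ₗ[ℚ] boxAlg L' :=
  (LinearEquiv.ofInjective ((boxAlg L).val.toLinearMap ∘ₗ (boxMap j).toLinearMap)
      (Subtype.val_injective.comp (boxMap_injective j hj))).symm.toLinearMap ∘ₗ
    (dD (ratFun φ) ∘ₗ (boxAlg L).val.toLinearMap).codRestrict _ (boxContract_aux j φ hk)

theorem dmap_boxContract (j : L' →ₗ[ℤ] L) (hj : Function.Injective j) (φ : L →ₗ[ℤ] ℤ)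
    (hk : LinearMap.range j = LinearMap.ker φ) (x : boxAlg L) :
    dmap (j.baseChange ℚ) (boxContract j hj φ hk x) = dD (ratFun φ) x := by
  have := LinearEquiv.apply_symm_apply
    (LinearEquiv.ofInjective ((boxAlg L).val.toLinearMap ∘ₗ (boxMap j).toLinearMap)
      (Subtype.val_injective.comp (boxMap_injective j hj)))
    ((dD (ratFun φ) ∘ₗ (boxAlg L).val.toLinearMap).codRestrict _ (boxContract_aux j φ hk) x)
  exact congrArg Subtype.val this

variable (L) in
/-- The restriction of the trace of `Λ(L ⊕ L) ⊗ ℚ` to the tropical classes. -/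
def boxTr [Module.Free ℤ L] [Module.Finite ℤ L] : boxAlg L →ₗ[ℚ] ℚ :=
  latTrace L ∘ₗ (boxAlg L).val.toLinearMap

theorem boxTr_nondeg [Module.Free ℤ L] [Module.Finite ℤ L] (a : boxAlg L)
    (h : ∀ b, boxTr L (a * b) = 0) : a = 0 :=
  Subtype.ext (latTrace_nondeg a.2 fun y hy => h ⟨y, hy⟩)

theorem boxTr_contract [Module.Free ℤ L] [Module.Finite ℤ L] [Module.Free ℤ L']
    [Module.Finite ℤ L'] (j : L' →ₗ[ℤ] L) (hj : Function.Injective j) (φ : L →ₗ[ℤ] ℤ)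
    (hk : LinearMap.range j = LinearMap.ker φ) (f : L) (hf : φ f ≠ 0) (hd : ∀ z, φ f ∣ φ z)
    (a : boxAlg L) (b : boxAlg L') :
    boxTr L' (boxContract j hj φ hk a * b) = (φ f : ℚ) ^ 2 * boxTr L (a * boxMap j b) := by
  have hb : (b : DExt (ℚ ⊗[ℤ] L')) ∈ box (ℚ ⊗[ℤ] L') := by rw [← boxAlg_eq]; exact b.2
  have ha : (a : DExt (ℚ ⊗[ℤ] L)) ∈ box (ℚ ⊗[ℤ] L) := by rw [← boxAlg_eq]; exact a.2
  refine latTrace_contract j hj φ hk f hf hd (a * boxMap j b).2 ?_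
  have h1 := dD_mul_dmap (j.baseChange ℚ) (ratMap_range j φ hk) ha hb
  refine Eq.trans (map_mul (dmap (j.baseChange ℚ)) _ _) ?_
  rw [dmap_boxContract]
  exact h1.symm

end boxmaps

/-- Algebraic data that determine a two-dimensional tropical quantum field theory with colours in
`X` and values in rational vector spaces: a commutative Frobenius algebra `C x` for every colour,
and mutually adjoint maps `κ x : C x → C 0` and `κd x : C 0 → C x`, identities for `x = 0`. -/
structure TrQFTData (X : Type*) [Zero X] where
  C : X → Type*
  [commRing : ∀ x, CommRing (C x)]
  [algebra : ∀ x, Algebra ℚ (C x)]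
  [finite : ∀ x, Module.Finite ℚ (C x)]
  tr : ∀ x, C x →ₗ[ℚ] ℚ
  nondeg : ∀ x a, (∀ b, tr x (a * b) = 0) → a = 0
  κ : ∀ x, C x →ₗ[ℚ] C 0
  κd : ∀ x, C 0 →ₗ[ℚ] C x
  κ_zero : κ 0 = LinearMap.id
  κd_zero : κd 0 = LinearMap.id
  adjoint : ∀ x a b, tr x (κd x a * b) = tr 0 (a * κ x b)

attribute [instance] TrQFTData.commRing TrQFTData.algebra TrQFTData.finite

/-- The relation `m = ± n`. -/
def negSetoid (N : Type*) [AddCommGroup N] : Setoid N where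
  r m n := m = n ∨ m = -n
  iseqv := ⟨fun _ => Or.inl rfl, by rintro _ _ (rfl | rfl) <;> simp,
    by rintro _ _ _ (rfl | rfl) (rfl | rfl) <;> simp⟩

/-- The quotient of the lattice `N` by negation. -/
def NBar (N : Type*) [AddCommGroup N] : Type _ := Quotient (negSetoid N)

namespace NBar
variable {N : Type*} [AddCommGroup N]
def mk (n : N) : NBar N := Quotient.mk (negSetoid N) n
instance : Zero (NBar N) := ⟨mk 0⟩
/-- A representative of a class in the quotient of `N` by negation; the kernel and the contraction
square below do not depend on its sign. -/
def rep (x : NBar N) : N := Quotient.out x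
theorem mk_rep (x : NBar N) : mk x.rep = x := Quotient.out_eq x
theorem rep_mk (n : N) : (mk n).rep = n ∨ (mk n).rep = -n :=
  Quotient.exact (Quotient.out_eq (Quotient.mk (negSetoid N) n))
theorem rep_zero : (0 : NBar N).rep = 0 := by
  rcases rep_mk (0 : N) with h | h
  · exact h
  · rw [neg_zero] at h; exact h
theorem rep_eq_zero {x : NBar N} : x.rep = 0 ↔ x = 0 :=
  ⟨fun h => by rw [← mk_rep x, h]; rfl, fun h => by rw [h, rep_zero]⟩
end NBar

/-- The index `|n|`: the largest `k` such that `n` is `k` times a lattice vector. -/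
def vecIndex {N : Type*} [AddCommGroup N] (n : N) : ℕ := sSup {k : ℕ | ∃ v : N, n = k • v}

/-- The annihilator `M_n` of `n` in the dual lattice `M`. -/
def perp {N : Type*} [AddCommGroup N] (n : N) : Submodule ℤ (Dual ℤ N) :=
  LinearMap.ker (Dual.eval ℤ N n)

/-- The lattice `M_n` as a type. -/
def Perp {N : Type*} [AddCommGroup N] (n : N) : Type _ := ↥(perp n)

instance {N : Type*} [AddCommGroup N] (n : N) : AddCommGroup (Perp n) :=
  inferInstanceAs (AddCommGroup ↥(perp n))

/-- The inclusion of `M_n` in `M`. -/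
def Perp.val {N : Type*} [AddCommGroup N] {n : N} : Perp n →ₗ[ℤ] Dual ℤ N :=
  (perp n).subtype.toAddMonoidHom.toIntLinearMap

/-- An element of `M_n` from an element of `M` that vanishes on `n`. -/
def Perp.mk {N : Type*} [AddCommGroup N] {n : N} (f : Dual ℤ N) (h : f n = 0) : Perp n :=
  (⟨f, h⟩ : perp n)

theorem Perp.val_mk {N : Type*} [AddCommGroup N] {n : N} (f : Dual ℤ N) (h : f n = 0) :
    Perp.val (Perp.mk f h) = f := rfl

theorem Perp.val_injective {N : Type*} [AddCommGroup N] {n : N} :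
    Function.Injective (Perp.val (n := n)) := Subtype.val_injective

theorem Perp.val_apply {N : Type*} [AddCommGroup N] {n : N} (f : Perp n) : Perp.val f n = 0 := f.2

/-- The inclusion `M_n ⊆ M_m`; it is used for `m = 0`, where `M_m = M`, and for `m = n`. -/
def perpIncl {N : Type*} [AddCommGroup N] (m n : N) (h : perp n ≤ perp m) : Perp n →ₗ[ℤ] Perp m :=
  (Submodule.inclusion h).toAddMonoidHom.toIntLinearMap

theorem val_perpIncl {N : Type*} [AddCommGroup N] (m n : N) (h : perp n ≤ perp m) (f : Perp n) :
    Perp.val (perpIncl m n h f) = Perp.val f := rfl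

theorem perp_le {N : Type*} [AddCommGroup N] (n : N) : perp n ≤ perp (0 : NBar N).rep := fun f _ => by
  simp [perp, NBar.rep_zero]

section boxdata
variable {N : Type*} [AddCommGroup N] [Module.Free ℤ N] [Module.Finite ℤ N]

theorem vecIndex_spec {n : N} (hn : n ≠ 0) :
    vecIndex n ≠ 0 ∧ ∃ f : Dual ℤ N, f n = vecIndex n ∧ ∀ g : Dual ℤ N, (vecIndex n : ℤ) ∣ g n := by
  obtain ⟨d, hd⟩ := (IsPrincipalIdealRing.principal
    (LinearMap.range (Dual.eval ℤ N n) : Submodule ℤ ℤ)).principal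
  have hdvd : ∀ g : Dual ℤ N, d ∣ g n := fun g => by
    have : g n ∈ LinearMap.range (Dual.eval ℤ N n) := ⟨g, rfl⟩
    rw [hd] at this
    exact Ideal.mem_span_singleton.1 this
  obtain ⟨f, hf⟩ : ∃ f : Dual ℤ N, f n = d := by
    have : d ∈ LinearMap.range (Dual.eval ℤ N n) := by rw [hd]; exact Submodule.mem_span_singleton_self d
    exact this
  obtain ⟨f', hf'⟩ : ∃ f : Dual ℤ N, f n = (d.natAbs : ℤ) := by
    rcases Int.natAbs_eq d with h | h
    · exact ⟨f, by rw [hf]; exact h⟩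
    · exact ⟨-f, by rw [LinearMap.neg_apply, hf]; omega⟩
  have hd0 : d ≠ 0 := by
    rintro rfl
    apply hn
    rw [← Module.forall_dual_apply_eq_zero_iff ℤ n]
    intro g; exact zero_dvd_iff.1 (hdvd g)
  have hmain : vecIndex n = d.natAbs := by
    refine IsGreatest.csSup_eq ⟨?_, ?_⟩
    · let b := Module.finBasis ℤ N
      choose c hc using fun i => Int.natAbs_dvd.2 (hdvd (b.coord i))
      refine ⟨∑ i, c i • b i, ?_⟩
      rw [← natCast_zsmul, Finset.smul_sum]
      conv_lhs => rw [← b.sum_repr n]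
      refine Finset.sum_congr rfl fun i _ => ?_
      rw [smul_smul]; congr 1; exact hc i
    · rintro k ⟨v, hv⟩
      refine Nat.le_of_dvd (Int.natAbs_pos.2 hd0) ?_
      rw [← Int.natCast_dvd_natCast, ← hf']
      exact ⟨f' v, by rw [hv]; simp⟩
  rw [hmain]
  exact ⟨by simpa using hd0, f', hf', fun g => Int.natAbs_dvd.2 (hdvd g)⟩

instance (n : N) : Module.Finite ℤ (Perp n) :=
  Module.Finite.of_injective Perp.val Perp.val_injective

instance (n : N) : Module.Free ℤ (Perp n) :=
  haveI : Module.IsTorsionFree ℤ (Perp n) :=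
    Function.Injective.moduleIsTorsionFree _ Perp.val_injective fun c x => map_zsmul Perp.val c x
  Module.free_of_finite_type_torsion_free'

/-- Evaluation at `n` on the lattice `M_m`; it is used for `m = 0`. -/
def perpEval (m n : N) : Perp m →ₗ[ℤ] ℤ := Dual.eval ℤ N n ∘ₗ Perp.val

theorem perpIncl_injective (m n : N) (h : perp n ≤ perp m) : Function.Injective (perpIncl m n h) :=
  Submodule.inclusion_injective h

theorem range_perpIncl (m n : N) (h : perp n ≤ perp m) :
    LinearMap.range (perpIncl m n h) = LinearMap.ker (perpEval m n) := by
  ext f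
  constructor
  · rintro ⟨g, rfl⟩; exact g.val_apply
  · intro h; exact ⟨Perp.mk (Perp.val f) h, rfl⟩

open scoped Classical in
/-- The factor `|n|⁻²` (and `1` for `n = 0`). The trace of `C_n` is this multiple of the standard trace
of `Λ(M_n ⊕ M_n)`, that is, the trace which sends the contraction of `Θ_M^□` by `(n, 0) ∧ (0, n)`
to `1`. -/
def trScale (x : NBar N) : ℚ := if x = 0 then 1 else ((vecIndex x.rep : ℚ) ^ 2)⁻¹

theorem trScale_ne (x : NBar N) : trScale x ≠ 0 := by
  unfold trScale
  split_ifs with h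
  · exact one_ne_zero
  · have := (vecIndex_spec (mt NBar.rep_eq_zero.1 h)).1
    positivity

theorem perp_zero_le {x : NBar N} (h : x = 0) : perp (0 : NBar N).rep ≤ perp x.rep := h ▸ le_rfl

open scoped Classical in
/-- The map `C_0 → C_n`: contraction by `(n, 0) ∧ (0, n)` for `n ≠ 0`, and the identity for `n = 0`. -/
def boxκd (x : NBar N) : boxAlg (Perp (0 : NBar N).rep) →ₗ[ℚ] boxAlg (Perp x.rep) :=
  if h : x = 0 then (boxMap (perpIncl x.rep _ (perp_zero_le h))).toLinearMap
  else boxContract (perpIncl _ x.rep (perp_le _)) (perpIncl_injective _ _ _) (perpEval _ x.rep) (range_perpIncl _ _ _)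

theorem boxMap_id {L : Type*} [AddCommGroup L] (j : L →ₗ[ℤ] L) (h : j = LinearMap.id) :
    (boxMap j).toLinearMap = LinearMap.id := by
  subst h
  refine LinearMap.ext fun x => Subtype.ext ?_
  change dmap _ _ = _
  rw [dmap, LinearMap.baseChange_id, LinearMap.prodMap_id, ExteriorAlgebra.map_id]
  rfl

theorem boxκd_zero : boxκd (0 : NBar N) = LinearMap.id := by
  rw [boxκd, dif_pos rfl]; exact boxMap_id _ rfl

theorem boxMap_perpIncl_zero :
    (boxMap (perpIncl _ (0 : NBar N).rep (perp_le _))).toLinearMap = LinearMap.id := boxMap_id _ rfl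

theorem boxTr_contract_rep {x : NBar N} (hx : x ≠ 0) (a : boxAlg (Perp (0 : NBar N).rep))
    (b : boxAlg (Perp x.rep)) :
    boxTr (Perp x.rep) (boxContract (perpIncl _ x.rep (perp_le _)) (perpIncl_injective _ _ _) (perpEval _ x.rep)
        (range_perpIncl _ _ _) a * b) =
      (vecIndex x.rep : ℚ) ^ 2 * boxTr _ (a * boxMap (perpIncl _ x.rep (perp_le _)) b) := by
  obtain ⟨h0, f, hf, hd⟩ := vecIndex_spec (mt NBar.rep_eq_zero.1 hx)
  have hm : f (0 : NBar N).rep = 0 := by simp [NBar.rep_zero]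
  have hfe : perpEval (0 : NBar N).rep x.rep (Perp.mk f hm) = vecIndex x.rep := hf
  have := boxTr_contract (perpIncl _ x.rep (perp_le _)) (perpIncl_injective _ _ _) (perpEval _ x.rep)
    (range_perpIncl _ _ _) (Perp.mk f hm) (by rw [hfe]; exact_mod_cast h0) (fun z => by rw [hfe]; exact hd (Perp.val z)) a b
  rw [hfe, Int.cast_natCast] at this
  exact this

theorem box_adjoint (x : NBar N) (a : boxAlg (Perp (0 : NBar N).rep)) (b : boxAlg (Perp x.rep)) :
    (trScale x • boxTr (Perp x.rep)) (boxκd x a * b) =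
      (trScale (0 : NBar N) • boxTr (Perp (0 : NBar N).rep)) (a * boxMap (perpIncl _ x.rep (perp_le _)) b) := by
  by_cases hx : x = 0
  · subst hx
    rw [boxκd_zero, LinearMap.id_apply]
    have := LinearMap.congr_fun (boxMap_perpIncl_zero (N := N)) b
    rw [AlgHom.toLinearMap_apply, LinearMap.id_apply] at this
    rw [this]
  · have h0 := (vecIndex_spec (mt NBar.rep_eq_zero.1 hx)).1
    have : (vecIndex x.rep : ℚ) ≠ 0 := by exact_mod_cast h0
    rw [boxκd, dif_neg hx, LinearMap.smul_apply, LinearMap.smul_apply, boxTr_contract_rep hx,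
      trScale, if_neg hx, trScale, if_pos rfl, smul_eq_mul, smul_eq_mul, one_mul, ← mul_assoc,
      inv_mul_cancel₀ (pow_ne_zero 2 this), one_mul]

variable (N) in
/-- The data of the theory `F^□_Mult` over `ℚ`. For a class `x = ± n`, `C x` is the algebra of
tropical classes of `M_n` (generated by the squares of the simple elements of `Λ M_n`), which is
regarded as a subspace of `C 0`; `κ` is the inclusion, `κd` is contraction by `(n, 0) ∧ (0, n)`,
and the trace of `C x` is normalised so that the contraction of `Θ_M^□` has trace `1`. -/
def boxTrQFT : TrQFTData (NBar N) where
  C x := boxAlg (Perp x.rep)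
  tr x := trScale x • boxTr (Perp x.rep)
  nondeg x a h := by
    refine boxTr_nondeg a fun b => ?_
    have := h b
    rw [LinearMap.smul_apply, smul_eq_mul] at this
    exact (mul_eq_zero.1 this).resolve_left (trScale_ne x)
  κ x := (boxMap (perpIncl _ x.rep (perp_le _))).toLinearMap
  κd := boxκd
  κ_zero := boxMap_perpIncl_zero
  κd_zero := boxκd_zero
  adjoint x a b := box_adjoint x a b

/-- The inclusion of `C x` in `Λ(M ⊕ M) ⊗ ℚ`. -/
def boxInclusion (x : NBar N) : (boxTrQFT N).C x →ₐ[ℚ] DExt (ℚ ⊗[ℤ] Dual ℤ N) :=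
  (dmap (Perp.val.baseChange ℚ)).comp (boxAlg (Perp x.rep)).val

end boxdata


/-- A tropical cobordism to the empty degree, with colours in `X`: a finite graph with vertices `V`,
compact edges `E` from `src e` to `tgt e`, and non-compact edges (legs) `I` at the vertices `leg i`,
with the weighted directions of all edges up to sign, and a genus for every vertex. -/
structure TropCobordism (X V E I : Type*) where
  src : E → V
  tgt : E → V
  leg : I → V
  dir : E → X
  deg : I → X
  genus : V → ℕ

namespace TropCobordism
variable {X V E I : Type*}

/-- The half-edges at vertices: `(e, false)` at the source of `e`, `(e, true)` at its target, and one
for every leg. -/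
abbrev Flag (E I : Type*) := (E × Bool) ⊕ I

/-- The edge that contains a given half-edge. -/
def edgeOf : Flag E I → E ⊕ I
  | Sum.inl p => Sum.inl p.1
  | Sum.inr i => Sum.inr i

variable (Γ : TropCobordism X V E I)

/-- The vertex at which a half-edge ends. -/
def vertexOf : Flag E I → V
  | Sum.inl (e, false) => Γ.src e
  | Sum.inl (e, true) => Γ.tgt e
  | Sum.inr i => Γ.leg i

/-- The weighted direction of the edge that contains a half-edge. -/
def colour : Flag E I → X
  | Sum.inl p => Γ.dir p.1
  | Sum.inr i => Γ.deg i

/-- The arrows of the quiver with a vertex for every vertex of the graph and for the middle of every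
edge, when the half-edges are oriented by `toV` (towards the vertex if `true`). The outer ends of
the legs, which are sources with a single arrow to the middle of the leg, are left out: they lie
on no directed cycle. -/
inductive Arrow (toV : Flag E I → Bool) : V ⊕ (E ⊕ I) → V ⊕ (E ⊕ I) → Prop
  | inward (f : Flag E I) : toV f = true → Arrow toV (Sum.inr (edgeOf f)) (Sum.inl (Γ.vertexOf f))
  | outward (f : Flag E I) : toV f = false → Arrow toV (Sum.inl (Γ.vertexOf f)) (Sum.inr (edgeOf f))

/-- A tropical flow: an acyclic orientation of the graph that is obtained by inserting a vertex in the
middle of every edge, for which the outer ends of all legs are sources. -/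
structure Flow where
  toV : Flag E I → Bool
  acyclic : ∀ x, ¬ Relation.TransGen (Γ.Arrow toV) x x

/-- Every cobordism has a flow: orient all half-edges towards the vertices. -/
instance : Nonempty Γ.Flow :=
  ⟨⟨fun _ => true, by
    have key : ∀ x y, Relation.TransGen (Γ.Arrow fun _ => true) x y →
        (∃ a, x = Sum.inr a) ∧ ∃ v, y = Sum.inl v := by
      intro x y h
      induction h with
      | single h => rcases h with ⟨f, h⟩ | ⟨f, h⟩
                    · exact ⟨⟨_, rfl⟩, _, rfl⟩
                    · cases h
      | tail _ h ih => rcases h with ⟨f, h⟩ | ⟨f, h⟩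
                       · exact ⟨ih.1, _, rfl⟩
                       · cases h
    intro x h
    obtain ⟨⟨a, rfl⟩, v, hv⟩ := key _ _ h
    cases hv⟩⟩

end TropCobordism

namespace TrQFTData
variable {X : Type*} [Zero X] (F : TrQFTData X)

/-- The trace pairing of `C x`. -/
def form (x : X) : LinearMap.BilinForm ℚ (F.C x) := (LinearMap.mul ℚ (F.C x)).compr₂ (F.tr x)

theorem form_nondegenerate (x : X) : (F.form x).Nondegenerate :=
  ⟨fun a h => F.nondeg x a h, fun a h => F.nondeg x a fun b => by rw [mul_comm]; exact h b⟩

/-- The index set of the chosen basis of `C x`. -/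
abbrev Idx (x : X) : Type := Fin (finrank ℚ (F.C x))

/-- A basis of `C x`. -/
def basis (x : X) : Basis (F.Idx x) ℚ (F.C x) := Module.finBasis ℚ (F.C x)

/-- The basis of `C x` that is dual to the chosen one with respect to the trace pairing. -/
def dual (x : X) : Basis (F.Idx x) ℚ (F.C x) :=
  (F.form x).dualBasis (F.form_nondegenerate x) (F.basis x)

/-- The cotrace of `C x`, an element of `C x ⊗ C x`. -/
def cotrace (x : X) : F.C x ⊗[ℚ] F.C x := ∑ j, F.basis x j ⊗ₜ[ℚ] F.dual x j

/-- The handle element of `C 0`: the product of the two factors of the cotrace. -/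
def handle : F.C 0 := LinearMap.mul' ℚ (F.C 0) (F.cotrace 0)

open scoped Classical in
/-- The iterated coproduct from `C 0` to its tensor power over `S`; it is the counit for `S` empty, the
identity for `S` a point and the coproduct for `S` with two elements. -/
def coprod (S : Type*) [Fintype S] (z : F.C 0) : ⨂[ℚ] _ : S, F.C 0 :=
  ∑ j : S → F.Idx 0, F.tr 0 (z * ∏ t, F.dual 0 (j t)) • ⨂ₜ[ℚ] t, F.basis 0 (j t)

/-- The coordinate with index `s` of a tensor, in the basis of the elementary tensors of basis
elements. -/
def tensorCoord {S : Type*} [Fintype S] (c : S → X) (s : ∀ t, F.Idx (c t)) :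
    (⨂[ℚ] t, F.C (c t)) →ₗ[ℚ] ℚ :=
  PiTensorProduct.lift
    ((MultilinearMap.mkPiAlgebra ℚ S ℚ).compLinearMap fun t => (F.basis (c t)).coord (s t))

section eval
variable {V E I : Type*} [Fintype V] [Fintype E] [Fintype I] (Γ : TropCobordism X V E I)
  (φ : Γ.Flow)

open TropCobordism

/-- A choice of a basis element for every half-edge. -/
abbrev State : Type _ := ∀ f : Flag E I, F.Idx (Γ.colour f)

open scoped Classical in
/-- The matrix coefficient of the operation at the vertex `v`. The operation applies `κ` on every
half-edge that flows into `v`, multiplies in `C 0`, multiplies by the handle element once for each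
unit of genus, applies the iterated coproduct, and applies `κd` on every half-edge that flows out. -/
def vertexAmp (s : F.State Γ) (v : V) : ℚ :=
  F.tensorCoord (fun f : {f // Γ.vertexOf f = v ∧ φ.toV f = false} => Γ.colour f) (fun f => s f)
    (PiTensorProduct.map (fun f : {f // Γ.vertexOf f = v ∧ φ.toV f = false} => F.κd (Γ.colour f))
      (F.coprod {f // Γ.vertexOf f = v ∧ φ.toV f = false}
        (F.handle ^ Γ.genus v *
          ∏ f : {f // Γ.vertexOf f = v ∧ φ.toV f = true},
            F.κ (Γ.colour f) (F.basis (Γ.colour f) (s f)))))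

/-- The matrix coefficient of the operation in the middle of a compact edge: the cotrace if the middle
is a source of the flow, the trace pairing if it is a sink, and the identity otherwise. -/
def edgeAmp (s : F.State Γ) (e : E) : ℚ :=
  match φ.toV (Sum.inl (e, false)), φ.toV (Sum.inl (e, true)) with
  | true, true => ((F.basis (Γ.dir e)).tensorProduct (F.basis (Γ.dir e))).coord
      (s (Sum.inl (e, false)), s (Sum.inl (e, true))) (F.cotrace (Γ.dir e))
  | false, false => F.tr (Γ.dir e) (F.basis (Γ.dir e) (s (Sum.inl (e, false))) *
      F.basis (Γ.dir e) (s (Sum.inl (e, true))))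
  | false, true => (F.basis (Γ.dir e)).coord (s (Sum.inl (e, true)))
      (F.basis (Γ.dir e) (s (Sum.inl (e, false))))
  | true, false => (F.basis (Γ.dir e)).coord (s (Sum.inl (e, false)))
      (F.basis (Γ.dir e) (s (Sum.inl (e, true))))

/-- The operation on a leg, as a function of the element inserted at its outer end: the identity if the
leg flows into its vertex, and the trace pairing otherwise. -/
def legAmp (s : F.State Γ) (i : I) : F.C (Γ.deg i) →ₗ[ℚ] ℚ :=
  match φ.toV (Sum.inr i) with
  | true => (F.basis (Γ.deg i)).coord (s (Sum.inr i))
  | false => F.form (Γ.deg i) (F.basis (Γ.deg i) (s (Sum.inr i)))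

open scoped Classical in
/-- The morphism `⨂ᵢ C(deg i) → ℚ` that the theory assigns to a cobordism, computed along a flow: the
composition of the operations at the vertices, at the middles of the edges and on the legs, written
as a sum over all states. -/
def eval : (⨂[ℚ] i, F.C (Γ.deg i)) →ₗ[ℚ] ℚ :=
  ∑ s : F.State Γ, ((∏ v, F.vertexAmp Γ φ s v) * ∏ e, F.edgeAmp Γ φ s e) •
    PiTensorProduct.lift
      ((MultilinearMap.mkPiAlgebra ℚ I ℚ).compLinearMap fun i => F.legAmp Γ φ s i)

end eval
end TrQFTData


/-- A nonzero element that is not a proper multiple of another element. -/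
def IsPrimitive {L : Type*} [AddCommGroup L] (v : L) : Prop :=
  v ≠ 0 ∧ ∀ (k : ℕ) (v' : L), v = k • v' → k = 1

section Curves
variable {N V E I : Type*} [AddCommGroup N]

/-- A lattice vector as a vector of the real space `ℝ ⊗ N`. -/
def realPt (n : N) : ℝ ⊗[ℤ] N := (1 : ℝ) ⊗ₜ[ℤ] n

open scoped Classical in
/-- The number of half-edges at the vertex `v` (a self-loop counts twice). -/
def endCount [Fintype E] [Fintype I] (src tgt : E → V) (leg : I → V) (v : V) : ℕ :=
  Fintype.card {e // src e = v} + Fintype.card {e // tgt e = v} + Fintype.card {i // leg i = v}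

open scoped Classical in
/-- A parameterized tropical curve in `ℝ ⊗ N` with at least one vertex: a finite connected graph with
compact edges `E` and marked non-compact edges (legs) `I`, weights, genera, and a map to `ℝ ⊗ N`,
given by the positions `pos` of the vertices and by primitive directions (`0` for weight `0`) of
the edges, from `src e` towards `tgt e`, and of the legs, pointing outwards. -/
structure TropicalCurve (N V E I : Type*) [AddCommGroup N] [Fintype V] [Fintype E] [Fintype I] where
  src : E → V
  tgt : E → V
  leg : I → V
  wt : E → ℕ
  legWt : I → ℕ
  genusAt : V → ℕ
  nonempty : Nonempty V
  connected : ∀ v v' : V, Relation.EqvGen (fun a b => ∃ e, src e = a ∧ tgt e = b) v v'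
  stable : ∀ v : V, endCount src tgt leg v = 1 ∨ endCount src tgt leg v = 2 → 0 < genusAt v
  pos : V → ℝ ⊗[ℤ] N
  dir : E → N
  legDir : I → N
  dir_primitive : ∀ e, wt e ≠ 0 → IsPrimitive (dir e)
  dir_zero : ∀ e, wt e = 0 → dir e = 0
  legDir_primitive : ∀ i, legWt i ≠ 0 → IsPrimitive (legDir i)
  legDir_zero : ∀ i, legWt i = 0 → legDir i = 0
  edge : ∀ e, wt e ≠ 0 → ∃ t : ℝ, 0 < t ∧ pos (tgt e) - pos (src e) = t • realPt (dir e)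
  edge_zero : ∀ e, wt e = 0 → pos (tgt e) = pos (src e)
  balancing : ∀ v : V, ∑ e with src e = v, wt e • dir e - ∑ e with tgt e = v, wt e • dir e +
    ∑ i with leg i = v, legWt i • legDir i = 0

namespace TropicalCurve
variable [Fintype V] [Fintype E] [Fintype I] (Γ : TropicalCurve N V E I)

/-- The valence of a vertex. -/
def valence (v : V) : ℕ := endCount Γ.src Γ.tgt Γ.leg v

/-- The over-valence `val(v) + 3 g(v) - 3`. -/
def overvalence (v : V) : ℤ := Γ.valence v + 3 * Γ.genusAt v - 3

/-- The genus: the first Betti number of the (connected) graph plus the genera of the vertices. -/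
def genus : ℤ := Fintype.card E - Fintype.card V + 1 + ∑ v, (Γ.genusAt v : ℤ)

/-- The degree `Δ(i)`. -/
def degree (i : I) : N := Γ.legWt i • Γ.legDir i

/-- The tropical cobordism determined by the type of a tropical curve. -/
def toCobordism : TropCobordism (NBar N) V E I where
  src := Γ.src
  tgt := Γ.tgt
  leg := Γ.leg
  dir e := NBar.mk (Γ.wt e • Γ.dir e)
  deg i := NBar.mk (Γ.degree i)
  genus := Γ.genusAt

/-- The difference of the positions of the two ends of an edge. -/
def edgeVector (e : E) : (V → ℝ ⊗[ℤ] N) →ₗ[ℝ] ℝ ⊗[ℤ] N :=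
  LinearMap.proj (R := ℝ) (φ := fun _ : V => ℝ ⊗[ℤ] N) (Γ.tgt e) - LinearMap.proj (Γ.src e)

/-- The linear space of the face of all curves with the combinatorial type of `Γ`: the vertex
positions of these curves form a relatively open, nonempty convex cone in this space, cut out by
the requirement that the edges of positive weight have positive length. -/
def faceSpace : Submodule ℝ (V → ℝ ⊗[ℤ] N) :=
  ⨅ e : E, (Submodule.span ℝ {realPt (Γ.dir e)}).comap (Γ.edgeVector e)

/-- The expected dimension `#I + (r - 3)(1 - g) - ov(Γ)` of the face of the type of `Γ`. -/
def expectedDim : ℤ := Fintype.card I + ((finrank ℤ N : ℤ) - 3) * (1 - Γ.genus) - ∑ v, Γ.overvalence v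

/-- No loop of contracted edges, no vertex of higher genus, and a face of the expected dimension. -/
def NonSuperabundant : Prop :=
  (∀ e, Γ.wt e = 0 → ¬ Relation.EqvGen
    (fun a b => ∃ e', e' ≠ e ∧ Γ.wt e' = 0 ∧ Γ.src e' = a ∧ Γ.tgt e' = b) (Γ.src e) (Γ.tgt e)) ∧
  (∀ v, Γ.genusAt v = 0) ∧ (finrank ℝ Γ.faceSpace : ℤ) = Γ.expectedDim

/-- Every leg is mapped into the corresponding affine subspace. -/
def Matches (A : I → AffineSubspace ℝ (ℝ ⊗[ℤ] N)) : Prop :=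
  ∀ i, ∀ t : ℝ, 0 ≤ t → Γ.pos (Γ.leg i) + t • realPt (Γ.legDir i) ∈ A i

open scoped Classical in
/-- The ψ-class conditions: `ov(v) ≥ ∑ s i`, summed over the contracted legs `i` at `v`. (The values of `s`
at other legs play no role.) -/
def Satisfies (s : I → ℕ) : Prop :=
  ∀ v, ((∑ i with Γ.leg i = v ∧ Γ.legWt i = 0, s i : ℕ) : ℤ) ≤ Γ.overvalence v

end TropicalCurve

/-- The codimension of an affine subspace. -/
def codim (A : AffineSubspace ℝ (ℝ ⊗[ℤ] N)) : ℕ := finrank ℝ ((ℝ ⊗[ℤ] N) ⧸ A.direction)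

/-- The lattice `L_N(A)` of lattice vectors parallel to `A`. -/
def latticeDir (A : AffineSubspace ℝ (ℝ ⊗[ℤ] N)) : AddSubgroup N :=
  A.direction.toAddSubgroup.comap (TensorProduct.mk ℤ ℝ N 1).toAddMonoidHom

/-- The affine subspace `A` has rational slope: its direction is spanned by lattice vectors. -/
def IsRational (A : AffineSubspace ℝ (ℝ ⊗[ℤ] N)) : Prop :=
  A.direction = Submodule.span ℝ (realPt '' (latticeDir A : Set N))

/-- `α` is a form associated with `A` taken with weight `w`: an element of `Λ^codim(A) M` of index `w`
that is trivial along `A`, in the sense that all its contractions with vectors of `L_N(A)` vanish.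
It is unique up to sign. -/
structure IsTropicalForm (A : AffineSubspace ℝ (ℝ ⊗[ℤ] N)) (w : ℕ)
    (α : ExteriorAlgebra ℤ (Dual ℤ N)) : Prop where
  homogeneous : α ∈ ⋀[ℤ]^(codim A) (Dual ℤ N)
  restrict : ∀ v ∈ latticeDir A, CliffordAlgebra.contractLeft (Dual.eval ℤ N v) α = 0
  index : ∃ β, IsPrimitive β ∧ α = w • β

namespace TropicalCurve
variable [Fintype V] [Fintype E] [Fintype I] (Γ : TropicalCurve N V E I)

/-- `Γ` is rigid with respect to the constraints `A` and the ψ-class conditions `s`. -/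
structure IsRigid (A : I → AffineSubspace ℝ (ℝ ⊗[ℤ] N)) (s : I → ℕ) : Prop where
  nonSuperabundant : Γ.NonSuperabundant
  matches_ : Γ.Matches A
  satisfies : Γ.Satisfies s
  codim : ((∑ i, codim (A i) : ℕ) : ℤ) = Γ.expectedDim

/-- The lattice of lattice vectors parallel to an edge (`0` for an edge of weight `0`). -/
def latticeEdge (e : E) : AddSubgroup N :=
  (Submodule.span ℝ {realPt (Γ.dir e)}).toAddSubgroup.comap (TensorProduct.mk ℤ ℝ N 1).toAddMonoidHom

/-- The map `∏_V N → ∏_E N / L_N(E) × ∏_i N / L_N(A_i)`. -/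
def Phi (A : I → AffineSubspace ℝ (ℝ ⊗[ℤ] N)) :
    (V → N) →+ (∀ e, N ⧸ Γ.latticeEdge e) × (∀ i, N ⧸ latticeDir (A i)) where
  toFun H := (fun e => QuotientAddGroup.mk (H (Γ.tgt e) - H (Γ.src e)),
    fun i => QuotientAddGroup.mk (H (Γ.leg i)))
  map_zero' := by ext <;> simp
  map_add' H K := by
    ext
    · simp only [Pi.add_apply, Prod.fst_add, ← QuotientAddGroup.mk_add]; congr 1; abel
    · rfl

/-- The multiplicity: the index of `Phi` (`0` if it is infinite) times the weights of the compact edges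
and the weights `w i` of the constraints. -/
def mult (A : I → AffineSubspace ℝ (ℝ ⊗[ℤ] N)) (w : I → ℕ) : ℕ :=
  (Γ.Phi A).range.index * (∏ e, Γ.wt e) * ∏ i, w i

end TropicalCurve
end Curves

end TropQFT

end

open TropQFT Module
open scoped TensorProduct

/-! Both sides are the square of one integral determinant, up to the same weights. A curve of genus
0 without vertices of positive genus is a tree with expected dimension `r + #E`. Its face has at
most `r` plus the number of non-contracted compact edges as dimension, so a rigid curve has no
contracted compact edges (`wt_ne_zero`). The lattice configurations of the vertices whose edges keep
their directions are then parametrised by `ℤ^(r + #E)`: the position of a root and the signed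
lengths of the edges (`position`). Rigidity also gives `∑ codim A_i = r + #E`, so the integral
coordinates `θ_i` of `N / L(A_i)`, evaluated at the vertices of the legs, form a square matrix `T`
in these parameters.

Multiplicity: on a tree the edge components of `Phi` can be prescribed freely. Hence the index of
`Phi` is that of the leg components on the kernel of the edge components, which is `|det T|`, with
`0` for an infinite index (`index_Phi`).

Field theory: expand everything that flows into a vertex in a basis and everything that flows out in
the dual basis. By adjunction of `κ` and `κd` every vertex becomes a trace that is symmetric in its
half-edges, and the four possible operations in the middle of an edge become coordinates of one and
the same cotrace. The resulting formula `eval_eq` does not contain the flow. On a tree it is summed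
leaf by leaf. Summing over the states of an edge inserts `κ ∘ κd`, which is contraction by the
weighted direction and thus `w(E)²` times contraction by the primitive one (`κ_κd_of_eq_mk`). The
trace over `ℤ^(r + k)` of the classes pulled back along the vertex positions obeys the same
recursion, because the length of the last edge is a coordinate that only the last vertex sees
(`boxTr_prod_position_succ`). So the theory computes `∏ w(E)²` times one trace over `ℤ^(r + #E)`
(`treeSum_eq_boxTr`).

Finally `α_i^□` is `w_i²` times the product of the squares of the coordinates of `θ_i`
(`exists_coordinates_square`), and the trace of a product of squares of vectors is a squared
determinant, here `(det T)²`. Signs of the forms and of the directions disappear because everything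
enters quadratically. -/

namespace TropQFT
namespace TrQFTData
-- Dual bases, and independence of the flow
section frobenius
variable {X : Type*} [Zero X] (F : TrQFTData X) (x : X)

theorem dual_repr (a : F.C x) (s : F.Idx x) : (F.dual x).repr a s = F.tr x (a * F.basis x s) :=
  LinearMap.BilinForm.dualBasis_repr_apply (F.form_nondegenerate x) (F.basis x) a s

theorem basis_repr (a : F.C x) (s : F.Idx x) : (F.basis x).repr a s = F.tr x (a * F.dual x s) := by
  have key : ∀ i, F.tr x (F.basis x i * F.dual x s) = if i = s then 1 else 0 := fun i => by
    rw [mul_comm]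
    exact LinearMap.BilinForm.apply_dualBasis_left (F.form_nondegenerate x) (F.basis x) s i
  conv_rhs => rw [← (F.basis x).sum_repr a, Finset.sum_mul, map_sum]
  simp only [smul_mul_assoc, map_smul, key]
  simp

/-- The chosen basis of `C x` for incoming half-edges and its dual basis for outgoing ones. -/
noncomputable def flowBasis (b : Bool) : Basis (F.Idx x) ℚ (F.C x) :=
  if b then F.basis x else F.dual x

end frobenius

section eval
variable {X : Type*} [Zero X] (F : TrQFTData X)
  {V E I : Type*} [Fintype V] [Fintype E] [Fintype I] (Γ : TropCobordism X V E I) (φ : Γ.Flow)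

open TropCobordism
open scoped Classical

/-- A half-edge `g` lies at exactly one vertex, so one factor depends on `a`, and linearly; `q`
collects the other vertices and `z` the other half-edges at that vertex. This is what makes
`vertexTraces` multilinear. -/
theorem exists_prod_tr_update [DecidableEq (Flag E I)] (y : ∀ f : Flag E I, F.C (Γ.colour f)) (g : Flag E I) :
    ∃ (z : F.C 0) (q : ℚ), ∀ a, ∏ v, F.tr 0 (F.handle ^ Γ.genus v *
      ∏ f, if Γ.vertexOf f = v then F.κ (Γ.colour f) (Function.update y g a f) else 1) =
        q * F.tr 0 (z * F.κ (Γ.colour g) a) := by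
  refine ⟨F.handle ^ Γ.genus (Γ.vertexOf g) * ∏ f ∈ Finset.univ.erase g,
    if Γ.vertexOf f = Γ.vertexOf g then F.κ (Γ.colour f) (y f) else 1,
    ∏ v ∈ Finset.univ.erase (Γ.vertexOf g), F.tr 0 (F.handle ^ Γ.genus v *
      ∏ f, if Γ.vertexOf f = v then F.κ (Γ.colour f) (y f) else 1), fun a => ?_⟩
  rw [← Finset.prod_erase_mul _ _ (Finset.mem_univ (Γ.vertexOf g))]
  congr 1
  · refine Finset.prod_congr rfl fun v hv => ?_
    congr 2
    refine Finset.prod_congr rfl fun f _ => ?_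
    split_ifs with h
    · rw [Function.update_of_ne]
      rintro rfl
      exact Finset.ne_of_mem_erase hv h.symm
    · rfl
  · rw [← Finset.prod_erase_mul _ _ (Finset.mem_univ g), if_pos rfl, Function.update_self, mul_assoc]
    congr 3
    refine Finset.prod_congr rfl fun f hf => ?_
    rw [Function.update_of_ne (Finset.ne_of_mem_erase hf)]

/-- The product over all vertices of the traces of the elements that are inserted at the
half-edges. -/
noncomputable def vertexTraces : MultilinearMap ℚ (fun f : Flag E I => F.C (Γ.colour f)) ℚ where
  toFun y := ∏ v, F.tr 0 (F.handle ^ Γ.genus v *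
    ∏ f, if Γ.vertexOf f = v then F.κ (Γ.colour f) (y f) else 1)
  map_update_add' := by
    intro _ y g a b
    obtain ⟨z, q, h⟩ := F.exists_prod_tr_update Γ y g
    rw [h, h, h, map_add, mul_add, map_add, mul_add]
  map_update_smul' := by
    intro _ y g c a
    obtain ⟨z, q, h⟩ := F.exists_prod_tr_update Γ y g
    rw [h, h, map_smul, mul_smul_comm, map_smul, mul_smul_comm]

/-- A coordinate of `κd` is a trace against a dual basis element, and adjunction moves it to `κ` of
that element. Expanding these elements in the dual basis of `C 0` reproduces the sum that defines
the coproduct. Outputs of a vertex thereby become further inputs under the trace. -/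
theorem tensorCoord_map_coprod {S : Type*} [Fintype S] (c : S → X) (s : ∀ t, F.Idx (c t))
    (z : F.C 0) :
    F.tensorCoord c s (PiTensorProduct.map (fun t => F.κd (c t)) (F.coprod S z)) =
      F.tr 0 (z * ∏ t, F.κ (c t) (F.dual (c t) (s t))) := by
  have h : ∀ t, F.κ (c t) (F.dual (c t) (s t)) =
      ∑ j, (F.basis (c t)).coord (s t) (F.κd (c t) (F.basis 0 j)) • F.dual 0 j := by
    intro t
    conv_lhs => rw [← (F.dual 0).sum_repr (F.κ (c t) (F.dual (c t) (s t)))]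
    refine Finset.sum_congr rfl fun j _ => ?_
    rw [dual_repr, Basis.coord_apply, basis_repr, F.adjoint, mul_comm]
  simp only [h, Finset.prod_univ_sum, Fintype.piFinset_univ, Finset.mul_sum, map_sum, coprod,
    map_smul, tensorCoord, PiTensorProduct.map_tprod, PiTensorProduct.lift.tprod]
  refine Finset.sum_congr rfl fun j _ => ?_
  rw [Finset.prod_smul, mul_smul_comm, map_smul, smul_eq_mul, smul_eq_mul, mul_comm]
  simp

omit [Fintype V] in
-- Incoming and outgoing half-edges now enter in the same way; the flow only decides between a basis
-- and its dual.
theorem vertexAmp_eq (s : F.State Γ) (v : V) :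
    F.vertexAmp Γ φ s v = F.tr 0 (F.handle ^ Γ.genus v *
      ∏ f, if Γ.vertexOf f = v then
        F.κ (Γ.colour f) (F.flowBasis (Γ.colour f) (φ.toV f) (s f)) else 1) := by
  rw [vertexAmp, tensorCoord_map_coprod, mul_assoc]
  congr 2
  have h : ∀ b, (∏ f : {f // Γ.vertexOf f = v ∧ φ.toV f = b},
      F.κ (Γ.colour f) (F.flowBasis (Γ.colour f) (φ.toV f) (s f))) =
      ∏ f, if Γ.vertexOf f = v ∧ φ.toV f = b then
        F.κ (Γ.colour f) (F.flowBasis (Γ.colour f) (φ.toV f) (s f)) else 1 := by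
    intro b
    rw [← Finset.prod_filter]
    exact (Finset.prod_subtype (Finset.univ.filter fun f => Γ.vertexOf f = v ∧ φ.toV f = b)
      (fun f => by simp) fun f => F.κ (Γ.colour f)
        (F.flowBasis (Γ.colour f) (φ.toV f) (s f))).symm
  trans (∏ f : {f // Γ.vertexOf f = v ∧ φ.toV f = true},
      F.κ (Γ.colour f) (F.flowBasis (Γ.colour f) (φ.toV f) (s f))) *
    ∏ f : {f // Γ.vertexOf f = v ∧ φ.toV f = false},
      F.κ (Γ.colour f) (F.flowBasis (Γ.colour f) (φ.toV f) (s f))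
  -- On each of the two index sets `toV` is constant, so `flowBasis` reduces to the basis or to its
  -- dual.
  · congr 1 <;> refine Finset.prod_congr rfl fun f _ => ?_ <;> rw [f.2.2] <;> rfl
  rw [h, h, ← Finset.prod_mul_distrib]
  refine Finset.prod_congr rfl fun f _ => ?_
  cases φ.toV f <;> by_cases hv : Γ.vertexOf f = v <;> simp [hv]

/-- The elements inserted at the half-edges: a basis element at the source of an edge, the dual basis
element at its target, and the given argument at a leg. -/
noncomputable def insertions (γ : ∀ i, F.C (Γ.deg i)) (t : ∀ e, F.Idx (Γ.dir e)) :
    ∀ f : Flag E I, F.C (Γ.colour f)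
  | Sum.inl (e, false) => F.basis (Γ.dir e) (t e)
  | Sum.inl (e, true) => F.dual (Γ.dir e) (t e)
  | Sum.inr i => γ i

/-- The left side is a coordinate of the cotrace `∑ basis ⊗ dual` in the bases chosen by the
directions of the two half-edges. The cotrace is inverse to the trace pairing (`h1`), so all four
operations in the middle of an edge are this one tensor. -/
theorem sum_repr_mul_repr (x : X) (b c : Bool) (i j : F.Idx x) :
    ∑ t, (F.flowBasis x b).repr (F.basis x t) i * (F.flowBasis x c).repr (F.dual x t) j =
      match b, c with
      | true, true => ((F.basis x).tensorProduct (F.basis x)).coord (i, j) (F.cotrace x)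
      | false, false => F.tr x (F.basis x i * F.basis x j)
      | false, true => (F.basis x).coord j (F.basis x i)
      | true, false => (F.basis x).coord i (F.basis x j) := by
  have h1 : ∀ z w : F.C x, ∑ t, F.tr x (F.basis x t * z) * F.tr x (F.dual x t * w) =
      F.tr x (z * w) := by
    intro z w
    conv_rhs => rw [← (F.dual x).sum_repr z]
    simp only [dual_repr, Finset.sum_mul, map_sum, smul_mul_assoc, map_smul, smul_eq_mul,
      mul_comm z]
  cases b <;> cases c <;>
    simp only [flowBasis, Bool.false_eq_true, if_false, if_true, dual_repr, basis_repr, h1]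
  · rw [Basis.coord_apply, basis_repr]
  · rw [Basis.coord_apply, basis_repr, mul_comm]
  · rw [cotrace, map_sum]
    simp only [Basis.coord_apply, Basis.tensorProduct_repr_tmul_apply, basis_repr, smul_eq_mul]
    rw [← h1 (F.dual x i) (F.dual x j)]
    exact Finset.sum_congr rfl fun t _ => mul_comm _ _

omit [Fintype V] in
-- The index `t e` occurs only at the two halves of `e`, so the sum factors over the edges.
theorem sum_prod_repr (γ : ∀ i, F.C (Γ.deg i)) (s : F.State Γ) :
    ∑ t : ∀ e, F.Idx (Γ.dir e), ∏ f,
      (F.flowBasis (Γ.colour f) (φ.toV f)).repr (F.insertions Γ γ t f) (s f) =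
      (∏ e, F.edgeAmp Γ φ s e) * ∏ i, F.legAmp Γ φ s i (γ i) := by
  have he : ∀ e, F.edgeAmp Γ φ s e = ∑ t,
      (F.flowBasis (Γ.dir e) (φ.toV (Sum.inl (e, false)))).repr (F.basis (Γ.dir e) t)
        (s (Sum.inl (e, false))) *
      (F.flowBasis (Γ.dir e) (φ.toV (Sum.inl (e, true)))).repr (F.dual (Γ.dir e) t)
        (s (Sum.inl (e, true))) := by
    intro e
    exact (F.sum_repr_mul_repr (Γ.dir e) _ _ _ _).symm
  have hl : ∀ i, F.legAmp Γ φ s i (γ i) =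
      (F.flowBasis (Γ.deg i) (φ.toV (Sum.inr i))).repr (γ i) (s (Sum.inr i)) := by
    intro i
    rw [legAmp]
    cases φ.toV (Sum.inr i)
    · refine Eq.trans ?_ (F.dual_repr (Γ.deg i) _ _).symm
      rw [mul_comm]; rfl
    · rfl
  simp only [he, hl, Finset.prod_univ_sum, Fintype.piFinset_univ, Finset.sum_mul]
  refine Finset.sum_congr rfl fun t _ => ?_
  rw [Fintype.prod_sum_type, Fintype.prod_prod_type]
  simp only [Fintype.prod_bool]
  congr 1
  exact Finset.prod_congr rfl fun e _ => mul_comm _ _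

/-- The right side does not mention `φ`: this is the independence of the flow. Its acyclicity is not
needed for the identity, since the state sum makes sense for every orientation of the half-edges. -/
theorem eval_eq (γ : ∀ i, F.C (Γ.deg i)) :
    F.eval Γ φ (⨂ₜ[ℚ] i, γ i) =
      ∑ t : ∀ e, F.Idx (Γ.dir e), F.vertexTraces Γ (F.insertions Γ γ t) := by
  have h : ∀ t, F.vertexTraces Γ (F.insertions Γ γ t) = ∑ s : F.State Γ,
      (∏ f, (F.flowBasis (Γ.colour f) (φ.toV f)).repr (F.insertions Γ γ t f) (s f)) *
        ∏ v, F.vertexAmp Γ φ s v := by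
    intro t
    -- Each insertion is expanded in the basis that the flow prescribes at its half-edge;
    -- multilinearity then produces the sum over states.
    conv_lhs => rw [show F.insertions Γ γ t = fun f => ∑ a,
      (F.flowBasis (Γ.colour f) (φ.toV f)).repr (F.insertions Γ γ t f) a •
        F.flowBasis (Γ.colour f) (φ.toV f) a from funext fun f => (Basis.sum_repr _ _).symm]
    rw [MultilinearMap.map_sum]
    refine Finset.sum_congr rfl fun s _ => ?_
    rw [MultilinearMap.map_smul_univ, smul_eq_mul]
    congr 1
    refine Finset.prod_congr rfl fun v _ => ?_
    rw [vertexAmp_eq]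
  simp only [h]
  rw [Finset.sum_comm]
  simp only [← Finset.sum_mul, sum_prod_repr, eval, LinearMap.sum_apply, LinearMap.smul_apply,
    PiTensorProduct.lift.tprod, MultilinearMap.compLinearMap_apply,
    MultilinearMap.mkPiAlgebra_apply, smul_eq_mul]
  exact Finset.sum_congr rfl fun s _ => by ring

end eval
end TrQFTData
end TropQFT

/-! ### Enumerations of finite trees -/

namespace TropQFT

section order
variable {V E : Type*}

/-- An enumeration of the vertices and edges of a finite tree in which the `i`-th edge joins the vertex
with number `i + 1` to a vertex `parent i` with a smaller number. -/
structure TreeOrder (src tgt : E → V) (k : ℕ) where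
  vert : ℕ → V
  edge : Fin k ≃ E
  parent : ℕ → ℕ
  parent_le : ∀ i, parent i ≤ i
  bijective : Function.Bijective fun i : Fin (k + 1) => vert i
  joins : ∀ i : Fin k, (src (edge i) = vert (parent i) ∧ tgt (edge i) = vert (i + 1)) ∨
    (tgt (edge i) = vert (parent i) ∧ src (edge i) = vert (i + 1))

variable [Fintype V] [Fintype E]

omit [Fintype E] in
-- The visited set grows by one edge at a time. Only the values of `vert` up to `k` and of `parent`
-- below `k` carry information.
theorem exists_partial_treeOrder (src tgt : E → V) (v₀ : V)
    (conn : ∀ v v', Relation.EqvGen (fun a b => ∃ e, src e = a ∧ tgt e = b) v v') (k : ℕ)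
    (hk : k < Fintype.card V) :
    ∃ (vert : ℕ → V) (parent : ℕ → ℕ), (∀ i, parent i ≤ i) ∧
      Set.InjOn vert {i | i ≤ k} ∧ ∀ i < k, ∃ e, (src e = vert (parent i) ∧ tgt e = vert (i + 1)) ∨
        (tgt e = vert (parent i) ∧ src e = vert (i + 1)) := by
  induction k with
  | zero => exact ⟨fun _ => v₀, id, fun _ => le_rfl, fun a ha b hb _ => by simp_all, by simp⟩
  | succ k ih =>
    obtain ⟨f, p, hp, hf, he⟩ := ih (by omega)
    have hS : ∃ v, ∀ i ≤ k, f i ≠ v := by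
      by_contra! h
      have : Function.Surjective fun i : Fin (k + 1) => f i := fun v => by
        obtain ⟨i, hi, rfl⟩ := h v
        exact ⟨⟨i, by omega⟩, rfl⟩
      have := Fintype.card_le_of_surjective _ this
      simp at this
      omega
    obtain ⟨v, hv⟩ := hS
    obtain ⟨e, m, u, hm, hu, h⟩ : ∃ e m u, m ≤ k ∧ (∀ i ≤ k, f i ≠ u) ∧
        ((src e = f m ∧ tgt e = u) ∨ (tgt e = f m ∧ src e = u)) := by
      -- If no edge left the visited set, being visited would be constant along the connectivity
      -- relation, and `v` would be visited.
      by_contra! hcon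
      have key : ∀ a b, Relation.EqvGen (fun a b => ∃ e, src e = a ∧ tgt e = b) a b →
          ((∃ i ≤ k, f i = a) ↔ ∃ i ≤ k, f i = b) := by
        intro a b h
        induction h with
        | rel a b h =>
          obtain ⟨e, rfl, rfl⟩ := h
          constructor
          · rintro ⟨i, hi, h⟩
            by_contra! h2
            exact (hcon e i _ hi h2).1 h.symm rfl
          · rintro ⟨i, hi, h⟩
            by_contra! h2
            exact (hcon e i _ hi h2).2 h.symm rfl
        | refl a => rfl
        | symm a b _ h => exact h.symm
        | trans a b c _ _ h1 h2 => exact h1.trans h2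
      obtain ⟨i, hi, h⟩ := (key _ _ (conn (f 0) v)).1 ⟨0, by omega, rfl⟩
      exact hv i hi h
    refine ⟨Function.update f (k + 1) u, Function.update p k m, ?_, ?_, ?_⟩
    · intro i
      rcases eq_or_ne i k with rfl | h
      · simpa
      · simpa [h] using hp i
    · intro a ha b hb hab
      simp only [Set.mem_ofPred_eq] at ha hb
      rcases eq_or_ne a (k + 1) with rfl | h1 <;> rcases eq_or_ne b (k + 1) with rfl | h2
      · rfl
      · simp only [Function.update_self, Function.update_of_ne h2] at hab
        exact absurd hab.symm (hu b (by omega))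
      · simp only [Function.update_self, Function.update_of_ne h1] at hab
        exact absurd hab (hu a (by omega))
      · simp only [Function.update_of_ne h1, Function.update_of_ne h2] at hab
        exact hf (by simp; omega) (by simp; omega) hab
    · intro i hi
      rcases eq_or_ne i k with rfl | h'
      · exact ⟨e, by simpa [Function.update_of_ne (show m ≠ i + 1 by omega)] using h⟩
      · have := hp i
        rw [Function.update_of_ne h', Function.update_of_ne (show i + 1 ≠ k + 1 by omega),
          Function.update_of_ne (show p i ≠ k + 1 by omega)]
        exact he i (by omega)

/-- The chosen edges are distinct, and there are as many of them as edges in total, so a spanning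
enumeration uses every edge once. -/
theorem exists_treeOrder (src tgt : E → V) (v₀ : V)
    (conn : ∀ v v', Relation.EqvGen (fun a b => ∃ e, src e = a ∧ tgt e = b) v v')
    (hcard : Fintype.card E + 1 = Fintype.card V) :
    Nonempty (TreeOrder src tgt (Fintype.card E)) := by
  obtain ⟨f, p, hp, hf, he⟩ := exists_partial_treeOrder src tgt v₀ conn (Fintype.card E) (by omega)
  choose g hg using fun i : Fin (Fintype.card E) => he i i.2
  have hbij : Function.Bijective fun i : Fin (Fintype.card E + 1) => f i := by
    rw [Fintype.bijective_iff_injective_and_card]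
    refine ⟨fun a b h => Fin.ext (hf ?_ ?_ h), by simpa using hcard⟩ <;> simp <;> omega
  have hinj : ∀ {i j}, i ≤ Fintype.card E → j ≤ Fintype.card E → f i = f j → i = j :=
    fun hi hj h => hf hi hj h
  have hg' : Function.Bijective g := by
    rw [Fintype.bijective_iff_injective_and_card]
    refine ⟨fun a b h => ?_, by simp⟩
    have ha := hg a
    have hb := hg b
    have hpa := hp a
    have hpb := hp b
    rw [h] at ha
    ext
    -- If the two indices see the same end of the edge as the child, then `a + 1 = b + 1`. If they
    -- see opposite ends, then `a + 1 = p b ≤ b` and `b + 1 = p a ≤ a`, which is absurd.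
    rcases ha with ⟨h1, h2⟩ | ⟨h1, h2⟩ <;> rcases hb with ⟨h3, h4⟩ | ⟨h3, h4⟩
    · have := hinj (by omega) (by omega) (h2.symm.trans h4)
      omega
    · have h5 := hinj (by omega) (by omega) (h2.symm.trans h3)
      have h6 := hinj (by omega) (by omega) (h1.symm.trans h4)
      omega
    · have h5 := hinj (by omega) (by omega) (h2.symm.trans h3)
      have h6 := hinj (by omega) (by omega) (h1.symm.trans h4)
      omega
    · have := hinj (by omega) (by omega) (h2.symm.trans h4)
      omega
  exact ⟨⟨f, Equiv.ofBijective g hg', p, hp, hbij, hg⟩⟩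

end order

/-! ### State sums on trees, summed leaf by leaf -/

section elimination
variable {C : Type*} [CommRing C] [Algebra ℚ C] (Tr : C →ₗ[ℚ] ℚ) (p : ℕ → ℕ)

/-- The sum over all states of the products over the vertices of a tree, in an enumeration of the
vertices and edges. -/
def treeSum {k : ℕ} {ι : Fin k → Type*} [∀ i, Fintype (ι i)] (a b : ∀ i, ι i → C) (z : ℕ → C) : ℚ :=
  ∑ t : ∀ i, ι i, ∏ v ∈ Finset.range (k + 1), Tr (z v * ∏ i : Fin k,
    ((if p i = v then a i (t i) else 1) * (if (i : ℕ) + 1 = v then b i (t i) else 1)))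

/-- The vertex `k + 1` is a leaf that only meets the last edge. Summing over the states of this edge
removes the leaf and multiplies the class at its parent by what the leaf transmits. -/
theorem treeSum_succ {k : ℕ} {ι : Fin (k + 1) → Type*} [∀ i, Fintype (ι i)]
    (hp : ∀ i, p i ≤ i) (a b : ∀ i, ι i → C) (z : ℕ → C) :
    treeSum Tr p a b z = treeSum Tr p (fun i : Fin k => a i.castSucc) (fun i => b i.castSucc)
      (Function.update z (p k)
        (z (p k) * ∑ s, Tr (z (k + 1) * b (Fin.last k) s) • a (Fin.last k) s)) := by
  rw [treeSum, treeSum, ← (Fin.snocEquiv ι).sum_comp, Fintype.sum_prod_type_right]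
  refine Finset.sum_congr rfl fun t _ => ?_
  have hmem : p k ∈ Finset.range (k + 1) := by have := hp k; simp; omega
  -- The state `s` of the last edge is isolated in the factors at `p k` and `k + 1`; all other
  -- vertices do not see it.
  have h1 : ∀ s, (∏ v ∈ Finset.range (k + 1 + 1), Tr (z v * ∏ i : Fin (k + 1),
      ((if p i = v then a i (Fin.snocEquiv ι (s, t) i) else 1) *
        (if (i : ℕ) + 1 = v then b i (Fin.snocEquiv ι (s, t) i) else 1)))) =
      (∏ v ∈ (Finset.range (k + 1)).erase (p k), Tr (z v * ∏ i : Fin k,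
        ((if p i = v then a i.castSucc (t i) else 1) *
          (if (i : ℕ) + 1 = v then b i.castSucc (t i) else 1)))) *
      (Tr ((z (p k) * ∏ i : Fin k,
        ((if p i = p k then a i.castSucc (t i) else 1) *
          (if (i : ℕ) + 1 = p k then b i.castSucc (t i) else 1))) * a (Fin.last k) s) *
      Tr (z (k + 1) * b (Fin.last k) s)) := by
    intro s
    simp only [Fin.snocEquiv_apply, Fin.prod_univ_castSucc, Fin.snoc_castSucc, Fin.snoc_last,
      Fin.val_last, Fin.val_castSucc]
    rw [Finset.prod_range_succ, ← Finset.prod_erase_mul _ _ hmem, mul_assoc]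
    congr 1
    · refine Finset.prod_congr rfl fun v hv => ?_
      have h2 := Finset.ne_of_mem_erase hv
      have h3 := Finset.mem_range.1 (Finset.mem_of_mem_erase hv)
      rw [if_neg (Ne.symm h2), if_neg (by omega : k + 1 ≠ v), mul_one, mul_one]
    · have h2 := hp k
      -- For `i < k` both ends `p i ≤ i` and `i + 1` differ from `k + 1`, so earlier edges miss the
      -- leaf.
      have h3 : (∏ i : Fin k, ((if p i = k + 1 then a i.castSucc (t i) else 1) *
          (if (i : ℕ) + 1 = k + 1 then b i.castSucc (t i) else 1))) = 1 := by
        refine Finset.prod_eq_one fun i _ => ?_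
        have := hp i
        rw [if_neg (by omega), if_neg (by omega), mul_one]
      rw [h3, if_pos rfl, if_neg (by omega : k + 1 ≠ p k), if_neg (by omega : p k ≠ k + 1),
        if_pos rfl, mul_one, one_mul, one_mul, mul_assoc]
  simp only [h1]
  rw [← Finset.mul_sum, ← Finset.prod_erase_mul _ _ hmem, Function.update_self]
  congr 1
  · refine Finset.prod_congr rfl fun v hv => ?_
    rw [Function.update_of_ne (Finset.ne_of_mem_erase hv)]
  · rw [mul_right_comm, Finset.mul_sum, map_sum]
    refine Finset.sum_congr rfl fun s _ => ?_
    rw [mul_smul_comm, map_smul, smul_eq_mul, mul_comm]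

end elimination

namespace TrQFTData
variable {X : Type*} [Zero X] (F : TrQFTData X)

/-- By adjunction the traces are the coordinates of `κd z`, so gluing along an edge of colour `x` is
the operator `κ ∘ κd`. The companion `sum_tr_basis_smul_dual` gives the same operator, so it does
not matter which end of the edge is the parent. -/
theorem sum_tr_dual_smul_basis (x : X) (z : F.C 0) :
    ∑ s, F.tr 0 (z * F.κ x (F.dual x s)) • F.κ x (F.basis x s) = F.κ x (F.κd x z) := by
  conv_rhs => rw [← (F.basis x).sum_repr (F.κd x z), map_sum]
  simp only [map_smul, basis_repr, F.adjoint]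

theorem sum_tr_basis_smul_dual (x : X) (z : F.C 0) :
    ∑ s, F.tr 0 (z * F.κ x (F.basis x s)) • F.κ x (F.dual x s) = F.κ x (F.κd x z) := by
  conv_rhs => rw [← (F.dual x).sum_repr (F.κd x z), map_sum]
  simp only [map_smul, dual_repr, F.adjoint]

variable {V E I : Type*} [Fintype V] [Fintype E] [Fintype I] (Γ : TropCobordism X V E I)
  {k : ℕ} (o : TreeOrder Γ.src Γ.tgt k)

open TropCobordism
open scoped Classical

/-- The basis element at the upper end of the `i`-th edge of an enumerated tree. -/
noncomputable def upper (i : Fin k) : F.Idx (Γ.dir (o.edge i)) → F.C 0 := fun s =>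
  F.κ _ (if Γ.src (o.edge i) = o.vert (o.parent i) then F.basis _ s else F.dual _ s)

/-- The basis element at the lower end of the `i`-th edge of an enumerated tree. -/
noncomputable def lower (i : Fin k) : F.Idx (Γ.dir (o.edge i)) → F.C 0 := fun s =>
  F.κ _ (if Γ.src (o.edge i) = o.vert (o.parent i) then F.dual _ s else F.basis _ s)

omit [Fintype V] [Fintype E] [Fintype I] in
theorem sum_tr_lower_smul_upper (i : Fin k) (z : F.C 0) :
    ∑ s, F.tr 0 (z * F.lower Γ o i s) • F.upper Γ o i s =
      F.κ (Γ.dir (o.edge i)) (F.κd (Γ.dir (o.edge i)) z) := by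
  unfold lower upper
  split_ifs
  · exact F.sum_tr_dual_smul_basis _ z
  · exact F.sum_tr_basis_smul_dual _ z

omit [Fintype V] [Fintype E] in
theorem _root_.TropQFT.TreeOrder.vert_inj {src tgt : E → V} (o : TreeOrder src tgt k) {i j : ℕ}
    (hi : i ≤ k) (hj : j ≤ k) : o.vert i = o.vert j ↔ i = j :=
  ⟨fun h => congrArg Fin.val (@o.bijective.1 ⟨i, by omega⟩ ⟨j, by omega⟩ h), fun h => by rw [h]⟩

/-- A translation to the enumeration: `upper` and `lower` select from `insertions` the elements at
the parent end and at the child end of an edge. -/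
theorem sum_vertexTraces (γ : ∀ i, F.C (Γ.deg i)) :
    ∑ t : ∀ e, F.Idx (Γ.dir e), F.vertexTraces Γ (F.insertions Γ γ t) =
      treeSum (F.tr 0) o.parent (F.upper Γ o) (F.lower Γ o) fun j =>
        F.handle ^ Γ.genus (o.vert j) *
          ∏ i, if Γ.leg i = o.vert j then F.κ (Γ.deg i) (γ i) else 1 := by
  rw [treeSum, ← (Equiv.piCongrLeft (fun e => F.Idx (Γ.dir e)) o.edge).sum_comp]
  refine Finset.sum_congr rfl fun t _ => ?_
  rw [Finset.prod_range]
  refine ((Equiv.ofBijective _ o.bijective).prod_comp _).symm.trans ?_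
  refine Finset.prod_congr rfl fun j _ => ?_
  rw [Equiv.ofBijective_apply, mul_assoc]
  congr 2
  rw [Fintype.prod_sum_type, Fintype.prod_prod_type, mul_comm, ← o.edge.prod_comp]
  congr 1
  refine Finset.prod_congr rfl fun i _ => ?_
  have hj : (j : ℕ) ≤ k := by omega
  have hpi := o.parent_le i
  rw [Fintype.prod_bool]
  simp only [vertexOf, insertions, Equiv.piCongrLeft_apply_apply, upper, lower, colour]
  rcases o.joins i with ⟨h1, h2⟩ | ⟨h1, h2⟩
  · rw [h1, h2, o.vert_inj (by omega) hj, o.vert_inj (by omega) hj, if_pos rfl, if_pos rfl, mul_comm]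
    congr!
  -- Here the source of the edge is the child, so `upper` must take the dual basis element, which is
  -- the one inserted at the target.
  · have : ¬ (i : ℕ) + 1 = o.parent i := by omega
    rw [h1, h2, o.vert_inj (by omega) hj, o.vert_inj (by omega) hj, o.vert_inj (by omega) (by omega),
      if_neg this, if_neg this]
    congr!

end TrQFTData
end TropQFT

/-! ### Contractions and traces of tropical classes -/

namespace TropQFT

section contraction
variable {V V' : Type*} [AddCommGroup V] [Module ℚ V] [AddCommGroup V'] [Module ℚ V']

/-- A product of squares can be written with at most one vector outside the kernel of `ψ ∘ h`.
Contraction removes the square of that vector, and on the remaining ones `h` and `h'` agree. This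
freedom allows `h'` to be `h` with one coordinate set to zero. -/
theorem dD_dmap (h h' : V' →ₗ[ℚ] V) (ψ : V →ₗ[ℚ] ℚ) (hh : ∀ v, ψ (h v) = 0 → h' v = h v)
    {x : DExt V'} (hx : x ∈ box V') : dD ψ (dmap h x) = dmap h' (dD (ψ ∘ₗ h) x) := by
  refine box_induction (p := fun x => dD ψ (dmap h x) = dmap h' (dD (ψ ∘ₗ h) x)) ?_ ?_ ?_ ?_ hx
  · simp
  · intro x y h1 h2; simp only [map_add, h1, h2]
  · intro c x h1; simp only [map_smul, h1]
  · intro l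
    rcases normal_form (ψ ∘ₗ h) l with h1 | ⟨v, l', h1, h2, -⟩
    · rw [dD_ker _ _ h1, map_zero, dmap_sqProd, dD_ker]
      simpa using h1
    · rw [h2, dD_cons_ker _ _ _ h1, map_mul, dmap_sq, dmap_sqProd, dD_cons_ker, map_smul, dmap_sqProd]
      · rw [List.map_congr_left fun u hu => (hh u (h1 u hu)).symm]; rfl
      · simpa using h1

theorem dD_mem_box (φ : V →ₗ[ℚ] ℚ) {x : DExt V} (hx : x ∈ box V) : dD φ x ∈ box V := by
  obtain ⟨y, hy, h⟩ := dD_mem (LinearMap.ker φ).subtype (φ := φ) (by simp) hx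
  exact h ▸ dmap_mem _ hy

theorem dD_smul (c : ℚ) (φ : V →ₗ[ℚ] ℚ) (x : DExt V) : dD (c • φ) x = c ^ 2 • dD φ x := by
  have hX : dX (c • φ) = c • dX φ := by unfold dX; rw [LinearMap.smul_comp, map_smul]
  have hY : dY (c • φ) = c • dY φ := by unfold dY; rw [LinearMap.smul_comp, map_smul]
  simp only [dD, hX, hY, LinearMap.comp_apply, LinearMap.smul_apply, map_smul, smul_smul, pow_two]

end contraction

section lattice
variable {L L' L'' : Type*} [AddCommGroup L] [AddCommGroup L'] [AddCommGroup L'']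

/-- Contraction by `(φ, 0) ∧ (0, φ)` on the tropical classes of a lattice. -/
noncomputable def boxInner (φ : L →ₗ[ℤ] ℤ) : boxAlg L →ₗ[ℚ] boxAlg L :=
  (dD (ratFun φ)).restrict (p := Subalgebra.toSubmodule (boxAlg L))
    (q := Subalgebra.toSubmodule (boxAlg L)) fun x hx => by
      rw [Subalgebra.mem_toSubmodule, boxAlg_eq] at *
      exact dD_mem_box _ hx

theorem coe_boxInner (φ : L →ₗ[ℤ] ℤ) (x : boxAlg L) :
    (boxInner φ x : DExt (ℚ ⊗[ℤ] L)) = dD (ratFun φ) x := rfl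

theorem ratFun_smul (c : ℤ) (φ : L →ₗ[ℤ] ℤ) : ratFun (c • φ) = (c : ℚ) • ratFun φ := by
  ext x
  simp [ratFun]

theorem boxInner_smul (c : ℤ) (φ : L →ₗ[ℤ] ℤ) (x : boxAlg L) :
    boxInner (c • φ) x = (c : ℚ) ^ 2 • boxInner φ x := by
  apply Subtype.ext
  rw [coe_boxInner, ratFun_smul, dD_smul]
  rfl

theorem boxMap_comp (f : L' →ₗ[ℤ] L'') (g : L →ₗ[ℤ] L') (x : boxAlg L) :
    boxMap (f ∘ₗ g) x = boxMap f (boxMap g x) := by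
  apply Subtype.ext
  rw [coe_boxMap, coe_boxMap, coe_boxMap, dmap, dmap, dmap, ← AlgHom.comp_apply,
    ExteriorAlgebra.map_comp_map, LinearMap.baseChange_comp]
  rfl

/-- The square of a lattice vector. -/
noncomputable def boxSq (a : L) : boxAlg L :=
  ⟨sq ((1 : ℚ) ⊗ₜ[ℤ] a), by rw [boxAlg_eq]; simpa using sqProd_mem [(1 : ℚ) ⊗ₜ[ℤ] a]⟩

theorem coe_boxSq (a : L) : (boxSq a : DExt (ℚ ⊗[ℤ] L)) = sq ((1 : ℚ) ⊗ₜ[ℤ] a) := rfl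

theorem boxMap_boxSq (f : L →ₗ[ℤ] L') (a : L) : boxMap f (boxSq a) = boxSq (f a) := by
  apply Subtype.ext
  rw [coe_boxMap, coe_boxSq, coe_boxSq, dmap_sq, LinearMap.baseChange_tmul]

theorem coe_prod_boxSq {n : ℕ} (a : Fin n → L) :
    ((∏ i, boxSq (a i) : boxAlg L) : DExt (ℚ ⊗[ℤ] L)) =
      sqProd (List.ofFn fun i => (1 : ℚ) ⊗ₜ[ℤ] a i) := by
  rw [← List.prod_ofFn, ← Subalgebra.coe_val, map_list_prod, sqProd, List.map_ofFn, List.map_ofFn]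
  rfl

/-- Insertion of a zero as the first coordinate. -/
def consZero (m : ℕ) : (Fin m → ℤ) →ₗ[ℤ] (Fin (m + 1) → ℤ) where
  toFun x := Fin.cons 0 x
  map_add' x y := by ext i; refine Fin.cases ?_ (fun i => ?_) i <;> simp
  map_smul' c x := by ext i; refine Fin.cases ?_ (fun i => ?_) i <;> simp

theorem consZero_injective (m : ℕ) : Function.Injective (consZero m) :=
  fun _ _ h => Fin.cons_right_injective (α := fun _ => ℤ) 0 h

theorem range_consZero (m : ℕ) :
    LinearMap.range (consZero m) = LinearMap.ker (LinearMap.proj (R := ℤ) (φ := fun _ => ℤ) 0) := by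
  ext x
  constructor
  · rintro ⟨y, rfl⟩; rfl
  · intro h
    refine ⟨Fin.tail x, ?_⟩
    have : x 0 = 0 := h
    conv_rhs => rw [← Fin.cons_self_tail x, this]
    rfl

/-- Contracting by the first coordinate after pushing forward along `h` is contracting by the first
component `φ` of `h` before: the rest only involves vectors in the kernel of `φ`, where `h` is
`consZero` after `h'`. -/
theorem boxContract_consZero {m : ℕ} (h : L →ₗ[ℤ] (Fin (m + 1) → ℤ)) (φ : L →ₗ[ℤ] ℤ)
    (h' : L →ₗ[ℤ] (Fin m → ℤ)) (hh : ∀ x, h x = Fin.cons (φ x) (h' x)) (x : boxAlg L) :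
    boxContract (consZero m) (consZero_injective m) _ (range_consZero m) (boxMap h x) =
      boxMap h' (boxInner φ x) := by
  apply Subtype.ext
  apply dmap_injective _ (ratMap_injective (consZero m) (consZero_injective m))
  have hx : (x : DExt (ℚ ⊗[ℤ] L)) ∈ box (ℚ ⊗[ℤ] L) := by rw [← boxAlg_eq]; exact x.2
  rw [dmap_boxContract, ← coe_boxMap, ← boxMap_comp, coe_boxMap, coe_boxMap, coe_boxInner]
  have hφ : ratFun φ = ratFun (LinearMap.proj (R := ℤ) (φ := fun _ => ℤ) 0) ∘ₗ h.baseChange ℚ := by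
    ext a
    simp [ratFun, hh]
  rw [hφ]
  refine dD_dmap _ _ _ (fun v hv => ?_) hx
  rw [← LinearMap.comp_apply, ← hφ] at hv
  -- After clearing denominators it suffices to compare the maps on a lattice vector, where `hh`
  -- applies.
  obtain ⟨q, a, hq, rfl⟩ := exists_denom v
  rw [map_smul, ratFun_tmul, one_mul, smul_eq_mul, mul_eq_zero] at hv
  have ha : φ a = 0 := by exact_mod_cast hv.resolve_left hq
  rw [map_smul, map_smul, LinearMap.baseChange_tmul, LinearMap.baseChange_tmul, hh, ha]
  rfl

theorem traceOf_map_sqProd {V V' : Type*} [AddCommGroup V] [Module ℚ V] [AddCommGroup V']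
    [Module ℚ V'] {d : ℕ} (e : Basis (Fin d) ℚ V) (e' : Basis (Fin d) ℚ V') (j : V →ₗ[ℚ] V')
    (hj : ∀ v i, e'.repr (j v) i = e.repr v i) {x : DExt V} (hx : x ∈ box V) :
    traceOf e' (dmap j x) = traceOf e x := by
  refine box_induction (p := fun x => traceOf e' (dmap j x) = traceOf e x) ?_ ?_ ?_ ?_ hx
  · simp
  · intro x y h1 h2; simp only [map_add, h1, h2]
  · intro c x h1; simp only [map_smul, h1]
  · intro l
    rw [dmap_sqProd]
    by_cases h : l.length = d
    · obtain ⟨a, rfl⟩ : ∃ a : Fin d → V, l = List.ofFn a := by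
        subst h; exact ⟨l.get, (List.ofFn_get l).symm⟩
      rw [List.map_ofFn, traceOf_sqProd_ofFn, traceOf_sqProd_ofFn]
      simp [hj]
    · rw [traceOf_sqProd_ne _ _ h, traceOf_sqProd_ne]
      simpa

variable [Module.Free ℤ L] [Module.Finite ℤ L] [Module.Free ℤ L'] [Module.Finite ℤ L']

/-- The trace can be computed in any lattice basis, since base change has determinant `± 1` and only
its square enters. -/
theorem boxTr_boxMap_equiv (f : L ≃ₗ[ℤ] L') (x : boxAlg L) :
    boxTr L' (boxMap f.toLinearMap x) = boxTr L x := by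
  change latTrace L' (boxMap f.toLinearMap x : boxAlg L').1 = latTrace L x.1
  rw [latTrace, traceOf_baseChange _ ((Module.finBasis ℤ L).map f) (boxMap f.toLinearMap x).2]
  refine traceOf_map_sqProd _ _ (f.toLinearMap.baseChange ℚ) (fun v i => ?_) (by rw [← boxAlg_eq]; exact x.2)
  induction v using TensorProduct.induction_on with
  | zero => simp
  | tmul q a => simp
  | add v w h1 h2 => simp only [map_add, Finsupp.add_apply, h1, h2]

/-- Both copies of `V` in `Λ(V ⊕ V)` contribute the same determinant; this is where the square in
the theorem comes from. The order of the factors is immaterial, so any enumeration `e` may be used.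
-/
theorem boxTr_prod_boxSq {n : ℕ} {Q : Type*} [Fintype Q] (e : Fin n ≃ Q) (x : Q → Fin n → ℤ) :
    boxTr (Fin n → ℤ) (∏ q, boxSq (x q)) = ((Matrix.of fun i j => x (e i) j).det : ℚ) ^ 2 := by
  rw [← e.prod_comp]
  change latTrace _ (∏ i, boxSq (x (e i)) : boxAlg _).1 = _
  rw [latTrace, traceOf_baseChange _ (Pi.basisFun ℤ (Fin n)) (∏ i, boxSq (x (e i)) : boxAlg _).2,
    coe_prod_boxSq, traceOf_sqProd_ofFn]
  congr 1
  refine Eq.trans ?_ (RingHom.map_det (Int.castRingHom ℚ) _).symm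
  congr 1
  ext i j
  simp

end lattice

/-! ### Traces over the positions of a tree -/

section position
variable {N L : Type*} [AddCommGroup N] {r : ℕ} (β : Basis (Fin r) ℤ N)
  (p : ℕ → ℕ) (u : ℕ → N)

/-- The position of the vertex `v` of an enumerated tree with edge directions `u` as a function of
the position of the root and of the lengths of the edges. -/
noncomputable def position : ∀ k, ℕ → ((Fin (r + k) → ℤ) →ₗ[ℤ] N)
  | 0, _ => β.equivFun.symm.toLinearMap
  | k + 1, v =>
    if v ≤ k then position k v ∘ₗ LinearMap.funLeft ℤ ℤ Fin.succ
    else position k (p k) ∘ₗ LinearMap.funLeft ℤ ℤ Fin.succ +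
      (LinearMap.proj (R := ℤ) (φ := fun _ : Fin (r + k + 1) => ℤ) 0).smulRight (u k)

/-- The newest edge length is coordinate `0`, the older parameters are the tail, and those of the
root come last. Older vertices do not depend on the newest length. -/
theorem position_succ_of_le {k v : ℕ} (h : v ≤ k) (x : Fin (r + k + 1) → ℤ) :
    position β p u (k + 1) v x = position β p u k v (Fin.tail x) := by
  rw [position, if_pos h]; rfl

theorem position_succ_self (k : ℕ) (x : Fin (r + k + 1) → ℤ) :
    position β p u (k + 1) (k + 1) x = position β p u k (p k) (Fin.tail x) + x 0 • u k := by
  rw [position, if_neg (by omega)]; rfl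

variable [AddCommGroup L] (val : L ≃ₗ[ℤ] Dual ℤ N)

/-- The linear forms on `ℤᵐ` that are obtained by pulling back linear forms on `N`. -/
def pullForm {m : ℕ} (h : (Fin m → ℤ) →ₗ[ℤ] N) : L →ₗ[ℤ] (Fin m → ℤ) :=
  LinearMap.pi fun j => Dual.eval ℤ N (h (Pi.single j 1)) ∘ₗ val.toLinearMap

theorem pullForm_apply {m : ℕ} (h : (Fin m → ℤ) →ₗ[ℤ] N) (a : L) (j : Fin m) :
    pullForm val h a j = val a (h (Pi.single j 1)) := rfl

theorem tail_single_zero {m : ℕ} : Fin.tail (Pi.single 0 1 : Fin (m + 1) → ℤ) = 0 := by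
  ext i; simp [Fin.tail]

theorem tail_single_succ {m : ℕ} (j : Fin m) :
    Fin.tail (Pi.single j.succ 1 : Fin (m + 1) → ℤ) = Pi.single j 1 := by
  ext i; simp [Fin.tail, Pi.single_apply]

theorem pullForm_position_of_le {k v : ℕ} (h : v ≤ k) :
    pullForm val (position β p u (k + 1) v) =
      consZero (r + k) ∘ₗ pullForm val (position β p u k v) := by
  ext a j
  refine Fin.cases ?_ (fun j => ?_) j
  · rw [pullForm_apply, position_succ_of_le _ _ _ h, tail_single_zero, map_zero, map_zero]; rfl
  · rw [pullForm_apply, position_succ_of_le _ _ _ h, tail_single_succ]; rfl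

theorem pullForm_position_self (k : ℕ) (a : L) :
    pullForm val (position β p u (k + 1) (k + 1)) a =
      Fin.cons (val a (u k)) (pullForm val (position β p u k (p k)) a) := by
  ext j
  refine Fin.cases ?_ (fun j => ?_) j
  · rw [pullForm_apply, position_succ_self, tail_single_zero, map_zero, Pi.single_eq_same, zero_add,
      one_smul]; rfl
  · rw [pullForm_apply, position_succ_self, tail_single_succ, Pi.single_eq_of_ne (Fin.succ_ne_zero j).symm,
      zero_smul, add_zero]; rfl

/-- This is the start of the induction: for a single vertex the pull-back is an isomorphism of
lattices. -/
theorem boxTr_pullForm_zero [Module.Free ℤ L] [Module.Finite ℤ L] (z : boxAlg L) :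
    boxTr (Fin r → ℤ) (boxMap (pullForm val β.equivFun.symm.toLinearMap) z) = boxTr L z := by
  have : pullForm val β.equivFun.symm.toLinearMap =
      (val ≪≫ₗ (β.constr ℤ).symm).toLinearMap := by
    ext a j
    simp [pullForm_apply, Basis.constr]
  rw [this, boxTr_boxMap_equiv]

theorem prod_boxMap_update_mul {L' : Type*} [AddCommGroup L'] {S : Finset ℕ} {m : ℕ} (hm : m ∈ S)
    (g : ℕ → L →ₗ[ℤ] L') (z : ℕ → boxAlg L) (d : boxAlg L) :
    ∏ v ∈ S, boxMap (g v) (Function.update z m (z m * d) v) =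
      boxMap (g m) d * ∏ v ∈ S, boxMap (g v) (z v) := by
  rw [← Finset.mul_prod_erase _ _ hm, ← Finset.mul_prod_erase _ _ hm, Function.update_self, map_mul,
    ← mul_assoc, mul_comm (boxMap (g m) (z m))]
  congr 1
  exact Finset.prod_congr rfl fun v hv => by rw [Function.update_of_ne (Finset.ne_of_mem_erase hv)]

theorem map_single_one_sq (m : ℕ) :
    (((LinearMap.proj (R := ℤ) (φ := fun _ : Fin (m + 1) => ℤ) 0) (Pi.single 0 1) : ℤ) : ℚ) ^ 2 = 1 := by
  simp

/-- All classes except the one at `k + 1` come from the kernel of the newest coordinate. Adjunction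
of inclusion and contraction for this coordinate reduces the trace to `ℤ^(r + k)`, and naturality of
contraction turns it into contraction of `z (k + 1)` by the edge direction `u k`, carried to the
parent. -/
theorem boxTr_prod_position_succ (k : ℕ) (z : ℕ → boxAlg L) :
    boxTr (Fin (r + (k + 1)) → ℤ) (∏ v ∈ Finset.range (k + 1 + 1),
        boxMap (pullForm val (position β p u (k + 1) v)) (z v)) =
      boxTr (Fin (r + k) → ℤ) (boxMap (pullForm val (position β p u k (p k)))
          (boxInner (Dual.eval ℤ N (u k) ∘ₗ val.toLinearMap) (z (k + 1))) *
        ∏ v ∈ Finset.range (k + 1), boxMap (pullForm val (position β p u k v)) (z v)) := by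
  have h1 : ∏ v ∈ Finset.range (k + 1), boxMap (pullForm val (position β p u (k + 1) v)) (z v) =
      boxMap (consZero (r + k))
        (∏ v ∈ Finset.range (k + 1), boxMap (pullForm val (position β p u k v)) (z v)) := by
    rw [map_prod]
    refine Finset.prod_congr rfl fun v hv => ?_
    rw [pullForm_position_of_le _ _ _ _ (Nat.lt_succ_iff.1 (Finset.mem_range.1 hv)), boxMap_comp]
  -- The coordinate takes the value `1` at `Pi.single 0 1`, so the factor in the adjunction is `1`.
  have h2 := boxTr_contract (consZero (r + k)) (consZero_injective _)
    (LinearMap.proj (R := ℤ) (φ := fun _ => ℤ) 0) (range_consZero _) (Pi.single 0 1) (by simp)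
    (by simp) (boxMap (pullForm val (position β p u (k + 1) (k + 1))) (z (k + 1)))
    (∏ v ∈ Finset.range (k + 1), boxMap (pullForm val (position β p u k v)) (z v))
  rw [boxContract_consZero _ (Dual.eval ℤ N (u k) ∘ₗ val.toLinearMap)
    (pullForm val (position β p u k (p k))) (pullForm_position_self β p u val k),
    map_single_one_sq, one_mul] at h2
  rw [h2, Finset.prod_range_succ _ (k + 1), h1]
  exact congrArg _ (mul_comm _ _)

theorem boxTr_boxMap_smul_mul {L' : Type*} [AddCommGroup L'] [Module.Free ℤ L'] [Module.Finite ℤ L']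
    (f : L →ₗ[ℤ] L') (c : ℚ) (x : boxAlg L) (y : boxAlg L') :
    boxTr L' (boxMap f (c • x) * y) = c * boxTr L' (boxMap f x * y) := by
  rw [map_smul, smul_mul_assoc, map_smul, smul_eq_mul]

/-- Both sides satisfy the same leaf recursion, `treeSum_succ` on the left and
`boxTr_prod_position_succ` on the right. The hypothesis `hab` says that gluing along edge `i` is `s
i ^ 2` times contraction by `u i`; later `s i` is the weight. -/
theorem treeSum_eq_boxTr [Module.Free ℤ L] [Module.Finite ℤ L] (hp : ∀ i, p i ≤ i) (s : ℕ → ℚ)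
    {k : ℕ} {ι : Fin k → Type*} [∀ i, Fintype (ι i)] (a b : ∀ i, ι i → boxAlg L)
    (hab : ∀ i x, ∑ t, boxTr L (x * b i t) • a i t =
      s i ^ 2 • boxInner (Dual.eval ℤ N (u i) ∘ₗ val.toLinearMap) x)
    (z : ℕ → boxAlg L) :
    treeSum (boxTr L) p a b z = (∏ i ∈ Finset.range k, s i ^ 2) * boxTr (Fin (r + k) → ℤ)
      (∏ v ∈ Finset.range (k + 1), boxMap (pullForm val (position β p u k v)) (z v)) := by
  induction k generalizing z with
  | zero => simp [treeSum, position, boxTr_pullForm_zero]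
  | succ k ih =>
    -- The induction hypothesis is used for the tree without its last leaf, with the class at the
    -- parent multiplied by the contracted class of the leaf.
    have h3 := ih (fun i => a i.castSucc) (fun i => b i.castSucc) (fun i x => hab i.castSucc x)
      (Function.update z (p k) (z (p k) * s k ^ 2 •
        boxInner (Dual.eval ℤ N (u k) ∘ₗ val.toLinearMap) (z (k + 1))))
    rw [prod_boxMap_update_mul (Finset.mem_range.2 (Nat.lt_succ_of_le (hp k))), boxTr_boxMap_smul_mul,
      ← boxTr_prod_position_succ, ← mul_assoc, ← Finset.prod_range_succ] at h3
    rw [← h3, treeSum_succ _ _ hp]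
    have h4 := hab (Fin.last k) (z (k + 1))
    rw [Fin.val_last] at h4
    rw [h4]

end position
end TropQFT

/-! ### The theory `boxTrQFT` on a tree -/

namespace TropQFT
section
variable {N : Type*} [AddCommGroup N] [Module.Free ℤ N] [Module.Finite ℤ N]

variable (N) in
/-- The lattice `M_0` is the dual lattice. -/
noncomputable def perpZeroEquiv : Perp (0 : NBar N).rep ≃ₗ[ℤ] Dual ℤ N :=
  LinearEquiv.ofBijective Perp.val
    ⟨Perp.val_injective, fun f => ⟨Perp.mk f (by rw [NBar.rep_zero, map_zero]), rfl⟩⟩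

theorem coe_κ_κd {x : NBar N} (hx : x ≠ 0) (z : boxAlg (Perp (0 : NBar N).rep)) :
    boxMap (perpIncl _ x.rep (perp_le _)) (boxκd x z) = boxInner (perpEval _ x.rep) z := by
  apply Subtype.ext
  rw [coe_boxMap, boxκd, dif_neg hx, dmap_boxContract, coe_boxInner]

theorem boxInner_neg {L : Type*} [AddCommGroup L] (φ : L →ₗ[ℤ] ℤ) (x : boxAlg L) :
    boxInner (-φ) x = boxInner φ x := by
  have := boxInner_smul (-1) φ x
  simpa using this

/-- Contraction is quadratic in the vector: the sign of the representative drops out and the weight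
contributes `w ^ 2`. The direction must be nonzero, because for direction `0` the map `κd` is the
identity and not a contraction. -/
theorem κ_κd_of_eq_mk {x : NBar N} {n : N} {w : ℕ} (hx : x = NBar.mk (w • n)) (h : w • n ≠ 0)
    (z : boxAlg (Perp (0 : NBar N).rep)) :
    boxMap (perpIncl _ x.rep (perp_le _)) (boxκd x z) =
      (w : ℚ) ^ 2 • boxInner (Dual.eval ℤ N n ∘ₗ (perpZeroEquiv N).toLinearMap) z := by
  subst hx
  have h1 : perpEval (0 : NBar N).rep (w • n) =
      (w : ℤ) • (Dual.eval ℤ N n ∘ₗ (perpZeroEquiv N).toLinearMap) := by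
    ext f
    change Perp.val f (w • n) = (w : ℤ) • Perp.val f n
    rw [map_nsmul, natCast_zsmul]
  have hx : NBar.mk (w • n) ≠ 0 := fun h0 => by
    rw [← NBar.rep_eq_zero] at h0
    rcases NBar.rep_mk (w • n) with h2 | h2
    · exact h (h2.symm.trans h0)
    · exact h (neg_eq_zero.1 (h2.symm.trans h0))
  rw [coe_κ_κd hx]
  trans boxInner (perpEval (0 : NBar N).rep (w • n)) z
  · rcases NBar.rep_mk (w • n) with h2 | h2
    · rw [h2]
    · rw [h2, ← boxInner_neg]
      congr 2
      ext f
      change -(Perp.val f (-(w • n))) = Perp.val f (w • n)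
      rw [map_neg, neg_neg]
  · rw [h1, boxInner_smul]
    simp

variable {V E I : Type*} [Fintype V] [Fintype E] [Fintype I] (Γ : TropCobordism (NBar N) V E I)

theorem boxTrQFT_tr_zero : (boxTrQFT N).tr 0 = boxTr (Perp (0 : NBar N).rep) := by
  change trScale (0 : NBar N) • boxTr (Perp (0 : NBar N).rep) = _
  rw [trScale, if_pos rfl, one_smul]

open scoped Classical in
theorem eval_boxTrQFT (hΓ : ∀ v, Γ.genus v = 0) {k : ℕ} (o : TreeOrder Γ.src Γ.tgt k) (u : ℕ → N)
    (w : ℕ → ℕ) (hdir : ∀ i : Fin k, Γ.dir (o.edge i) = NBar.mk (w i • u i))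
    (hne : ∀ i : Fin k, w i • u i ≠ 0) {r : ℕ} (β : Basis (Fin r) ℤ N) (φ : Γ.Flow)
    (γ : ∀ i, (boxTrQFT N).C (Γ.deg i)) (z : I → boxAlg (Perp (0 : NBar N).rep))
    (hz : ∀ i, (boxTrQFT N).κ (Γ.deg i) (γ i) = z i) :
    (boxTrQFT N).eval Γ φ (⨂ₜ[ℚ] i, γ i) =
      (∏ i ∈ Finset.range k, (w i : ℚ) ^ 2) * boxTr (Fin (r + k) → ℤ)
        (∏ v ∈ Finset.range (k + 1),
          boxMap (pullForm (perpZeroEquiv N) (position β o.parent u k v))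
            (∏ i, if Γ.leg i = o.vert v then z i else 1)) := by
  rw [TrQFTData.eval_eq, TrQFTData.sum_vertexTraces (boxTrQFT N) Γ o]
  have h := treeSum_eq_boxTr β o.parent u (perpZeroEquiv N) o.parent_le (fun i => (w i : ℚ))
    ((boxTrQFT N).upper Γ o) ((boxTrQFT N).lower Γ o) (fun i x => ?_)
    (fun v => ∏ i, if Γ.leg i = o.vert v then z i else 1)
  · rw [← h, boxTrQFT_tr_zero]
    congr 1
    funext v
    rw [hΓ, pow_zero, one_mul]
    refine Finset.prod_congr rfl fun i _ => ?_
    split_ifs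
    · exact hz i
    · rfl
  · have h1 := (boxTrQFT N).sum_tr_lower_smul_upper Γ o i x
    rw [boxTrQFT_tr_zero] at h1
    exact h1.trans (κ_κd_of_eq_mk (hdir i) (hne i) x)

/-- The rows of the matrix are the linear forms `m i a` at the vertex of leg `i`, the columns are
the parameters of the tree. The equivalence `e` records that there are as many forms as parameters.
-/
theorem eval_boxTrQFT_eq_det (hΓ : ∀ v, Γ.genus v = 0) {k : ℕ} (o : TreeOrder Γ.src Γ.tgt k)
    (u : ℕ → N) (w : ℕ → ℕ) (hdir : ∀ i : Fin k, Γ.dir (o.edge i) = NBar.mk (w i • u i))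
    (hne : ∀ i : Fin k, w i • u i ≠ 0) {r : ℕ} (β : Basis (Fin r) ℤ N) (φ : Γ.Flow)
    {c : I → ℕ} (m : ∀ i, Fin (c i) → Dual ℤ N) (hm : ∀ i a, m i a (Γ.deg i).rep = 0)
    (x : I → ℚ) (num : I → ℕ) (hnum : ∀ i, num i ≤ k ∧ o.vert (num i) = Γ.leg i)
    (e : Fin (r + k) ≃ Σ i, Fin (c i)) (γ : ∀ i, (boxTrQFT N).C (Γ.deg i))
    (hγ : ∀ i, γ i = x i • ∏ a, boxSq (Perp.mk (m i a) (hm i a))) :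
    (boxTrQFT N).eval Γ φ (⨂ₜ[ℚ] i, γ i) =
      (∏ i ∈ Finset.range k, (w i : ℚ) ^ 2) * (∏ i, x i) *
        ((Matrix.of fun q j => m (e q).1 (e q).2
          (position β o.parent u k (num (e q).1) (Pi.single j 1))).det : ℚ) ^ 2 := by
  classical
  have h0 : ∀ f : Dual ℤ N, f (0 : NBar N).rep = 0 := fun f => by rw [NBar.rep_zero, map_zero]
  rw [eval_boxTrQFT Γ hΓ o u w hdir hne β φ γ
    (fun i => x i • ∏ a, boxSq (Perp.mk (m i a) (h0 _))), mul_assoc]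
  · congr 1
    -- After exchanging the two products, leg `i` contributes only at the number of its own vertex.
    have h1 : (∏ v ∈ Finset.range (k + 1),
          boxMap (pullForm (perpZeroEquiv N) (position β o.parent u k v))
            (∏ i, if Γ.leg i = o.vert v then x i • ∏ a, boxSq (Perp.mk (m i a) (h0 _)) else 1)) =
        (∏ i, x i) • ∏ q : Σ i, Fin (c i), boxSq fun j => m q.1 q.2
          (position β o.parent u k (num q.1) (Pi.single j 1)) := by
      simp only [map_prod]
      rw [Finset.prod_comm, Fintype.prod_sigma, ← Finset.prod_smul]
      refine Finset.prod_congr rfl fun i _ => ?_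
      rw [Finset.prod_eq_single (num i)]
      · rw [if_pos (hnum i).2.symm, map_smul, map_prod]
        simp only [boxMap_boxSq]
        rfl
      · intro v hv hvi
        rw [if_neg, map_one]
        rw [← (hnum i).2, o.vert_inj (hnum i).1 (Nat.lt_succ_iff.1 (Finset.mem_range.1 hv))]
        exact hvi.symm
      · intro h
        exact absurd (Finset.mem_range.2 (Nat.lt_succ_of_le (hnum i).1)) h
    rw [h1, map_smul, smul_eq_mul, boxTr_prod_boxSq e]
  · intro i
    rw [hγ i]
    change boxMap _ _ = _
    rw [map_smul, map_prod]
    simp only [boxMap_boxSq]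
    rfl

end
end TropQFT

/-! ### Forms that are trivial along a sublattice -/

namespace TropQFT

section exterior
variable {R M : Type*} [CommRing R] [AddCommGroup M] [Module R M]

/-- Expanding the product of the vectors `x - d x • g`, all terms with `g` twice vanish, and those
with `g` once make up the contraction. -/
theorem map_id_sub_smulRight (d : Dual R M) (g : M) (α : ExteriorAlgebra R M) :
    ExteriorAlgebra.map (LinearMap.id - d.smulRight g) α =
      α - ExteriorAlgebra.ι R g * CliffordAlgebra.contractLeft d α := by
  induction α using CliffordAlgebra.left_induction with
  | algebraMap r => simp
  | add x y hx hy => rw [map_add, map_add, hx, hy, mul_add]; abel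
  | ι_mul x m hx =>
    have h1 : ExteriorAlgebra.map (LinearMap.id - d.smulRight g) (CliffordAlgebra.ι (0 : QuadraticForm R M) m) =
        ExteriorAlgebra.ι R m - d m • ExteriorAlgebra.ι R g := by
      refine (ExteriorAlgebra.map_apply_ι _ _).trans ?_
      simp
    have h2 : ExteriorAlgebra.ι R m * ExteriorAlgebra.ι R g =
        -(ExteriorAlgebra.ι R g * ExteriorAlgebra.ι R m) :=
      eq_neg_of_add_eq_zero_left (ExteriorAlgebra.ι_add_mul_swap m g)
    rw [map_mul, hx, h1, CliffordAlgebra.contractLeft_ι_mul]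
    change _ = ExteriorAlgebra.ι R m * x - ExteriorAlgebra.ι R g *
      (d m • x - ExteriorAlgebra.ι R m * CliffordAlgebra.contractLeft d x)
    simp only [sub_mul, mul_sub, smul_mul_assoc, mul_smul_comm, ← mul_assoc, h2,
      ExteriorAlgebra.ι_sq_zero, zero_mul, smul_zero, neg_mul]
    abel

/-- Under the orthogonality `hdg` the map is a composition of the elementary maps of
`map_id_sub_smulRight`, and each of them fixes `α`. -/
theorem map_id_sub_sum_smulRight {J : Type*} (d : J → Dual R M) (g : J → M)
    (hdg : ∀ i j, i ≠ j → d i (g j) = 0) (α : ExteriorAlgebra R M)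
    (hα : ∀ j, CliffordAlgebra.contractLeft (d j) α = 0) (S : Finset J) :
    ExteriorAlgebra.map (LinearMap.id - ∑ j ∈ S, (d j).smulRight (g j)) α = α := by
  classical
  induction S using Finset.induction_on with
  | empty => simp
  | insert j S hj ih =>
    have : (LinearMap.id - ∑ i ∈ insert j S, (d i).smulRight (g i) : M →ₗ[R] M) =
        (LinearMap.id - (d j).smulRight (g j)) ∘ₗ (LinearMap.id - ∑ i ∈ S, (d i).smulRight (g i)) := by
      ext x
      have h0 : d j (x - ∑ i ∈ S, d i x • g i) = d j x := by
        rw [map_sub, map_sum, Finset.sum_eq_zero, sub_zero]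
        intro i hi
        rw [map_smul, hdg j i (by rintro rfl; exact hj hi), smul_zero]
      simp only [Finset.sum_insert hj, LinearMap.sub_apply, LinearMap.id_apply, LinearMap.add_apply,
        LinearMap.sum_apply, LinearMap.smulRight_apply, LinearMap.comp_apply, h0]
      abel
    rw [this, ← ExteriorAlgebra.map_comp_map, AlgHom.comp_apply, ih, map_id_sub_smulRight, hα,
      mul_zero, sub_zero]

theorem ιMulti_pi {c : ℕ} (a : Fin c → Fin c → R) :
    ExteriorAlgebra.ιMulti R c a =
      (Matrix.of a).det • ExteriorAlgebra.ιMulti R c fun i => Pi.single i (1 : R) := by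
  have : ExteriorAlgebra.ιMulti R c (M := Fin c → R) =
      (LinearMap.toSpanSingleton R _ (ExteriorAlgebra.ιMulti R c fun i => Pi.single i (1 : R))).compAlternatingMap
        Matrix.detRowAlternating := by
    refine Basis.ext_alternating (Pi.basisFun R (Fin c)) fun v hv => ?_
    -- An injective selection of basis vectors is a permutation, under which both alternating maps
    -- change by the same sign.
    let σ : Equiv.Perm (Fin c) := Equiv.ofBijective v (Finite.injective_iff_bijective.1 hv)
    have h1 : (fun i => Pi.basisFun R (Fin c) (v i)) = (fun i => Pi.single i (1 : R)) ∘ σ := by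
      ext i; simp [σ]
    have h2 : Matrix.detRowAlternating (R := R) (fun i : Fin c => (Pi.single i (1 : R) : Fin c → R)) = 1 := by
      have : (fun i : Fin c => (Pi.single i (1 : R) : Fin c → R)) = (1 : Matrix (Fin c) (Fin c) R) := by
        ext i j; simp [Matrix.one_apply, Pi.single_apply, eq_comm]
      rw [this]; exact Matrix.det_one
    rw [h1, AlternatingMap.map_perm, AlternatingMap.map_perm, LinearMap.compAlternatingMap_apply, h2,
      LinearMap.toSpanSingleton_apply, one_smul]
  exact congrArg (fun f => f a) this

theorem exists_map_eq_smul_ιMulti {c : ℕ} (S : M →ₗ[R] (Fin c → R)) (T : (Fin c → R) →ₗ[R] M)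
    {α : ExteriorAlgebra R M} (hα : α ∈ ⋀[R]^c M) :
    ∃ d : R, ExteriorAlgebra.map (T ∘ₗ S) α =
      d • ExteriorAlgebra.ιMulti R c fun i => T (Pi.single i 1) := by
  rw [← ExteriorAlgebra.ιMulti_span_fixedDegree] at hα
  induction hα using Submodule.span_induction with
  | mem x h =>
    obtain ⟨a, rfl⟩ := h
    refine ⟨(Matrix.of fun i => S (a i)).det, ?_⟩
    rw [← ExteriorAlgebra.map_comp_map, AlgHom.comp_apply, ExteriorAlgebra.map_apply_ιMulti, ιMulti_pi,
      map_smul, ExteriorAlgebra.map_apply_ιMulti]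
    rfl
  | zero => exact ⟨0, by simp⟩
  | add x y _ _ h1 h2 =>
    obtain ⟨d, h1⟩ := h1
    obtain ⟨d', h2⟩ := h2
    exact ⟨d + d', by rw [map_add, h1, h2, add_smul]⟩
  | smul t x _ h =>
    obtain ⟨d, h⟩ := h
    exact ⟨t * d, by rw [map_smul, h, mul_smul]⟩

/-- The determinant of `S` is such a functional. It detects the index of multiples of this form. -/
theorem exists_form_ιMulti_eq_one {c : ℕ} (S : M →ₗ[R] (Fin c → R)) (m : Fin c → M)
    (hm : ∀ i, S (m i) = Pi.single i 1) :
    ∃ F : ExteriorAlgebra R M →ₗ[R] R, F (ExteriorAlgebra.ιMulti R c m) = 1 := by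
  refine ⟨ExteriorAlgebra.liftAlternating (Pi.single c (Matrix.detRowAlternating.compLinearMap S)), ?_⟩
  rw [ExteriorAlgebra.liftAlternating_apply_ιMulti, Pi.single_eq_same,
    AlternatingMap.compLinearMap_apply]
  have : (fun i => S (m i)) = (1 : Matrix (Fin c) (Fin c) R) := by
    ext i j; simp [hm, Matrix.one_apply, Pi.single_apply, eq_comm]
  exact (congrArg Matrix.det this).trans Matrix.det_one

end exterior

section forms
variable {N : Type*} [AddCommGroup N] [Module.Free ℤ N] [Module.Finite ℤ N]

instance : Module.IsTorsionFree ℤ (ExteriorAlgebra ℤ (Dual ℤ N)) :=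
  have := Module.Free.of_basis (Module.finBasis ℤ (Dual ℤ N)).ExteriorAlgebra
  inferInstance

omit [Module.Free ℤ N] [Module.Finite ℤ N] in
theorem exists_section {c : ℕ} {θ : N →ₗ[ℤ] (Fin c → ℤ)} (hθ : Function.Surjective θ) :
    ∃ e : (Fin c → ℤ) →ₗ[ℤ] N, ∀ y, θ (e y) = y := by
  obtain ⟨e, he⟩ := θ.exists_rightInverse_of_surjective (LinearMap.range_eq_top.2 hθ)
  exact ⟨e, fun y => LinearMap.congr_fun he y⟩

/-- Triviality along `ker θ` means that `α` is fixed by pull-back along the projection `e ∘ θ`. This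
pull-back factors through `ℤ^c`, whose exterior power of degree `c` has rank one. -/
theorem exists_eq_smul_ιMulti_of_contract {c : ℕ} {θ : N →ₗ[ℤ] (Fin c → ℤ)}
    (e : (Fin c → ℤ) →ₗ[ℤ] N) (he : ∀ y, θ (e y) = y)
    {α : ExteriorAlgebra ℤ (Dual ℤ N)} (h : α ∈ ⋀[ℤ]^c (Dual ℤ N))
    (hα : ∀ v, θ v = 0 → CliffordAlgebra.contractLeft (Dual.eval ℤ N v) α = 0) :
    ∃ d : ℤ, α = d • ExteriorAlgebra.ιMulti ℤ c fun a => LinearMap.proj a ∘ₗ θ := by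
  let b := Module.finBasis ℤ (LinearMap.ker θ)
  let π : N →ₗ[ℤ] LinearMap.ker θ := (LinearMap.id - e ∘ₗ θ).codRestrict _ fun v => by simp [he]
  have hπ : ∀ v : LinearMap.ker θ, π v = v := fun v => by
    ext; simp [π]
  have h1 := map_id_sub_sum_smulRight (fun j => Dual.eval ℤ N (b j)) (fun j => b.coord j ∘ₗ π)
    (fun i j hij => by simp [hπ, hij]) α (fun j => hα _ (b j).2) Finset.univ
  let S : Dual ℤ N →ₗ[ℤ] (Fin c → ℤ) := LinearMap.pi fun a => Dual.eval ℤ N (e (Pi.single a 1))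
  let T : (Fin c → ℤ) →ₗ[ℤ] Dual ℤ N :=
    Fintype.linearCombination ℤ fun a => LinearMap.proj a ∘ₗ θ
  -- Both sides are pull-back along `e ∘ θ`: the sum extracts the component `v - e (θ v)` in `ker
  -- θ`, expanded in the basis `b`.
  have h2 : LinearMap.id - ∑ j, (Dual.eval ℤ N (b j)).smulRight (b.coord j ∘ₗ π) = T ∘ₗ S := by
    ext x v
    have h3 : ∑ j, x (b j) * b.coord j (π v) = x (v - e (θ v)) := by
      have h4 : (v - e (θ v) : N) = ∑ j, b.coord j (π v) • (b j : N) := by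
        have := congrArg Subtype.val (b.sum_repr (π v))
        rw [Submodule.coe_sum] at this
        exact this.symm
      rw [h4, map_sum]
      exact Finset.sum_congr rfl fun j _ => by rw [map_smul, smul_eq_mul, mul_comm]
    have h5 : ∑ a, x (e (Pi.single a 1)) * θ v a = x (e (θ v)) := by
      conv_rhs => rw [pi_eq_sum_univ' (θ v), map_sum, map_sum]
      refine Finset.sum_congr rfl fun a _ => ?_
      rw [map_smul, map_smul, smul_eq_mul, mul_comm]
    simp only [LinearMap.sub_apply, LinearMap.id_apply, LinearMap.sum_apply, LinearMap.smulRight_apply,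
      LinearMap.smul_apply, LinearMap.comp_apply, Dual.eval_apply, smul_eq_mul, h3, map_sub,
      sub_sub_cancel, S, T, Fintype.linearCombination_apply, LinearMap.pi_apply, LinearMap.proj_apply, h5]
  rw [h2] at h1
  obtain ⟨d, hd⟩ := exists_map_eq_smul_ιMulti S T h
  refine ⟨d, h1.symm.trans (hd.trans ?_)⟩
  congr 2
  funext a
  simp [T, Fintype.linearCombination_apply_single]

/-- A functional `F` with value `1` on the wedge of the coordinates gives `d = w * F β`. Cancelling
`w` shows that `β` is `F β` times that wedge, and primitivity forces `F β = ± 1`. -/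
theorem sq_eq_sq_of_smul_ιMulti {c : ℕ} {θ : N →ₗ[ℤ] (Fin c → ℤ)}
    (e : (Fin c → ℤ) →ₗ[ℤ] N) (he : ∀ y, θ (e y) = y) {w : ℕ} (hw : 0 < w)
    {β : ExteriorAlgebra ℤ (Dual ℤ N)} (hβ : IsPrimitive β) {d : ℤ}
    (h : w • β = d • ExteriorAlgebra.ιMulti ℤ c fun a => LinearMap.proj a ∘ₗ θ) :
    d ^ 2 = (w : ℤ) ^ 2 := by
  obtain ⟨F, hF⟩ := exists_form_ιMulti_eq_one
    (LinearMap.pi fun a => Dual.eval ℤ N (e (Pi.single a 1)))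
    (fun a => LinearMap.proj a ∘ₗ θ) (fun a => by
      ext i; simp [he, Pi.single_apply, eq_comm])
  have h1 : d = w * F β := by
    have := congrArg F h
    rw [map_nsmul, map_smul, hF] at this
    simpa using this.symm
  have h2 : β = F β • ExteriorAlgebra.ιMulti ℤ c fun a => LinearMap.proj a ∘ₗ θ := by
    have hw' : (w : ℤ) ≠ 0 := by exact_mod_cast hw.ne'
    apply smul_right_injective _ hw'
    change (w : ℤ) • β = (w : ℤ) • (F β • _)
    rw [natCast_zsmul, h, h1, mul_smul]
  have h3 : (F β).natAbs = 1 := by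
    rcases Int.natAbs_eq (F β) with h4 | h4
    · refine hβ.2 _ (ExteriorAlgebra.ιMulti ℤ c fun a => LinearMap.proj a ∘ₗ θ) (h2.trans ?_)
      conv_lhs => rw [h4, natCast_zsmul]
    · refine hβ.2 _ (-ExteriorAlgebra.ιMulti ℤ c fun a => LinearMap.proj a ∘ₗ θ) (h2.trans ?_)
      conv_lhs => rw [h4, neg_smul, natCast_zsmul]
      rw [smul_neg]
  have h4 : (F β) ^ 2 = 1 := by rw [← Int.natAbs_sq, h3]; rfl
  rw [h1, mul_pow, h4, mul_one]

omit [Module.Free ℤ N] in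
-- For a saturated sublattice the quotient is torsion free, hence free, and a basis of it provides
-- the coordinates.
theorem exists_coordinates (Λ : AddSubgroup N) (h : ∀ (k : ℤ) v, k ≠ 0 → k • v ∈ Λ → v ∈ Λ) :
    ∃ (c : ℕ) (θ : N →ₗ[ℤ] (Fin c → ℤ)), Function.Surjective θ ∧ ∀ v, θ v = 0 ↔ v ∈ Λ := by
  let Λ' : Submodule ℤ N := Λ.toIntSubmodule
  have : Module.IsTorsionFree ℤ (N ⧸ Λ') := by
    refine ⟨fun k hk => isSMulRegular_iff_right_eq_zero_of_smul.2 fun x hx => ?_⟩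
    obtain ⟨v, rfl⟩ := Submodule.mkQ_surjective _ x
    rw [← map_smul, Submodule.mkQ_apply, Submodule.Quotient.mk_eq_zero] at hx
    rw [Submodule.mkQ_apply, Submodule.Quotient.mk_eq_zero]
    exact h k v hk.ne_zero hx
  have : Module.Free ℤ (N ⧸ Λ') := Module.free_of_finite_type_torsion_free'
  let b := Module.finBasis ℤ (N ⧸ Λ')
  refine ⟨_, b.equivFun.toLinearMap ∘ₗ Λ'.mkQ, ?_, fun v => ?_⟩
  · exact b.equivFun.surjective.comp (Submodule.mkQ_surjective _)
  · simp only [LinearMap.comp_apply, LinearEquiv.coe_coe, LinearEquiv.map_eq_zero_iff,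
      Submodule.mkQ_apply, Submodule.Quotient.mk_eq_zero]
    rfl

omit [Module.Free ℤ N] [Module.Finite ℤ N] in
theorem span_realPt_ker {c : ℕ} {θ : N →ₗ[ℤ] (Fin c → ℤ)} (hθ : Function.Surjective θ) :
    Submodule.span ℝ (realPt '' {v | θ v = 0}) = LinearMap.ker (θ.baseChange ℝ) := by
  apply le_antisymm
  · rw [Submodule.span_le]
    rintro _ ⟨v, hv, rfl⟩
    simp only [SetLike.mem_coe, LinearMap.mem_ker, realPt, LinearMap.baseChange_tmul]
    rw [show θ v = 0 from hv, TensorProduct.tmul_zero]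
  · obtain ⟨e, he⟩ := exists_section hθ
    have key : ∀ y, y - e.baseChange ℝ (θ.baseChange ℝ y) ∈
        Submodule.span ℝ (realPt '' {v | θ v = 0}) := by
      intro y
      induction y using TensorProduct.induction_on with
      | zero => simp
      | tmul t v =>
        have : t ⊗ₜ[ℤ] v - e.baseChange ℝ (θ.baseChange ℝ (t ⊗ₜ[ℤ] v)) = t • realPt (v - e (θ v)) := by
          simp [realPt, TensorProduct.smul_tmul', TensorProduct.tmul_sub, smul_sub]
        rw [this]
        exact Submodule.smul_mem _ _ (Submodule.subset_span ⟨_, by simp [he], rfl⟩)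
      | add x y hx hy =>
        have := add_mem hx hy
        rw [map_add, map_add]
        convert this using 1
        abel
    intro y hy
    have := key y
    rwa [LinearMap.mem_ker.1 hy, map_zero, sub_zero] at this

variable {A : AffineSubspace ℝ (ℝ ⊗[ℤ] N)}

omit [Module.Free ℤ N] [Module.Finite ℤ N] in
-- Rational slope is essential: it identifies the direction of `A` with the real span of its lattice
-- vectors, which is the kernel of the real extension of `θ`.
theorem codim_eq {c : ℕ} {θ : N →ₗ[ℤ] (Fin c → ℤ)} (hθ : Function.Surjective θ)
    (hA : IsRational A) (h : ∀ v, θ v = 0 ↔ v ∈ latticeDir A) : codim A = c := by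
  have h1 : A.direction = LinearMap.ker (θ.baseChange ℝ) := by
    rw [← span_realPt_ker hθ, hA]
    congr 2
    ext v
    exact (h v).symm
  have h2 : Function.Surjective (θ.baseChange ℝ) := by
    exact LinearMap.lTensor_surjective ℝ hθ
  rw [codim, h1, ((θ.baseChange ℝ).quotKerEquivOfSurjective h2).finrank_eq, Module.finrank_baseChange]
  simp

omit [Module.Free ℤ N] [Module.Finite ℤ N] in
theorem mem_latticeDir {v : N} : v ∈ latticeDir A ↔ realPt v ∈ A.direction := Iff.rfl

/-- The form is `± w` times the wedge of the coordinates of `N / L(A)`, and taking squares removes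
the sign. The same `θ` computes the index of `Phi`, which links the two sides of the theorem. -/
theorem exists_coordinates_square {w : ℕ} (hw : 0 < w) (hA : IsRational A)
    {α : ExteriorAlgebra ℤ (Dual ℤ N)} (hα : IsTropicalForm A w α) :
    ∃ θ : N →ₗ[ℤ] (Fin (codim A) → ℤ), Function.Surjective θ ∧
      (∀ v, θ v = 0 ↔ v ∈ latticeDir A) ∧ square (codim A) α =
        (w : ℚ) ^ 2 • sqProd (List.ofFn fun a => (1 : ℚ) ⊗ₜ[ℤ] (LinearMap.proj a ∘ₗ θ : Dual ℤ N)) := by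
  obtain ⟨c, θ, hθ, h⟩ := exists_coordinates (latticeDir A) fun k v hk hv => by
    rw [mem_latticeDir] at *
    have h1 : realPt (k • v) = (k : ℝ) • realPt v := by
      rw [realPt, TensorProduct.tmul_smul, Int.cast_smul_eq_zsmul]; rfl
    rw [h1] at hv
    exact (Submodule.smul_mem_iff _ (by exact_mod_cast hk)).1 hv
  obtain rfl := codim_eq hθ hA h
  refine ⟨θ, hθ, h, ?_⟩
  obtain ⟨e, he⟩ := exists_section hθ
  obtain ⟨d, hd⟩ := exists_eq_smul_ιMulti_of_contract e he hα.homogeneous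
    fun v hv => hα.restrict v ((h v).1 hv)
  obtain ⟨β, hβ, hβα⟩ := hα.index
  have h2 := sq_eq_sq_of_smul_ιMulti e he hw hβ (hβα.symm.trans hd)
  have h3 : (d : ℚ) ^ 2 = (w : ℚ) ^ 2 := by exact_mod_cast h2
  rw [← square_ιMulti, hd, ← h3, square, square, map_smul, map_smul, smul_mul_smul_comm,
    ← Int.cast_smul_eq_zsmul ℚ, smul_comm, pow_two, Int.cast_mul]

end forms
end TropQFT

/-! ### Lattice indices, determinants and configurations of a tree -/

namespace TropQFT

section index

/-- The image of the kernel is the intersection of the range with `C`. Range and `C` together span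
everything, so by the second isomorphism theorem the two indices agree, also when infinite. -/
theorem index_range_prod {G B C : Type*} [AddCommGroup G] [AddCommGroup B] [AddCommGroup C]
    (f : G →+ B × C) (hf : Function.Surjective fun x => (f x).1) :
    f.range.index =
      (((AddMonoidHom.fst B C).comp f).ker.map ((AddMonoidHom.snd B C).comp f)).index := by
  have h1 : ((AddMonoidHom.fst B C).comp f).ker.map ((AddMonoidHom.snd B C).comp f) =
      f.range.comap (AddMonoidHom.inr B C) := by
    ext c
    constructor
    · rintro ⟨x, hx, rfl⟩
      exact ⟨x, Prod.ext hx rfl⟩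
    · rintro ⟨x, hx⟩
      exact ⟨x, congrArg Prod.fst hx, congrArg Prod.snd hx⟩
  have h2 : f.range ⊔ (AddMonoidHom.inr B C).range = ⊤ := by
    rw [eq_top_iff]
    rintro ⟨b, c⟩ -
    obtain ⟨x, hx⟩ := hf b
    refine AddSubgroup.mem_sup.2 ⟨f x, ⟨x, rfl⟩, (0, c - (f x).2), ⟨_, rfl⟩, ?_⟩
    exact Prod.ext (by simpa using hx) (by simp)
  rw [h1, AddSubgroup.index_comap, ← AddSubgroup.relIndex_sup_left, h2, AddSubgroup.relIndex_top_right]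

theorem index_range_eq_natAbs_det {n : ℕ} (f : (Fin n → ℤ) →ₗ[ℤ] (Fin n → ℤ)) :
    f.toAddMonoidHom.range.index = (LinearMap.det f).natAbs := by
  by_cases hdet : LinearMap.det f = 0
  · rw [hdet, Int.natAbs_zero]
    -- A nonzero index `m` would put `m` times every basis vector into the range, so `f` would have
    -- a right inverse up to the factor `m`, and taking determinants would give `m = 0`.
    by_contra h0
    have h1 : ∀ i : Fin n, ∃ y, f y = f.toAddMonoidHom.range.index • Pi.basisFun ℤ (Fin n) i :=
      fun i => AddMonoidHom.mem_range.1 (AddSubgroup.nsmul_index_mem f.toAddMonoidHom.range _)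
    choose y hy using h1
    have h2 : f ∘ₗ (Pi.basisFun ℤ (Fin n)).constr ℤ y =
        (f.toAddMonoidHom.range.index : ℤ) • LinearMap.id := by
      refine (Pi.basisFun ℤ (Fin n)).ext fun i => ?_
      rw [LinearMap.comp_apply, Basis.constr_basis, hy, LinearMap.smul_apply, LinearMap.id_apply,
        natCast_zsmul]
    have h3 := congrArg LinearMap.det h2
    rw [LinearMap.det_comp, hdet, zero_mul, LinearMap.det_smul, LinearMap.det_id, mul_one] at h3
    have : (f.toAddMonoidHom.range.index : ℤ) = 0 := by
      exact eq_zero_of_pow_eq_zero h3.symm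
    exact h0 (by exact_mod_cast this)
  · have hinj : Function.Injective f := by
      rw [← LinearMap.ker_eq_bot]
      by_contra h
      exact hdet (LinearMap.det_eq_zero_iff_ker_ne_bot.2 h)
    have := Submodule.natAbs_det_equiv (LinearMap.range f) (LinearEquiv.ofInjective f hinj)
    exact this.symm

theorem index_range_eq_natAbs_det_matrix {n : ℕ} (f : (Fin n → ℤ) →ₗ[ℤ] (Fin n → ℤ)) :
    f.toAddMonoidHom.range.index = (Matrix.of fun i j => f (Pi.single j 1) i).det.natAbs := by
  rw [index_range_eq_natAbs_det, ← LinearMap.det_toMatrix']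
  rfl

end index

section position
variable {N : Type*} [AddCommGroup N] {r : ℕ} (β : Basis (Fin r) ℤ N)
  {p : ℕ → ℕ} (hp : ∀ i, p i ≤ i) (u : ℕ → N)
include hp

theorem position_sub (k : ℕ) (x : Fin (r + k) → ℤ) {i : ℕ} (hi : i < k) :
    ∃ c : ℤ, position β p u k (i + 1) x - position β p u k (p i) x = c • u i := by
  induction k with
  | zero => omega
  | succ k ih =>
    have h1 := hp i
    rw [position_succ_of_le β p u (by omega : p i ≤ k)]
    rcases Nat.lt_succ_iff_lt_or_eq.1 hi with h | rfl
    · rw [position_succ_of_le β p u (by omega : i + 1 ≤ k)]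
      exact ih _ h
    · rw [position_succ_self, add_sub_cancel_left]
      exact ⟨x 0, rfl⟩

/-- With `position_sub` this says that `position` parametrises exactly the configurations whose
differences along edges are integral multiples of the directions. -/
theorem exists_position_eq (k : ℕ) (Y : ℕ → N)
    (hY : ∀ i < k, ∃ c : ℤ, Y (i + 1) - Y (p i) = c • u i) :
    ∃ x, ∀ v ≤ k, position β p u k v x = Y v := by
  induction k with
  | zero =>
    refine ⟨β.equivFun (Y 0), fun v hv => ?_⟩
    obtain rfl : v = 0 := by omega
    exact β.equivFun.symm_apply_apply _
  | succ k ih =>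
    obtain ⟨x, hx⟩ := ih fun i hi => hY i (by omega)
    obtain ⟨c, hc⟩ := hY k (by omega)
    refine ⟨(Fin.cons c x : Fin (r + k + 1) → ℤ), fun v hv => ?_⟩
    rcases Nat.le_succ_iff.1 hv with h | rfl
    · rw [position_succ_of_le β p u h]
      exact hx v h
    · rw [position_succ_self, Fin.tail_cons, Fin.cons_zero, hx _ (hp k), ← hc]
      abel

omit β in
theorem exists_differences (k : ℕ) (d : ℕ → N) : ∃ Y : ℕ → N, ∀ i < k, Y (i + 1) - Y (p i) = d i := by
  induction k with
  | zero => exact ⟨0, by simp⟩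
  | succ k ih =>
    obtain ⟨Y, hY⟩ := ih
    refine ⟨Function.update Y (k + 1) (Y (p k) + d k), fun i hi => ?_⟩
    have h1 := hp i
    rw [Function.update_of_ne (by omega : p i ≠ k + 1)]
    rcases Nat.lt_succ_iff_lt_or_eq.1 hi with h | rfl
    · rw [Function.update_of_ne (by omega)]
      exact hY i h
    · rw [Function.update_self, add_sub_cancel_left]

end position

/-! ### Lattice vectors in the real space -/

section real
variable {N : Type*} [AddCommGroup N]

/-- The extension of an integral linear form to `ℝ ⊗ N`. -/
noncomputable def realFun (f : Dual ℤ N) : ℝ ⊗[ℤ] N →ₗ[ℝ] ℝ :=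
  LinearMap.liftBaseChange ℝ ((Int.castAddHom ℝ).toIntLinearMap ∘ₗ f)

theorem realFun_realPt (f : Dual ℤ N) (v : N) : realFun f (realPt v) = f v := by
  simp [realFun, realPt]

theorem realPt_zero : realPt (0 : N) = 0 := TensorProduct.tmul_zero _ _

theorem realPt_zsmul (k : ℤ) (v : N) : realPt (k • v) = (k : ℝ) • realPt v := by
  rw [realPt, TensorProduct.tmul_smul, Int.cast_smul_eq_zsmul]; rfl

variable [Module.Free ℤ N] [Module.Finite ℤ N]

theorem IsPrimitive.exists_dual_eq_one {u : N} (hu : IsPrimitive u) : ∃ f : Dual ℤ N, f u = 1 := by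
  obtain ⟨-, f, hf, -⟩ := vecIndex_spec hu.1
  have : vecIndex u = 1 := by
    have : {k : ℕ | ∃ v : N, u = k • v} = {1} := by
      ext k
      constructor
      · rintro ⟨v, hv⟩; exact hu.2 k v hv
      · rintro rfl; exact ⟨u, by simp⟩
    rw [vecIndex, this, csSup_singleton]
  exact ⟨f, by rw [hf, this]; rfl⟩

omit [Module.Finite ℤ N] in
theorem realPt_eq_zero {v : N} (h : realPt v = 0) : v = 0 := by
  rw [← Module.forall_dual_apply_eq_zero_iff ℤ v]
  intro f
  have := realFun_realPt f v
  rw [h, map_zero] at this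
  exact_mod_cast this.symm

/-- An integral form with value `1` on `u` reads off the coefficient, which is therefore an integer.
-/
theorem IsPrimitive.realPt_mem_span_iff {u : N} (hu : IsPrimitive u) {v : N} :
    realPt v ∈ Submodule.span ℝ {realPt u} ↔ ∃ c : ℤ, v = c • u := by
  constructor
  · intro h
    obtain ⟨t, ht⟩ := Submodule.mem_span_singleton.1 h
    obtain ⟨f, hf⟩ := hu.exists_dual_eq_one
    have h1 : t = f v := by
      have := congrArg (realFun f) ht
      rw [map_smul, realFun_realPt, realFun_realPt, hf] at this
      simpa using this
    refine ⟨f v, sub_eq_zero.1 (realPt_eq_zero ?_)⟩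
    rw [realPt, TensorProduct.tmul_sub]
    change realPt v - realPt (f v • u) = 0
    rw [realPt_zsmul, ← h1, ht, sub_self]
  · rintro ⟨c, rfl⟩
    rw [realPt_zsmul]
    exact Submodule.smul_mem _ _ (Submodule.mem_span_singleton_self _)

end real

/-! ### Tropical curves of genus 0 and the index of `Phi` -/

namespace TropicalCurve
variable {N V E I : Type*} [AddCommGroup N] [Module.Free ℤ N] [Module.Finite ℤ N] [Fintype V]
  [Fintype E] [Fintype I] (Γ : TropicalCurve N V E I)

open scoped Classical in
-- By connectedness a point of the face space is determined by the position of one vertex and the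
-- signed lengths of the non-contracted edges.
theorem finrank_faceSpace_le :
    finrank ℝ Γ.faceSpace ≤ finrank ℤ N + Fintype.card {e // Γ.wt e ≠ 0} := by
  obtain ⟨v₀⟩ := Γ.nonempty
  choose f hf using fun e : {e // Γ.wt e ≠ 0} => (Γ.dir_primitive e e.2).exists_dual_eq_one
  let F : Γ.faceSpace →ₗ[ℝ] (ℝ ⊗[ℤ] N) × ({e // Γ.wt e ≠ 0} → ℝ) :=
    ((LinearMap.proj v₀).prod (LinearMap.pi fun e => realFun (f e) ∘ₗ Γ.edgeVector e)) ∘ₗ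
      Γ.faceSpace.subtype
  have hF : Function.Injective F := by
    rw [← LinearMap.ker_eq_bot, LinearMap.ker_eq_bot']
    rintro ⟨y, hy⟩ h
    have h0 : y v₀ = 0 := congrArg Prod.fst h
    have h1 : ∀ e, y (Γ.src e) = y (Γ.tgt e) := by
      intro e
      obtain ⟨t, ht⟩ := Submodule.mem_span_singleton.1 ((Submodule.mem_iInf _).1 hy e)
      by_cases hw : Γ.wt e = 0
      · rw [Γ.dir_zero e hw, realPt_zero, smul_zero] at ht
        exact (sub_eq_zero.1 ht.symm).symm
      · have h2 : realFun (f ⟨e, hw⟩) (Γ.edgeVector e y) = 0 := congrFun (congrArg Prod.snd h) ⟨e, hw⟩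
        rw [← ht, map_smul, realFun_realPt, hf] at h2
        have h3 : t = 0 := by simpa using h2
        rw [h3, zero_smul] at ht
        exact (sub_eq_zero.1 ht.symm).symm
    have h2 : ∀ a b, Relation.EqvGen (fun a b => ∃ e, Γ.src e = a ∧ Γ.tgt e = b) a b → y a = y b := by
      intro a b h
      induction h with
      | rel a b h => obtain ⟨e, rfl, rfl⟩ := h; exact h1 e
      | refl => rfl
      | symm _ _ _ h => exact h.symm
      | trans _ _ _ _ _ h h' => exact h.trans h'
    ext v
    exact (h2 _ _ (Γ.connected v v₀)).trans h0
  have := LinearMap.finrank_le_finrank_of_injective hF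
  rw [Module.finrank_prod, Module.finrank_baseChange, Module.finrank_fintype_fun_eq_card] at this
  exact this

omit [Module.Free ℤ N] [Module.Finite ℤ N] in
open scoped Classical in
theorem sum_valence : ∑ v, Γ.valence v = 2 * Fintype.card E + Fintype.card I := by
  have hE : ∀ g : E → V, ∑ v, Fintype.card {j // g j = v} = Fintype.card E := fun g => by
    rw [← Fintype.card_sigma]; exact Fintype.card_congr (Equiv.sigmaFiberEquiv g)
  have hI : ∑ v, Fintype.card {j // Γ.leg j = v} = Fintype.card I := by
    rw [← Fintype.card_sigma]; exact Fintype.card_congr (Equiv.sigmaFiberEquiv Γ.leg)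
  have h : ∑ v, Γ.valence v = ∑ v, Fintype.card {j // Γ.src j = v} +
      ∑ v, Fintype.card {j // Γ.tgt j = v} + ∑ v, Fintype.card {j // Γ.leg j = v} := by
    rw [← Finset.sum_add_distrib, ← Finset.sum_add_distrib]
    exact Finset.sum_congr rfl fun v _ => by rw [valence, endCount]
  rw [h, hE, hE, hI, two_mul]

variable {Γ}

omit [Module.Free ℤ N] [Module.Finite ℤ N] in
theorem card_edges (hg : Γ.genus = 0) (hΓ : ∀ v, Γ.genusAt v = 0) :
    Fintype.card E + 1 = Fintype.card V := by
  rw [genus] at hg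
  simp only [hΓ, Nat.cast_zero, Finset.sum_const_zero] at hg
  omega

omit [Module.Free ℤ N] [Module.Finite ℤ N] in
theorem expectedDim_eq (hg : Γ.genus = 0) (hΓ : ∀ v, Γ.genusAt v = 0) :
    Γ.expectedDim = finrank ℤ N + Fintype.card E := by
  have h1 := card_edges hg hΓ
  have h2 := Γ.sum_valence
  have h3 : ∑ v, Γ.overvalence v = 2 * Fintype.card E + Fintype.card I - 3 * Fintype.card V := by
    simp only [overvalence, hΓ, Finset.sum_sub_distrib]
    have : ((∑ v, Γ.valence v : ℕ) : ℤ) = 2 * Fintype.card E + Fintype.card I := by rw [h2]; push_cast; rfl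
    push_cast at this
    simp [this, mul_comm]
  rw [expectedDim, hg, h3]
  push_cast [← h1]
  ring

/-- In genus 0 the expected dimension counts every compact edge, while the face gains nothing from
contracted ones, so a contracted edge would make the face too small. -/
theorem wt_ne_zero (hg : Γ.genus = 0) (hΓ : Γ.NonSuperabundant) (e : E) : Γ.wt e ≠ 0 := by
  classical
  intro he
  have h1 := Γ.finrank_faceSpace_le
  have h2 := hΓ.2.2
  rw [expectedDim_eq hg hΓ.2.1] at h2
  have h3 : Fintype.card {e // Γ.wt e ≠ 0} < Fintype.card E :=
    Fintype.card_subtype_lt (x := e) (by simpa using he)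
  have h4 : Fintype.card {e // Γ.wt e ≠ 0} = _ := Fintype.card_congr (Equiv.refl _)
  omega

omit [Module.Free ℤ N] [Module.Finite ℤ N] in
theorem legDir_mem {A : I → AffineSubspace ℝ (ℝ ⊗[ℤ] N)} (hA : Γ.Matches A) (i : I) :
    Γ.legDir i ∈ latticeDir (A i) := by
  rw [mem_latticeDir]
  have := AffineSubspace.vsub_mem_direction (hA i 1 zero_le_one) (hA i 0 le_rfl)
  simpa using this

theorem _root_.TropQFT.TreeOrder.exists_index {V E : Type*} {src tgt : E → V} {k : ℕ}
    (o : TreeOrder src tgt k) : ∃ num : V → ℕ, ∀ v, num v ≤ k ∧ o.vert (num v) = v := by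
  choose g hg using o.bijective.2
  exact ⟨fun v => g v, fun v => ⟨Nat.lt_succ_iff.1 (g v).2, hg v⟩⟩

omit [Module.Free ℤ N] [Module.Finite ℤ N] in
-- On a tree the differences along the edges are independent and can be prescribed from the root
-- outwards.
theorem Phi_fst_surjective {k : ℕ} (o : TreeOrder Γ.src Γ.tgt k)
    (A : I → AffineSubspace ℝ (ℝ ⊗[ℤ] N)) : Function.Surjective fun H => (Γ.Phi A H).1 := by
  classical
  intro δ
  choose δ' hδ using fun e => QuotientAddGroup.mk_surjective (δ e)
  obtain ⟨num, hnum⟩ := o.exists_index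
  -- The sign compares the orientation of the edge with the direction from parent to child.
  obtain ⟨Y, hY⟩ := exists_differences o.parent_le k fun i =>
    if h : i < k then if Γ.src (o.edge ⟨i, h⟩) = o.vert (o.parent i) then δ' (o.edge ⟨i, h⟩)
      else -δ' (o.edge ⟨i, h⟩) else 0
  have hYn : ∀ j ≤ k, Y (num (o.vert j)) = Y j := fun j hj => by
    rw [(o.vert_inj (hnum _).1 hj).1 (hnum _).2]
  refine ⟨fun v => Y (num v), funext fun e => ?_⟩
  rw [← hδ e]
  change QuotientAddGroup.mk _ = _
  congr 1
  obtain ⟨i, rfl⟩ := o.edge.surjective e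
  have h1 := hY i i.2
  have h2 := o.parent_le i
  rw [dif_pos i.2] at h1
  rcases o.joins i with ⟨h3, h4⟩ | ⟨h3, h4⟩
  · rw [if_pos h3] at h1
    change Y _ - Y _ = _
    rw [h3, h4, hYn _ (by omega), hYn _ (by omega), h1]
  · rw [if_neg (by rw [h4, o.vert_inj (by omega) (by omega)]; omega)] at h1
    change Y _ - Y _ = _
    rw [h3, h4, hYn _ (by omega), hYn _ (by omega), ← neg_sub, h1, neg_neg]

/-- The coordinates of a family of elements of the quotients `N / L_N(A i)`. -/
def quotientCoords (A : I → AffineSubspace ℝ (ℝ ⊗[ℤ] N)) {c : I → ℕ}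
    (θ : ∀ i, N →ₗ[ℤ] (Fin (c i) → ℤ)) (hker : ∀ i v, θ i v = 0 ↔ v ∈ latticeDir (A i)) :
    (∀ i, N ⧸ latticeDir (A i)) →+ ((Σ i, Fin (c i)) → ℤ) where
  toFun y q := QuotientAddGroup.lift (latticeDir (A q.1)) (θ q.1).toAddMonoidHom
    (fun v hv => (hker q.1 v).2 hv) (y q.1) q.2
  map_zero' := by ext; simp
  map_add' x y := by ext; simp

omit [Module.Free ℤ N] [Module.Finite ℤ N] [Fintype I] in
theorem quotientCoords_bijective (A : I → AffineSubspace ℝ (ℝ ⊗[ℤ] N)) {c : I → ℕ}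
    (θ : ∀ i, N →ₗ[ℤ] (Fin (c i) → ℤ)) (hker : ∀ i v, θ i v = 0 ↔ v ∈ latticeDir (A i))
    (hθ : ∀ i, Function.Surjective (θ i)) : Function.Bijective (quotientCoords A θ hker) := by
  constructor
  · rw [injective_iff_map_eq_zero]
    intro y hy
    ext i
    obtain ⟨v, hv⟩ := QuotientAddGroup.mk_surjective (y i)
    rw [← hv]
    refine (QuotientAddGroup.eq_zero_iff v).2 ((hker i v).1 (funext fun a => ?_))
    have := congrFun hy ⟨i, a⟩
    change QuotientAddGroup.lift (latticeDir (A i)) (θ i).toAddMonoidHom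
      (fun v hv => (hker i v).2 hv) (y i) a = 0 at this
    rw [← hv] at this
    exact this
  · intro z
    choose v hv using fun i => hθ i fun a => z ⟨i, a⟩
    exact ⟨fun i => QuotientAddGroup.mk (v i), funext fun q => congrFun (hv q.1) q.2⟩

theorem mem_latticeEdge {e : E} (he : Γ.wt e ≠ 0) {v : N} :
    v ∈ Γ.latticeEdge e ↔ ∃ c : ℤ, v = c • Γ.dir e :=
  (Γ.dir_primitive e he).realPt_mem_span_iff

theorem exists_zsmul_comm {G : Type*} [AddCommGroup G] {a b u : G} :
    (∃ c : ℤ, a - b = c • u) ↔ ∃ c : ℤ, b - a = c • u := by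
  constructor <;> rintro ⟨c, hc⟩ <;> exact ⟨-c, by rw [neg_smul, ← hc, neg_sub]⟩

/-- As the edge components are surjective, only the leg components on their kernel matter. That
kernel consists of the configurations parametrised by `position`, and in the coordinates `θ` the leg
components become the endomorphism `f` of `ℤ^(r + k)`. -/
theorem index_Phi {k : ℕ} (o : TreeOrder Γ.src Γ.tgt k) (hw : ∀ e, Γ.wt e ≠ 0) {r : ℕ}
    (β : Basis (Fin r) ℤ N) (u : ℕ → N) (hu : ∀ i : Fin k, u i = Γ.dir (o.edge i))
    (A : I → AffineSubspace ℝ (ℝ ⊗[ℤ] N)) {c : I → ℕ} (θ : ∀ i, N →ₗ[ℤ] (Fin (c i) → ℤ))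
    (hθ : ∀ i, Function.Surjective (θ i)) (hker : ∀ i v, θ i v = 0 ↔ v ∈ latticeDir (A i))
    (num : I → ℕ) (hnum : ∀ i, num i ≤ k ∧ o.vert (num i) = Γ.leg i)
    (e : Fin (r + k) ≃ Σ i, Fin (c i)) :
    (Γ.Phi A).range.index = (Matrix.of fun q j => (LinearMap.proj (e q).2 ∘ₗ θ (e q).1 : Dual ℤ N)
      (position β o.parent u k (num (e q).1) (Pi.single j 1))).det.natAbs := by
  obtain ⟨idx, hidx⟩ := o.exists_index
  have hidx' : ∀ j ≤ k, idx (o.vert j) = j := fun j hj =>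
    (o.vert_inj (hidx _).1 hj).1 (hidx _).2
  let ψ : (∀ i, N ⧸ latticeDir (A i)) →+ (Fin (r + k) → ℤ) :=
    (LinearEquiv.funCongrLeft ℤ ℤ e).toLinearMap.toAddMonoidHom.comp (quotientCoords A θ hker)
  have hψ : Function.Bijective ψ :=
    (LinearEquiv.funCongrLeft ℤ ℤ e).bijective.comp (quotientCoords_bijective A θ hker hθ)
  let f : (Fin (r + k) → ℤ) →ₗ[ℤ] (Fin (r + k) → ℤ) := LinearMap.pi fun q =>
    LinearMap.proj (e q).2 ∘ₗ θ (e q).1 ∘ₗ position β o.parent u k (num (e q).1)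
  refine Eq.trans ?_ (index_range_eq_natAbs_det_matrix f)
  rw [index_range_prod _ (Phi_fst_surjective o A), ← AddSubgroup.index_map_of_bijective hψ]
  congr 1
  -- As all weights are positive, `L(E)` is generated by the primitive direction of `E`, and the
  -- orientation of `E` does not affect the condition.
  have hedge : ∀ H : V → N, H ∈ ((AddMonoidHom.fst _ _).comp (Γ.Phi A)).ker ↔
      ∀ i : Fin k, ∃ c : ℤ, H (o.vert (i + 1)) - H (o.vert (o.parent i)) = c • u i := by
    intro H
    have h1 : H ∈ ((AddMonoidHom.fst _ _).comp (Γ.Phi A)).ker ↔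
        ∀ e, H (Γ.tgt e) - H (Γ.src e) ∈ Γ.latticeEdge e :=
      funext_iff.trans (forall_congr' fun e => QuotientAddGroup.eq_zero_iff _)
    rw [h1, ← o.edge.forall_congr_right]
    refine forall_congr' fun i => ?_
    rw [mem_latticeEdge (hw _), hu]
    rcases o.joins i with ⟨h3, h4⟩ | ⟨h3, h4⟩
    · rw [h3, h4]
    · rw [h3, h4, exists_zsmul_comm]
  ext y
  constructor
  · rintro ⟨_, ⟨H, hH, rfl⟩, rfl⟩
    obtain ⟨x, hx⟩ := exists_position_eq β o.parent_le u k (fun j => H (o.vert j))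
      fun i hi => (hedge H).1 hH ⟨i, hi⟩
    refine ⟨x, funext fun q => ?_⟩
    change θ (e q).1 (position β o.parent u k (num (e q).1) x) (e q).2 =
      θ (e q).1 (H (Γ.leg (e q).1)) (e q).2
    rw [hx _ (hnum _).1, (hnum _).2]
  · rintro ⟨x, rfl⟩
    refine ⟨_, ⟨fun v => position β o.parent u k (idx v) x, (hedge _).2 fun i => ?_, rfl⟩,
      funext fun q => ?_⟩
    · have := o.parent_le i
      rw [hidx' _ (by omega), hidx' _ (by omega)]
      exact position_sub β o.parent_le u k x i.2
    · change θ (e q).1 (position β o.parent u k (idx (Γ.leg (e q).1)) x) (e q).2 =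
        θ (e q).1 (position β o.parent u k (num (e q).1) x) (e q).2
      rw [← (hnum (e q).1).2, hidx' _ (hnum _).1]

end TropicalCurve
end TropQFT

/-! ### The main theorem -/

namespace TropQFT
section
variable {N : Type*} [AddCommGroup N] [Module.Free ℤ N] [Module.Finite ℤ N]

omit [Module.Free ℤ N] [Module.Finite ℤ N] in
theorem rep_mk_eq_zero (f : Dual ℤ N) {n : N} (h : f n = 0) : f (NBar.mk n).rep = 0 := by
  rcases NBar.rep_mk n with h1 | h1 <;> simp [h1, h]

theorem boxInclusion_prod_boxSq (x : NBar N) {c : ℕ} (m : Fin c → Dual ℤ N)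
    (hm : ∀ a, m a x.rep = 0) (t : ℚ) :
    boxInclusion x (show boxAlg (Perp x.rep) from t • ∏ a, boxSq (Perp.mk (m a) (hm a))) =
      t • sqProd (List.ofFn fun a => (1 : ℚ) ⊗ₜ[ℤ] m a) := by
  change dmap (Perp.val.baseChange ℚ)
    (t • ((∏ a, boxSq (Perp.mk (m a) (hm a)) : boxAlg (Perp x.rep)) : DExt (ℚ ⊗[ℤ] Perp x.rep))) = _
  rw [map_smul, coe_prod_boxSq, dmap_sqProd, List.map_ofFn]
  rfl

end
end TropQFT

theorem mainTheorem7 {N : Type*} [AddCommGroup N] [Module.Free ℤ N] [Module.Finite ℤ N]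
    {V E I : Type*} [Fintype V] [Fintype E] [Fintype I] (Γ : TropicalCurve N V E I)
    (hg : Γ.genus = 0) (A : I → AffineSubspace ℝ (ℝ ⊗[ℤ] N)) (hA : ∀ i, IsRational (A i))
    (w : I → ℕ) (hw : ∀ i, 0 < w i) (s : I → ℕ) (hΓ : Γ.IsRigid A s)
    (α : I → ExteriorAlgebra ℤ (Dual ℤ N)) (hα : ∀ i, IsTropicalForm (A i) (w i) (α i)) :
    ∃ γ : ∀ i, (boxTrQFT N).C (Γ.toCobordism.deg i),
      (∀ i, boxInclusion _ (γ i) = square (codim (A i)) (α i)) ∧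
      ∀ φ : Γ.toCobordism.Flow,
        (boxTrQFT N).eval Γ.toCobordism φ (⨂ₜ[ℚ] i, γ i) = (Γ.mult A w : ℚ) ^ 2 := by
  classical
  choose θ hθ hker hsq using fun i => exists_coordinates_square (hw i) (hA i) (hα i)
  let m : ∀ i, Fin (codim (A i)) → Dual ℤ N := fun i a => LinearMap.proj a ∘ₗ θ i
  -- The leg lies in `A i`, so its direction is parallel to `A i` and is killed by the coordinates
  -- `θ i`. This puts the square of `α i` into the algebra of the degree of the leg.
  have hm : ∀ i a, m i a (Γ.toCobordism.deg i).rep = 0 := fun i a => by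
    refine rep_mk_eq_zero _ ?_
    have h1 : θ i (Γ.legDir i) = 0 := (hker i _).2 (TropicalCurve.legDir_mem hΓ.matches_ i)
    have h2 : θ i (Γ.degree i) = 0 := by rw [TropicalCurve.degree, map_nsmul, h1, smul_zero]
    exact congrFun h2 a
  refine ⟨fun i => show boxAlg (Perp (Γ.toCobordism.deg i).rep) from
    (w i : ℚ) ^ 2 • ∏ a, boxSq (Perp.mk (m i a) (hm i a)), fun i => ?_, fun φ => ?_⟩
  · rw [hsq i]
    exact boxInclusion_prod_boxSq _ (m i) (hm i) _
  obtain ⟨v₀⟩ := Γ.nonempty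
  have hgen := hΓ.nonSuperabundant.2.1
  have hwt := TropicalCurve.wt_ne_zero hg hΓ.nonSuperabundant
  obtain ⟨o⟩ := exists_treeOrder Γ.src Γ.tgt v₀ Γ.connected (TropicalCurve.card_edges hg hgen)
  obtain ⟨idx, hidx⟩ := o.exists_index
  -- The value `0` beyond the last edge is only a default and never enters the formulas.
  let u : ℕ → N := fun i => if h : i < Fintype.card E then Γ.dir (o.edge ⟨i, h⟩) else 0
  let wt : ℕ → ℕ := fun i => if h : i < Fintype.card E then Γ.wt (o.edge ⟨i, h⟩) else 0
  have hu : ∀ i : Fin (Fintype.card E), u i = Γ.dir (o.edge i) := fun i => dif_pos i.2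
  have hwt' : ∀ i : Fin (Fintype.card E), wt i = Γ.wt (o.edge i) := fun i => dif_pos i.2
  -- The codimension condition of rigidity makes the matrix square.
  have hcard : Fintype.card (Fin (finrank ℤ N + Fintype.card E)) =
      Fintype.card (Σ i, Fin (codim (A i))) := by
    have h1 := hΓ.codim
    rw [TropicalCurve.expectedDim_eq hg hgen] at h1
    rw [Fintype.card_sigma, Fintype.card_fin]
    simp only [Fintype.card_fin]
    exact_mod_cast h1.symm
  let e := Fintype.equivOfCardEq hcard
  rw [eval_boxTrQFT_eq_det Γ.toCobordism hgen o u wt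
    (fun i => by rw [hu, hwt']; rfl)
    (fun i h => by
      rw [hu, hwt', ← natCast_zsmul] at h
      rcases smul_eq_zero.1 h with h | h
      · exact hwt (o.edge i) (by exact_mod_cast h)
      · exact (Γ.dir_primitive _ (hwt _)).1 h)
    (Module.finBasis ℤ N) φ m hm (fun i => (w i : ℚ) ^ 2) (fun i => idx (Γ.leg i))
    (fun i => hidx _) e _ (fun i => rfl),
    TropicalCurve.mult, TropicalCurve.index_Phi o hwt (Module.finBasis ℤ N) u hu A θ hθ hker
      (fun i => idx (Γ.leg i)) (fun i => hidx _) e]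
  have h1 : ∏ i ∈ Finset.range (Fintype.card E), (wt i : ℚ) ^ 2 = (∏ e, (Γ.wt e : ℚ)) ^ 2 := by
    rw [Finset.prod_pow, Finset.prod_range, ← o.edge.prod_comp]
    simp only [hwt']
  rw [h1, Finset.prod_pow, Nat.cast_mul, Nat.cast_mul, Nat.cast_natAbs, Int.cast_abs, mul_pow,
    mul_pow, sq_abs, Nat.cast_prod, Nat.cast_prod]
  exact (mul_comm _ _).trans (mul_assoc _ _ _).symm
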